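/- **Theorem.** Let $G$ be a group which is hyperbolic relative to a finite family of subgroups $P_1,\dots,P_k$ ($k\ge 0$), each of infinite index in $G$. This means that for some finite generating set of $G$ the coned-off Cayley graph is hyperbolic and uniformly fine. Here the coned-off Cayley graph $\widehat{\mathrm{Cay}}(G)$ with respect to a finite generating set $S$ is the Cayley graph of $(G,S)$ together with one additional vertex for each $i$ and each left coset $gP_i$, joined by an edge to every element of $gP_i$. A connected graph is hyperbolic if for some $\delta>0$ each side of each geodesic triangle lies in the $\delta$-neighbourhood of the union of the other two sides. It is uniformly fine if for each $L\ge 0$ the number of simple loops of length at most $L$ containing a given edge is finite and bounded by a number depending only on $L$. Let $S$ be any finite generating set of $G$ and let $d$ be the graph metric of the corresponding coned-off Cayley graph. Then there exist a complex Hilbert space $H$ and an affine representation $\alpha$ of $G$ on $H$, $\alpha(g)v=\pi(g)v+c(g)$, where $\pi$ is a representation of $G$ by bounded linear operators (the linear part) and $c:G\to H$ satisfies the cocycle relation $c(gh)=c(g)+\pi(g)c(h)$, such that: 1. $\pi$ is polynomial of degree $2$: there are a function $\ell:G\to[0,\infty)$ with $\ell(g^{-1})=\ell(g)$ and $\ell(gh)\le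 \ell(g)+\ell(h)$ for all $g,h\in G$ (a length function), and a real polynomial $Q$ with $\deg Q=2$, such that $\|\pi(g)\|\le Q(\ell(g))$ for all $g\in G$; 2. $\alpha$ is proper for the metric of the coned-off graph: for every bounded set $B\subset H$ there is $R$ such that $d(1,g)\le R$ for every $g\in G$ with $\alpha(g)B\cap B\neq\emptyset$; 3. $\|c(g)\|\ge d(1,g)+1$ for all $g\in G$ with $g\ne 1$. -/

import Mathlib

open scoped Polynomial

universe u

namespace RelHyp

section Graphs

variable {V : Type*}

/-- A walk is a geodesic if its length is the graph distance between its endpoints. -/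
def IsGeodesic {X : SimpleGraph V} {x y : V} (p : X.Walk x y) : Prop :=
  p.length = X.dist x y

/-- Every vertex of `p` is at distance at most `δ` from some vertex of `q` or of `r`. -/
def SideThin (X : SimpleGraph V) (δ : ℝ) {x y x' y' x'' y'' : V}
    (p : X.Walk x y) (q : X.Walk x' y') (r : X.Walk x'' y'') : Prop :=
  ∀ a ∈ p.support, ∃ b, (b ∈ q.support ∨ b ∈ r.support) ∧ (X.dist a b : ℝ) ≤ δ

/-- A connected graph is `δ`-hyperbolic if every side of every geodesic triangle is contained in
the `δ`-neighbourhood of the union of the other two sides. -/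
def IsDeltaHyperbolic (X : SimpleGraph V) (δ : ℝ) : Prop :=
  X.Connected ∧
    ∀ (x y z : V) (p : X.Walk x y) (q : X.Walk y z) (r : X.Walk x z),
      IsGeodesic p → IsGeodesic q → IsGeodesic r →
        SideThin X δ p q r ∧ SideThin X δ q p r ∧ SideThin X δ r p q

def IsHyperbolic (X : SimpleGraph V) : Prop :=
  ∃ δ : ℝ, 0 < δ ∧ IsDeltaHyperbolic X δ

/-- The simple simplicial loops of length at most `L` containing the edge `e`. A loop is recorded
by its set of edges (so neither a base point nor an orientation is chosen). -/
def simpleLoops (X : SimpleGraph V) (L : ℕ) (e : Sym2 V) : Set (Set (Sym2 V)) :=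
  {C | ∃ (v : V) (p : X.Walk v v), p.IsCycle ∧ p.length ≤ L ∧ e ∈ p.edges ∧
    C = {e' | e' ∈ p.edges}}

/-- Uniformly fine graphs: the number of simple loops of length at most `L` through an edge is
finite, and bounded by a function of `L` only. -/
def IsUniformlyFine (X : SimpleGraph V) : Prop :=
  ∃ φ : ℕ → ℕ, ∀ L : ℕ, ∀ e ∈ X.edgeSet, (simpleLoops X L e).encard ≤ (φ L : ℕ∞)

end Graphs

section Groups

variable {G : Type*} [Group G]

/-- Vertices of the coned-off Cayley graph: the elements of `G`, and one cone vertex for each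
index `i` and each left coset of `P i`. -/
abbrev ConedOffVertex {k : ℕ} (P : Fin k → Subgroup G) : Type _ :=
  G ⊕ (Σ i : Fin k, G ⧸ P i)

/-- The adjacency relation of the coned-off Cayley graph: `g` and `g * s` are adjacent for `s ∈ S`
(when they are distinct), and each `g` is adjacent to the cone vertex of each coset `g (P i)`. -/
def conedOffAdj (S : Set G) {k : ℕ} (P : Fin k → Subgroup G) :
    ConedOffVertex P → ConedOffVertex P → Prop
  | Sum.inl g, Sum.inl h => g ≠ h ∧ (g⁻¹ * h ∈ S ∨ h⁻¹ * g ∈ S)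
  | Sum.inl g, Sum.inr c => (QuotientGroup.mk g : G ⧸ P c.1) = c.2
  | Sum.inr c, Sum.inl g => (QuotientGroup.mk g : G ⧸ P c.1) = c.2
  | Sum.inr _, Sum.inr _ => False

/-- The coned-off Cayley graph of `G` with respect to `S`, relative to the subgroups `P i`. -/
def conedOffGraph (S : Set G) {k : ℕ} (P : Fin k → Subgroup G) :
    SimpleGraph (ConedOffVertex P) where
  Adj := conedOffAdj S P
  symm := ⟨by
    rintro (g | c) (h | d) hgh
    · exact ⟨hgh.1.symm, hgh.2.symm⟩
    · exact hgh
    · exact hgh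
    · exact hgh⟩
  loopless := ⟨by
    rintro (g | c) h
    · exact h.1 rfl
    · exact h⟩

/-- The distance `d(1, g)` in the coned-off Cayley graph. -/
noncomputable def conedOffLength (S : Set G) {k : ℕ} (P : Fin k → Subgroup G) (g : G) : ℕ :=
  (conedOffGraph S P).dist (Sum.inl 1) (Sum.inl g)

/-- `G` is hyperbolic relative to `P 0, …, P (k - 1)`: it has a finite generating set whose
coned-off Cayley graph is hyperbolic and uniformly fine. -/
def IsRelativelyHyperbolic (G : Type*) [Group G] {k : ℕ} (P : Fin k → Subgroup G) : Prop :=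
  ∃ S : Finset G, Subgroup.closure (S : Set G) = ⊤ ∧
    IsHyperbolic (conedOffGraph (S : Set G) P) ∧ IsUniformlyFine (conedOffGraph (S : Set G) P)

/-- Length functions on a discrete group. -/
structure IsLengthFunction (l : G → ℝ) : Prop where
  nonneg : ∀ g, 0 ≤ l g
  inv : ∀ g, l g⁻¹ = l g
  mul_le : ∀ g h, l (g * h) ≤ l g + l h

/-- An affine representation of `G` on a complex Hilbert space: a linear representation by bounded
operators (the linear part) and a cocycle for it. -/
structure AffineRep (G : Type*) [Group G] (H : Type*) [NormedAddCommGroup H]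
    [InnerProductSpace ℂ H] where
  linear : G →* (H →L[ℂ] H)
  cocycle : G → H
  cocycle_mul : ∀ g h, cocycle (g * h) = cocycle g + linear g (cocycle h)

namespace AffineRep

variable {H : Type*} [NormedAddCommGroup H] [InnerProductSpace ℂ H]

/-- The action of `g` by the affine transformation `v ↦ π(g) v + c(g)`. -/
def act (α : AffineRep G H) (g : G) (v : H) : H :=
  α.linear g v + α.cocycle g

theorem act_one (α : AffineRep G H) (v : H) : α.act 1 v = v := by
  have h := α.cocycle_mul 1 1
  simp only [mul_one, map_one, one_apply_eq_self, left_eq_add] at h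
  simp [act, h]

theorem act_mul (α : AffineRep G H) (g h : G) (v : H) :
    α.act (g * h) v = α.act g (α.act h v) := by
  simp only [act, α.cocycle_mul, map_mul, mul_apply_eq_comp, map_add]
  abel

/-- The affine action is (metrically) proper with respect to `d : G → ℕ`: for each bounded set `B`,
the set of those `g` with `g B ∩ B ≠ ∅` is `d`-bounded. -/
def IsProperFor (α : AffineRep G H) (d : G → ℕ) : Prop :=
  ∀ B : Set H, Bornology.IsBounded B →
    ∃ R : ℕ, ∀ g : G, ((α.act g '' B) ∩ B).Nonempty → d g ≤ R

end AffineRep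

end Groups

end RelHyp

/-! A coned-off graph need not be locally finite, so local finiteness is replaced by what fineness
offers: call two edges neighbours if a simple loop of length at most `L` contains both; then every
edge has boundedly many neighbours. In a thin triangle every edge of one side has a neighbour on
another side (`exists_mem_edgeNhd`).

Fix a vertex `o` and a tree of geodesics from `o`. At a vertex `x`, the state of a target `z`
records the differences `dist q z - dist x z` for `q` in the finite cell of `x`; there are boundedly
many states. The path to `z` becomes a sequence of transitions, each consisting of a vertex with the
states before and after the step to it. For a finitely supported `f` of total mass zero, the flow
through a transition is the sum of `f` over the targets whose path uses it. The Hilbert norm is the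
square sum of all flows and of the weighted values `w v * f v`.

Translating `f` by `g` amounts to moving the base vertex. A flow for a tree at `o'` is a combination
of the flows for the tree at `o`: the indicator function of a transition, evaluated at
representatives of states, telescopes along paths, and mass zero removes the constant. The
coefficients have modulus at most `1`. If one is nonzero, a geodesic misses a cell, and thin
triangles place the edge in question near a set of edges under control; so rows and columns have at
most a constant times `1 + dist o o'` nonzero entries. Schur's test bounds the linear part by a
linear function of the length (`sum_norm_flow_sq_le`).

For properness, twice the Gromov product with `y` extends linearly to a functional whose squared
norm is at most a constant times `dist o y` (`norm_gromov_sq_le`). With `N = dist o (g • o)`, the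
functional of `g⁻¹ • o` at `f` and that of `g • o` at the image of `f` under the affine action add
up to `2 * N`. Hence `N` is bounded by the squared norms of `f` and of its image
(`dist_le_norm_sq`). The weight provides the lower bound on the cocycle, at the cost of a further
linear term in the bound for the linear part. -/

namespace RelHyp

variable {V : Type*} {X : SimpleGraph V}

/-! ### Geodesic walks -/

section Geodesics

open SimpleGraph

lemma IsGeodesic.dist_getVert_le {x y : V} (p : X.Walk x y) {i j : ℕ} (hij : i ≤ j) :
    X.dist (p.getVert i) (p.getVert j) ≤ j - i := by
  have h := X.dist_le ((p.drop i).take (j - i))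
  rw [Walk.take_length, Walk.drop_getVert, Nat.add_sub_cancel' hij] at h
  exact h.trans (min_le_left _ _)

lemma IsGeodesic.dist_getVert (hX : X.Connected) {x y : V} {p : X.Walk x y} (hp : IsGeodesic p)
    {i j : ℕ} (hij : i ≤ j) (hj : j ≤ p.length) :
    X.dist (p.getVert i) (p.getVert j) = j - i := by
  have h1 := IsGeodesic.dist_getVert_le p (Nat.zero_le i)
  have h2 := IsGeodesic.dist_getVert_le p hij
  have h3 := IsGeodesic.dist_getVert_le p hj
  rw [Walk.getVert_zero] at h1
  rw [Walk.getVert_length] at h3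
  have h4 := hX.dist_triangle (u := x) (v := p.getVert i) (w := y)
  have h5 := hX.dist_triangle (u := p.getVert i) (v := p.getVert j) (w := y)
  have h6 : p.length = X.dist x y := hp
  omega

lemma IsGeodesic.dist_start (hX : X.Connected) {x y : V} {p : X.Walk x y} (hp : IsGeodesic p)
    {i : ℕ} (hi : i ≤ p.length) : X.dist x (p.getVert i) = i := by
  simpa using hp.dist_getVert hX (Nat.zero_le i) hi

lemma IsGeodesic.dist_add (hX : X.Connected) {x y : V} {p : X.Walk x y} (hp : IsGeodesic p)
    {v : V} (hv : v ∈ p.support) : X.dist x v + X.dist v y = X.dist x y := by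
  obtain ⟨i, rfl, hi⟩ := Walk.mem_support_iff_exists_getVert.1 hv
  have h1 := hp.dist_start hX hi
  have h2 := hp.dist_getVert hX hi le_rfl
  rw [Walk.getVert_length] at h2
  have h3 : p.length = X.dist x y := hp
  omega

lemma IsGeodesic.append {x y z : V} {p : X.Walk x y} {q : X.Walk y z} (hp : IsGeodesic p)
    (hq : IsGeodesic q) (h : X.dist x z = X.dist x y + X.dist y z) : IsGeodesic (p.append q) := by
  simp only [IsGeodesic, Walk.length_append, h] at *
  omega

lemma exists_geodesic (hX : X.Connected) (x y : V) : ∃ p : X.Walk x y, IsGeodesic p :=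
  hX.exists_walk_length_eq_dist x y

lemma exists_getVert_of_mem_edges {x y : V} (p : X.Walk x y) {e : Sym2 V} (he : e ∈ p.edges) :
    ∃ i < p.length, e = s(p.getVert i, p.getVert (i + 1)) := by
  induction p with
  | nil => simp at he
  | cons h q ih =>
    rw [Walk.edges_cons, List.mem_cons] at he
    rcases he with rfl | he
    · exact ⟨0, by simp, by simp⟩
    · obtain ⟨i, hi, rfl⟩ := ih he
      exact ⟨i + 1, by simpa using hi, by simp⟩

lemma mem_edges_getVert {x y : V} (p : X.Walk x y) {i : ℕ} (hi : i < p.length) :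
    s(p.getVert i, p.getVert (i + 1)) ∈ p.edges := by
  induction p generalizing i with
  | nil => simp at hi
  | cons h q ih =>
    rcases i with _ | i
    · simp
    · simpa using Or.inr (ih (by simpa using hi))

lemma mem_support_of_mem_edges {x y : V} {p : X.Walk x y} {e : Sym2 V} (he : e ∈ p.edges) {v : V}
    (hv : v ∈ e) : v ∈ p.support := by
  obtain ⟨i, -, rfl⟩ := exists_getVert_of_mem_edges p he
  rcases Sym2.mem_iff.1 hv with rfl | rfl <;> exact Walk.getVert_mem_support _ _

/-- The two vertices can be joined by a walk of length at most `k`, all of whose edges satisfy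
`Good`. -/
def Linked (X : SimpleGraph V) (Good : Sym2 V → Prop) (k : ℕ) (a b : V) : Prop :=
  ∃ w : X.Walk a b, w.length ≤ k ∧ ∀ e ∈ w.edges, Good e

lemma Linked.trans {Good : Sym2 V → Prop} {k l : ℕ} {a b c : V} (h : Linked X Good k a b)
    (h' : Linked X Good l b c) : Linked X Good (k + l) a c := by
  obtain ⟨w, hw, hg⟩ := h
  obtain ⟨w', hw', hg'⟩ := h'
  refine ⟨w.append w', by simp; omega, fun e he => ?_⟩
  rw [Walk.edges_append, List.mem_append] at he
  exact he.elim (hg e) (hg' e)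

lemma Linked.symm {Good : Sym2 V → Prop} {k : ℕ} {a b : V} (h : Linked X Good k a b) :
    Linked X Good k b a := by
  obtain ⟨w, hw, hg⟩ := h
  exact ⟨w.reverse, by simpa using hw, fun e he => hg e (by simpa using he)⟩

lemma Linked.mono {Good : Sym2 V → Prop} {k l : ℕ} {a b : V} (h : Linked X Good k a b)
    (hkl : k ≤ l) : Linked X Good l a b :=
  h.imp fun _ hw => ⟨hw.1.trans hkl, hw.2⟩

lemma linked_getVert {Good : Sym2 V → Prop} {x y : V} (p : X.Walk x y) {i j : ℕ} (hij : i ≤ j)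
    (hj : j ≤ p.length)
    (hg : ∀ k, i ≤ k → k < j → Good s(p.getVert k, p.getVert (k + 1))) :
    Linked X Good (j - i) (p.getVert i) (p.getVert j) := by
  induction j, hij using Nat.le_induction with
  | base => exact ⟨Walk.nil, by simp, by simp⟩
  | succ j hij ih =>
    have h1 := ih (by omega) fun k hk hk' => hg k hk (by omega)
    have h2 : Linked X Good 1 (p.getVert j) (p.getVert (j + 1)) :=
      ⟨Walk.cons (p.adj_getVert_succ (by omega)) Walk.nil, by simp, by
        simpa using hg j hij (by omega)⟩
    exact (h1.trans h2).mono (by omega)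

lemma IsGeodesic.linked (hX : X.Connected) {Good : Sym2 V → Prop} {x y : V} {p : X.Walk x y}
    (hp : IsGeodesic p) (hg : ∀ e ∈ p.edges, Good e) {a b : V} (ha : a ∈ p.support)
    (hb : b ∈ p.support) : Linked X Good (X.dist a b) a b := by
  obtain ⟨i, rfl, hi⟩ := Walk.mem_support_iff_exists_getVert.1 ha
  obtain ⟨j, rfl, hj⟩ := Walk.mem_support_iff_exists_getVert.1 hb
  rcases le_total i j with hij | hij
  · rw [hp.dist_getVert hX hij hj]
    exact linked_getVert p hij hj fun k _ _ => hg _ (mem_edges_getVert p (by omega))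
  · rw [X.dist_comm, hp.dist_getVert hX hij hi]
    exact (linked_getVert p hij hi fun k _ _ => hg _ (mem_edges_getVert p (by omega))).symm

lemma linked_of_dist_le (hX : X.Connected) {Good : Sym2 V → Prop} {D : ℕ} {a b : V}
    (hab : X.dist a b ≤ D)
    (hg : ∀ e : Sym2 V, (∀ v ∈ e, X.dist a v ≤ D) → Good e) : Linked X Good D a b := by
  obtain ⟨p, hp⟩ := exists_geodesic hX a b
  refine ⟨p, hp.le.trans hab, fun e he => hg e fun v hv => ?_⟩
  have := hp.dist_add hX (mem_support_of_mem_edges he hv)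
  omega

end Geodesics

/-! ### Thin triangles -/

section Triangles

open SimpleGraph

/-- Geodesic triangles are `D`-thin, for a natural number `D`. -/
def ThinTriangles (X : SimpleGraph V) (D : ℕ) : Prop :=
  ∀ ⦃x y z : V⦄ (p : X.Walk x y) (q : X.Walk y z) (r : X.Walk x z),
    IsGeodesic p → IsGeodesic q → IsGeodesic r →
      (∀ a ∈ p.support, ∃ b, (b ∈ q.support ∨ b ∈ r.support) ∧ X.dist a b ≤ D) ∧
      (∀ a ∈ r.support, ∃ b, (b ∈ p.support ∨ b ∈ q.support) ∧ X.dist a b ≤ D)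

lemma IsDeltaHyperbolic.thinTriangles {δ : ℝ} (h : IsDeltaHyperbolic X δ) :
    ThinTriangles X ⌈δ⌉₊ := by
  intro x y z p q r hp hq hr
  obtain ⟨h1, -, h3⟩ := h.2 x y z p q r hp hq hr
  have key : ∀ {a b : V}, (X.dist a b : ℝ) ≤ δ → X.dist a b ≤ ⌈δ⌉₊ := fun h => by
    exact_mod_cast h.trans (Nat.le_ceil δ)
  exact ⟨fun a ha => (h1 a ha).imp fun b hb => ⟨hb.1, key hb.2⟩,
    fun a ha => (h3 a ha).imp fun b hb => ⟨hb.1, key hb.2⟩⟩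

/-- The edge `e` together with the edges lying on a common simple loop of length at most `L`
with `e`. -/
def edgeNhd (X : SimpleGraph V) (L : ℕ) (e : Sym2 V) : Set (Sym2 V) :=
  {f | f = e ∨ ∃ (v : V) (p : X.Walk v v), p.IsCycle ∧ p.length ≤ L ∧ e ∈ p.edges ∧ f ∈ p.edges}

lemma mem_edgeNhd_self (L : ℕ) (e : Sym2 V) : e ∈ edgeNhd X L e := Or.inl rfl

lemma edgeNhd_symm {L : ℕ} {e f : Sym2 V} (h : f ∈ edgeNhd X L e) : e ∈ edgeNhd X L f := by
  rcases h with rfl | ⟨v, p, hp, hl, he, hf⟩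
  · exact Or.inl rfl
  · exact Or.inr ⟨v, p, hp, hl, hf, he⟩

lemma mem_edgeSet_of_mem_edgeNhd {L : ℕ} {e f : Sym2 V} (h : f ∈ edgeNhd X L e)
    (he : e ∈ X.edgeSet) : f ∈ X.edgeSet := by
  rcases h with rfl | ⟨v, p, hp, hl, -, hf⟩
  · exact he
  · exact p.edges_subset_edgeSet hf

/-- A common loop, rotated to start at `v`, reaches `w` within `L` steps; `1 ≤ L` serves the case of
a single edge. -/
lemma dist_le_of_mem_edgeNhd {L : ℕ} (hL : 1 ≤ L) {e f : Sym2 V}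
    (h : f ∈ edgeNhd X L e) (he : e ∈ X.edgeSet) {v w : V} (hv : v ∈ e) (hw : w ∈ f) :
    X.dist v w ≤ L := by
  classical
  rcases h with rfl | ⟨u, p, hp, hl, hep, hfp⟩
  · by_cases hvw : v = w
    · simp [hvw]
    · have : f = s(v, w) := ((Sym2.mem_and_mem_iff hvw).1 ⟨hv, hw⟩)
      subst this
      have : X.dist v w = 1 := dist_eq_one_iff_adj.2 he
      omega
  · have hv' := mem_support_of_mem_edges hep hv
    have hw' := mem_support_of_mem_edges hfp hw
    have hw'' : w ∈ (p.rotate v hv').support := by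
      rw [Walk.mem_support_rotate_iff]; exact hw'
    have h1 := X.dist_le ((p.rotate v hv').takeUntil w hw'')
    have h2 := (p.rotate v hv').length_takeUntil_le_length hw''
    rw [Walk.length_rotate] at h2
    omega

section Loop

variable {o p z : V} (α : X.Walk o p) (β : X.Walk p z) (γ : X.Walk o z) (n : ℕ)

/-- The edges that may occur on the loop through the `n`-th edge of the side `γ` of a geodesic
triangle. -/
def GoodEdge (e : Sym2 V) : Prop :=
  e ∈ α.edges ∨ e ∈ β.edges ∨ (∀ v ∈ e, X.dist o v < n) ∨ (∀ v ∈ e, n < X.dist o v) ∨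
    (0 < n ∧ e = s(γ.getVert (n - 1), γ.getVert n))

variable {α β γ n}

/-- Levels are distances from `o`. A geodesic of length at most `D` that starts more than `D` below
level `n` never reaches that level. -/
lemma linked_low (hX : X.Connected) {D : ℕ} {a b : V} (hab : X.dist a b ≤ D)
    (h : X.dist o a + D < n) : Linked X (GoodEdge α β γ n) D a b := by
  refine linked_of_dist_le hX hab fun e he => Or.inr (Or.inr (Or.inl fun v hv => ?_))
  have h1 := he v hv
  have h2 := hX.dist_triangle (u := o) (v := a) (w := v)
  omega

lemma linked_high (hX : X.Connected) {D : ℕ} {a b : V} (hab : X.dist a b ≤ D)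
    (h : n + D < X.dist o a) : Linked X (GoodEdge α β γ n) D a b := by
  refine linked_of_dist_le hX hab fun e he => Or.inr (Or.inr (Or.inr (Or.inl fun v hv => ?_)))
  have h1 := he v hv
  have h2 := hX.dist_triangle (u := o) (v := v) (w := a)
  rw [X.dist_comm (u := v)] at h2
  omega

lemma linked_left (hX : X.Connected) (hα : IsGeodesic α) {a b : V} (ha : a ∈ α.support)
    (hb : b ∈ α.support) : Linked X (GoodEdge α β γ n) (X.dist a b) a b :=
  hα.linked hX (fun _ he => Or.inl he) ha hb

lemma linked_right (hX : X.Connected) (hβ : IsGeodesic β) {a b : V} (ha : a ∈ β.support)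
    (hb : b ∈ β.support) : Linked X (GoodEdge α β γ n) (X.dist a b) a b :=
  hβ.linked hX (fun _ he => Or.inr (Or.inl he)) ha hb

/-- The configuration to be reached: vertices of `γ` on both sides of the `n`-th edge which are
linked by a short walk. -/
lemma exists_linked (hX : X.Connected) {D : ℕ} (hT : ThinTriangles X D) (hα : IsGeodesic α)
    (hβ : IsGeodesic β) (hγ : IsGeodesic γ) (hn : n < γ.length) :
    ∃ l₁ l₂, l₁ ≤ n ∧ n + 1 ≤ l₂ ∧ l₂ ≤ γ.length ∧ n ≤ l₁ + (2 * D + 2) ∧ l₂ ≤ n + (2 * D + 3) ∧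
      Linked X (GoodEdge α β γ n) (20 * D + 20) (γ.getVert l₁) (γ.getVert l₂) := by
  -- Go back `D + 1` levels along `γ`, or to `o` if that is nearer; the margin keeps a jump of
  -- length `D` from `γ` to another side below level `n`.
  obtain ⟨l₁, s, hl₁, hl₁', hs, hs', hsl⟩ : ∃ l₁ s, l₁ ≤ n ∧ (l₁ = 0 ∧ n ≤ D + 1 ∧ s ∈ α.support ∨
      l₁ + (D + 1) = n) ∧ (s ∈ α.support ∨ s ∈ β.support) ∧ X.dist (γ.getVert l₁) s ≤ D ∧
      Linked X (GoodEdge α β γ n) D (γ.getVert l₁) s := by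
    rcases lt_or_ge n (D + 1) with h | h
    · refine ⟨0, o, by omega, Or.inl ⟨rfl, by omega, α.start_mem_support⟩,
        Or.inl α.start_mem_support, by simp, ?_⟩
      rw [Walk.getVert_zero]
      exact ⟨Walk.nil, by simp, by simp⟩
    · obtain ⟨s, hs, hd⟩ := (hT α β γ hα hβ hγ).2 (γ.getVert (n - (D + 1)))
        (γ.getVert_mem_support _)
      refine ⟨n - (D + 1), s, by omega, Or.inr (by omega), hs, hd, linked_low hX hd ?_⟩
      rw [hγ.dist_start hX (by omega)]
      omega
  obtain ⟨l₂, s', hl₂, hl₂b, hl₂', ht, ht', htl⟩ : ∃ l₂ s', n + 1 ≤ l₂ ∧ l₂ ≤ γ.length ∧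
      (l₂ ≤ n + (D + 1) ∧ s' ∈ β.support ∨
      l₂ = n + (D + 1)) ∧ (s' ∈ α.support ∨ s' ∈ β.support) ∧ X.dist (γ.getVert l₂) s' ≤ D ∧
      Linked X (GoodEdge α β γ n) D (γ.getVert l₂) s' := by
    rcases lt_or_ge γ.length (n + (D + 1)) with h | h
    · refine ⟨γ.length, z, by omega, le_rfl, Or.inl ⟨by omega, β.end_mem_support⟩,
        Or.inr β.end_mem_support, by simp, ?_⟩
      rw [Walk.getVert_length]
      exact ⟨Walk.nil, by simp, by simp⟩
    · obtain ⟨s', hs', hd⟩ := (hT α β γ hα hβ hγ).2 (γ.getVert (n + (D + 1)))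
        (γ.getVert_mem_support _)
      refine ⟨n + (D + 1), s', by omega, h, Or.inr rfl, hs', hd, linked_high hX hd ?_⟩
      rw [hγ.dist_start hX h]
      omega
  have hlev₁ := hγ.dist_start hX (i := l₁) (by omega)
  have hlev₂ := hγ.dist_start hX (i := l₂) (by omega)
  have hdist := hγ.dist_getVert hX (i := l₁) (j := l₂) (by omega) hl₂b
  have t1 := hX.dist_triangle (u := o) (v := γ.getVert l₁) (w := s)
  have t2 := hX.dist_triangle (u := o) (v := s) (w := γ.getVert l₁)
  have t3 := hX.dist_triangle (u := o) (v := γ.getVert l₂) (w := s')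
  have t4 := hX.dist_triangle (u := o) (v := s') (w := γ.getVert l₂)
  have t5 := hX.dist_triangle (u := s) (v := γ.getVert l₁) (w := s')
  have t6 := hX.dist_triangle (u := γ.getVert l₁) (v := γ.getVert l₂) (w := s')
  rw [X.dist_comm (u := s) (v := γ.getVert l₁)] at t2 t5
  rw [X.dist_comm (u := s') (v := γ.getVert l₂)] at t4
  by_cases hsα : s ∈ α.support
  · by_cases htα : s' ∈ α.support
    · exact ⟨l₁, l₂, hl₁, hl₂, hl₂b, by omega, by omega,
        ((hsl.trans (linked_left hX hα hsα htα)).trans htl.symm).mono (by omega)⟩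
    have htβ : s' ∈ β.support := ht.resolve_left htα
    -- From `α` to `β`: if `α` ends below level `n + D + 1`, turn at `p`. Otherwise jump off `α` at
    -- that level; if the jump lands on `γ`, the landing vertex replaces the one of index `l₂`.
    rcases lt_or_ge α.length (n + (D + 1)) with h | h
    · have h1 := hα.dist_add hX hsα
      have h2 : α.length = X.dist o p := hα
      have t7 := hX.dist_triangle (u := p) (v := s) (w := s')
      rw [X.dist_comm (u := p) (v := s)] at t7
      exact ⟨l₁, l₂, hl₁, hl₂, hl₂b, by omega, by omega,
        (((hsl.trans (linked_left hX hα hsα α.end_mem_support)).trans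
          (linked_right hX hβ β.start_mem_support htβ)).trans htl.symm).mono (by omega)⟩
    · obtain ⟨v, hv, hd⟩ := (hT α β γ hα hβ hγ).1 (α.getVert (n + (D + 1)))
        (α.getVert_mem_support _)
      have ha := hα.dist_start hX h
      have hsa : X.dist s (α.getVert (n + (D + 1))) ≤ 3 * D + 4 := by
        obtain ⟨i, rfl, hi⟩ := Walk.mem_support_iff_exists_getVert.1 hsα
        have hi' := hα.dist_start hX hi
        rcases le_total i (n + (D + 1)) with hc | hc
        · rw [hα.dist_getVert hX hc h]; omega
        · rw [X.dist_comm, hα.dist_getVert hX hc hi]; omega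
      set a := α.getVert (n + (D + 1)) with ha_def
      have haα : a ∈ α.support := α.getVert_mem_support _
      have hav : Linked X (GoodEdge α β γ n) D a v := linked_high hX hd (by omega)
      have t8 := hX.dist_triangle (u := o) (v := a) (w := v)
      have t9 := hX.dist_triangle (u := o) (v := v) (w := a)
      rw [X.dist_comm (u := v)] at t9
      rcases hv with hv | hv
      · have t10 := hX.dist_triangle (u := v) (v := a) (w := s')
        have t11 := hX.dist_triangle (u := a) (v := s) (w := s')
        rw [X.dist_comm (u := v) (v := a)] at t10
        rw [X.dist_comm (u := a) (v := s)] at t11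
        exact ⟨l₁, l₂, hl₁, hl₂, hl₂b, by omega, by omega,
          ((((hsl.trans (linked_left hX hα hsα haα)).trans hav).trans
            (linked_right hX hβ hv htβ)).trans htl.symm).mono (by omega)⟩
      · obtain ⟨l, rfl, hl⟩ := Walk.mem_support_iff_exists_getVert.1 hv
        have h5 := hγ.dist_start hX hl
        exact ⟨l₁, l, hl₁, by omega, hl, by omega, by omega,
          ((hsl.trans (linked_left hX hα hsα haα)).trans hav).mono (by omega)⟩
  · have hsβ : s ∈ β.support := hs.resolve_left hsα
    by_cases htβ : s' ∈ β.support
    · exact ⟨l₁, l₂, hl₁, hl₂, hl₂b, by omega, by omega,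
        ((hsl.trans (linked_right hX hβ hsβ htβ)).trans htl.symm).mono (by omega)⟩
    have htα : s' ∈ α.support := ht.resolve_right htβ
    -- The choice `s = o` is excluded, as `o` lies on `α`. The change between `β` and `α` is made at
    -- level `n - (D + 1)` of `α`.
    have hn' : l₁ + (D + 1) = n := by
      rcases hl₁' with h | h
      · exact absurd h.2.2 hsα
      · exact h
    have hlα : n - (D + 1) ≤ α.length := by
      have h1 := hα.dist_add hX htα
      have h2 : α.length = X.dist o p := hα
      omega
    obtain ⟨v, hv, hd⟩ := (hT α β γ hα hβ hγ).1 (α.getVert (n - (D + 1)))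
        (α.getVert_mem_support _)
    have ha := hα.dist_start hX hlα
    have hsa : X.dist (α.getVert (n - (D + 1))) s' ≤ 3 * D + 4 := by
      obtain ⟨i, rfl, hi⟩ := Walk.mem_support_iff_exists_getVert.1 htα
      have hi' := hα.dist_start hX hi
      rcases le_total (n - (D + 1)) i with hc | hc
      · rw [hα.dist_getVert hX hc hi]; omega
      · rw [X.dist_comm, hα.dist_getVert hX hc hlα]; omega
    set a := α.getVert (n - (D + 1)) with ha_def
    have haα : a ∈ α.support := α.getVert_mem_support _
    have hav : Linked X (GoodEdge α β γ n) D a v := linked_low hX hd (by omega)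
    have t8 := hX.dist_triangle (u := o) (v := a) (w := v)
    have t9 := hX.dist_triangle (u := o) (v := v) (w := a)
    rw [X.dist_comm (u := v)] at t9
    rcases hv with hv | hv
    · have t10 := hX.dist_triangle (u := s) (v := s') (w := v)
      have t11 := hX.dist_triangle (u := s') (v := a) (w := v)
      rw [X.dist_comm (u := s') (v := a)] at t11
      exact ⟨l₁, l₂, hl₁, hl₂, hl₂b, by omega, by omega,
        ((((hsl.trans (linked_right hX hβ hsβ hv)).trans hav.symm).trans
          (linked_left hX hα haα htα)).trans htl.symm).mono (by omega)⟩
    · obtain ⟨l, rfl, hl⟩ := Walk.mem_support_iff_exists_getVert.1 hv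
      have h5 := hγ.dist_start hX hl
      exact ⟨l, l₂, by omega, hl₂, hl₂b, by omega, by omega,
        ((hav.symm.trans (linked_left hX hα haα htα)).trans htl.symm).mono (by omega)⟩

/-- Good edges on neither `α` nor `β` lie strictly below level `n`, strictly above it, or between
levels `n - 1` and `n`, so none of them crosses from level `n` to `n + 1`. -/
lemma exists_goodEdge_of_crossing {a b : V} (w : X.Walk a b)
    (hg : ∀ e ∈ w.edges, GoodEdge α β γ n e) (hX : X.Connected) (hγ : IsGeodesic γ)
    (hn : n < γ.length) (ha : X.dist o a ≤ n)
    (hb : n < X.dist o b) : ∃ e ∈ w.edges, e ∈ α.edges ∨ e ∈ β.edges := by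
  induction w with
  | nil => omega
  | @cons u v _ h q ih =>
    by_cases hv : X.dist o v ≤ n
    · obtain ⟨e, he, h'⟩ := ih (fun e he => hg e (by simp [he])) hv hb
      exact ⟨e, by simp [he], h'⟩
    · rcases hg s(u, v) (by simp) with h1 | h1 | h1 | h1 | ⟨h0, h1⟩
      · exact ⟨_, by simp, Or.inl h1⟩
      · exact ⟨_, by simp, Or.inr h1⟩
      · have := h1 v (by simp); omega
      · have := h1 u (by simp); omega
      · have hv' : v ∈ s(γ.getVert (n - 1), γ.getVert n) := h1 ▸ (by simp)
        have e1 := hγ.dist_start hX (i := n - 1) (by omega)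
        have e2 := hγ.dist_start hX (i := n) (by omega)
        rcases Sym2.mem_iff.1 hv' with rfl | rfl <;> omega

/-- Every edge of a side of a geodesic triangle shares a short simple loop with an edge of one of
the other sides; the loop leaves the first endpoint of the edge along one of those sides, or
backwards. -/
theorem exists_mem_edgeNhd (hX : X.Connected) {D : ℕ} (hT : ThinTriangles X D) {L : ℕ}
    (hL : 24 * D + 26 ≤ L) (hα : IsGeodesic α) (hβ : IsGeodesic β) (hγ : IsGeodesic γ)
    (hn : n < γ.length) :
    (∃ f ∈ edgeNhd X L s(γ.getVert n, γ.getVert (n + 1)), f ∈ α.edges ∨ f ∈ β.edges) ∧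
    (γ.getVert n ∉ β.support → ∃ f ∈ edgeNhd X L s(γ.getVert n, γ.getVert (n + 1)),
      γ.getVert n ∈ f ∧ (f ∈ α.edges ∨ (0 < n ∧ f = s(γ.getVert (n - 1), γ.getVert n)))) := by
  classical
  set e := s(γ.getVert n, γ.getVert (n + 1)) with he
  have lev0 := hγ.dist_start hX (i := n) (by omega)
  have lev1 := hγ.dist_start hX (i := n + 1) (by omega)
  by_cases hside : e ∈ α.edges ∨ e ∈ β.edges
  · refine ⟨⟨e, mem_edgeNhd_self L e, hside⟩, fun hc => ⟨e, mem_edgeNhd_self L e, by simp [he], Or.inl ?_⟩⟩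
    refine hside.resolve_right fun h => hc (mem_support_of_mem_edges h (by simp [he]))
  obtain ⟨l₁, l₂, h1, h2, h3, h4, h5, hW⟩ := exists_linked (n := n) hX hT hα hβ hγ hn
  -- The only edge of this piece touching level `n` is the one admitted by the last clause of
  -- `GoodEdge`.
  have back : Linked X (GoodEdge α β γ n) (n - l₁) (γ.getVert n) (γ.getVert l₁) := by
    refine (linked_getVert γ h1 (by omega) fun k hk hk' => ?_).symm
    rcases Nat.lt_or_ge (k + 1) n with h | h
    · refine Or.inr (Or.inr (Or.inl fun v hv => ?_))
      have e1 := hγ.dist_start hX (i := k) (by omega)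
      have e2 := hγ.dist_start hX (i := k + 1) (by omega)
      rcases Sym2.mem_iff.1 hv with rfl | rfl <;> omega
    · refine Or.inr (Or.inr (Or.inr (Or.inr ⟨by omega, ?_⟩)))
      have : k = n - 1 := by omega
      subst this
      rw [Nat.sub_add_cancel (by omega)]
  have forw : Linked X (GoodEdge α β γ n) (l₂ - (n + 1)) (γ.getVert l₂) (γ.getVert (n + 1)) := by
    refine (linked_getVert γ h2 h3 fun k hk hk' => ?_).symm
    refine Or.inr (Or.inr (Or.inr (Or.inl fun v hv => ?_)))
    have e1 := hγ.dist_start hX (i := k) (by omega)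
    have e2 := hγ.dist_start hX (i := k + 1) (by omega)
    rcases Sym2.mem_iff.1 hv with rfl | rfl <;> omega
  obtain ⟨w, hwl, hwg⟩ := (back.trans hW).trans forw
  have hbyg : ∀ f ∈ w.bypass.edges, GoodEdge α β γ n f := fun f hf =>
    hwg f (w.edges_bypass_subset_edges hf)
  -- The pieces have lengths at most `2 * D + 2`, `20 * D + 20` and `2 * D + 2`; one more edge will
  -- close the loop.
  have hbyl : w.bypass.length ≤ 24 * D + 25 := w.length_bypass_le_length.trans (by omega)
  have hbyp := w.bypass_isPath
  generalize w.bypass = q at hbyg hbyl hbyp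
  have hadj : X.Adj (γ.getVert n) (γ.getVert (n + 1)) := γ.adj_getVert_succ hn
  -- The edge `e` joins levels `n` and `n + 1` and is on neither other side, so it is not good. The
  -- path therefore avoids `e`, and adding `e` gives a simple loop.
  have heg : ¬ GoodEdge α β γ n e := by
    rintro (h | h | h | h | ⟨h0, h⟩)
    · exact hside (Or.inl h)
    · exact hside (Or.inr h)
    · have := h _ (Sym2.mem_mk_left _ _); omega
    · have := h _ (Sym2.mem_mk_left _ _); omega
    · have hm : γ.getVert (n + 1) ∈ s(γ.getVert (n - 1), γ.getVert n) := h ▸ (by simp [he])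
      have e1 := hγ.dist_start hX (i := n - 1) (by omega)
      rcases Sym2.mem_iff.1 hm with hm | hm <;> rw [hm] at lev1 <;> omega
  have hcyc : (Walk.cons hadj.symm q).IsCycle := by
    rw [Walk.cons_isCycle_iff]
    refine ⟨hbyp, fun h => heg (hbyg e ?_)⟩
    rwa [Sym2.eq_swap] at h
  have hnhd : ∀ f ∈ q.edges, f ∈ edgeNhd X L e := fun f hf =>
    Or.inr ⟨_, _, hcyc, by simp; omega, by simp [he, Sym2.eq_swap], by simp [hf]⟩
  constructor
  · obtain ⟨f, hf, h⟩ := exists_goodEdge_of_crossing q hbyg hX hγ hn (by omega) (by omega)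
    exact ⟨f, hnhd f hf, h⟩
  · intro hc
    have hql : 0 < q.length := by
      by_contra h0
      have h0' := X.dist_le q
      rw [dist_eq_one_iff_adj.2 hadj] at h0'
      omega
    have hf := mem_edges_getVert q hql
    rw [Walk.getVert_zero] at hf
    refine ⟨_, hnhd _ hf, Sym2.mem_mk_left _ _, ?_⟩
    -- The first edge of the path has an endpoint of level exactly `n`, so it is neither low nor
    -- high.
    rcases hbyg _ hf with h | h | h | h | h
    · exact Or.inl h
    · exact absurd (mem_support_of_mem_edges h (Sym2.mem_mk_left _ _)) hc
    · have := h _ (Sym2.mem_mk_left _ _); omega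
    · have := h _ (Sym2.mem_mk_left _ _); omega
    · exact Or.inr h

end Loop

end Triangles

end RelHyp

namespace RelHyp

variable {V : Type*} {X : SimpleGraph V}

open SimpleGraph

/-! ### Systems of geodesics issuing from a vertex -/

/-- The neighbours of `x` lying on a geodesic from `x` to `z`. -/
def toward (X : SimpleGraph V) (z x : V) : Set V :=
  {w | X.Adj x w ∧ X.dist w z + 1 = X.dist x z}

/-- A choice of geodesics from `o` to all vertices, which form a tree, and such that each step is
determined by the set of all neighbours leading towards the target. -/
structure PathSystem (X : SimpleGraph V) (o : V) where
  path : V → ℕ → V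
  path_zero : ∀ z, path z 0 = o
  path_dist : ∀ z, path z (X.dist o z) = z
  path_adj : ∀ z i, i < X.dist o z → X.Adj (path z i) (path z (i + 1))
  path_path : ∀ z i k, k ≤ i → i ≤ X.dist o z → path (path z i) k = path z k
  path_succ_eq : ∀ z₁ z₂ i, i < X.dist o z₁ → i < X.dist o z₂ → path z₁ i = path z₂ i →
    toward X z₁ (path z₁ i) = toward X z₂ (path z₁ i) → path z₁ (i + 1) = path z₂ (i + 1)

lemma toward_nonempty (hX : X.Connected) {z x : V} (h : x ≠ z) : (toward X z x).Nonempty := by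
  obtain ⟨p, hp⟩ := exists_geodesic hX x z
  have hpos : 0 < p.length := by
    rw [show p.length = X.dist x z from hp]
    exact hX.pos_dist_of_ne h
  refine ⟨p.getVert 1, ?_, ?_⟩
  · simpa using p.adj_getVert_succ hpos
  · have h1 := hp.dist_add hX (p.getVert_mem_support 1)
    have h2 := hp.dist_start hX (i := 1) hpos
    omega

section Existence

/-- The step towards `z` given by a well-order of the vertices. -/
noncomputable def stepToward (X : SimpleGraph V) (z x : V) : V :=
  open Classical in
  if h : (toward X z x).Nonempty then WellFounded.min (IsWellFounded.wf (r := WellOrderingRel)) _ h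
  else x

lemma stepToward_mem {z x : V} (h : (toward X z x).Nonempty) :
    stepToward X z x ∈ toward X z x := by
  rw [stepToward, dif_pos h]
  exact WellFounded.min_mem _ _ h

/-- The least element of a set is also the least element of any subset that contains it. -/
lemma stepToward_eq_of_subset {z z' x : V} (h : toward X z' x ⊆ toward X z x)
    (hm : stepToward X z x ∈ toward X z' x) : stepToward X z' x = stepToward X z x := by
  have h' : (toward X z' x).Nonempty := ⟨_, hm⟩
  have hn : (toward X z x).Nonempty := ⟨_, h hm⟩
  have h1 : ¬ WellOrderingRel (stepToward X z x) (stepToward X z' x) := by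
    rw [stepToward, stepToward, dif_pos h', dif_pos hn] at *
    exact WellFounded.not_lt_min _ _ hm
  have h2 : ¬ WellOrderingRel (stepToward X z' x) (stepToward X z x) := by
    rw [stepToward, stepToward, dif_pos h', dif_pos hn] at *
    exact WellFounded.not_lt_min _ _ (h (WellFounded.min_mem _ _ h'))
  rcases trichotomous_of WellOrderingRel (stepToward X z' x) (stepToward X z x) with h | h | h
  · exact absurd h h2
  · exact h
  · exact absurd h h1

lemma dist_iterate_stepToward (hX : X.Connected) (o z : V) {i : ℕ} (hi : i ≤ X.dist o z) :
    X.dist ((stepToward X z)^[i] o) z + i = X.dist o z := by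
  induction i with
  | zero => simp
  | succ i ih =>
    have h1 := ih (by omega)
    rw [Function.iterate_succ_apply']
    have hne : (stepToward X z)^[i] o ≠ z := by
      intro h; rw [h] at h1; simp at h1; omega
    have := (stepToward_mem (toward_nonempty hX hne)).2
    omega

/-- Always taking the least neighbour towards the target makes each step a function of `toward`
alone. The paths form a tree: if `y` lies further along the path to `z`, the neighbours leading to
`y` are among those leading to `z`, and the chosen one is among them. -/
lemma exists_pathSystem (hX : X.Connected) (o : V) : Nonempty (PathSystem X o) := by
  have hne : ∀ z i, i < X.dist o z → (stepToward X z)^[i] o ≠ z := by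
    intro z i hi h
    have h1 := dist_iterate_stepToward hX o z hi.le
    rw [h] at h1; simp at h1; omega
  have hmem : ∀ z i, i < X.dist o z →
      (stepToward X z)^[i + 1] o ∈ toward X z ((stepToward X z)^[i] o) := by
    intro z i hi
    rw [Function.iterate_succ_apply']
    exact stepToward_mem (toward_nonempty hX (hne z i hi))
  have hdo : ∀ z i, i ≤ X.dist o z → X.dist o ((stepToward X z)^[i] o) ≤ i := by
    intro z i
    induction i with
    | zero => simp
    | succ i ih =>
      intro hi
      have h1 := ih (by omega)
      have h2 := dist_eq_one_iff_adj.2 (hmem z i (by omega)).1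
      have h3 := hX.dist_triangle (u := o) (v := (stepToward X z)^[i] o)
        (w := (stepToward X z)^[i + 1] o)
      omega
  refine ⟨⟨fun z i => (stepToward X z)^[i] o, fun z => rfl, fun z => ?_, fun z i hi => ?_,
    fun z i k hk hi => ?_, fun z₁ z₂ i h1 h2 he ht => ?_⟩⟩
  · have := dist_iterate_stepToward hX o z le_rfl
    exact hX.dist_eq_zero_iff.1 (by omega)
  · exact (hmem z i hi).1
  · induction k with
    | zero => rfl
    | succ k ih =>
      have ih' := ih (by omega)
      rw [Function.iterate_succ_apply', Function.iterate_succ_apply', ih']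
      set x := (stepToward X z)^[k] o with hx
      set y := (stepToward X z)^[i] o with hy
      have a1 := dist_iterate_stepToward hX o z (i := k) (by omega)
      have a2 := dist_iterate_stepToward hX o z hi
      rw [← hx] at a1
      rw [← hy] at a2
      have hdist : ∀ j, k ≤ j → j ≤ i →
          X.dist ((stepToward X z)^[j] o) y ≤ i - j := by
        intro j hkj hji
        have : ∀ m, j + m ≤ i → X.dist ((stepToward X z)^[j] o)
            ((stepToward X z)^[j + m] o) ≤ m := by
          intro m
          induction m with
          | zero => simp
          | succ m ihm =>
            intro hm
            have b1 := ihm (by omega)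
            have b2 := dist_eq_one_iff_adj.2 (hmem z (j + m) (by omega)).1
            have b3 := hX.dist_triangle (u := (stepToward X z)^[j] o)
              (v := (stepToward X z)^[j + m] o) (w := (stepToward X z)^[j + m + 1] o)
            rw [← add_assoc]
            omega
        have h := this (i - j) (by omega)
        rwa [Nat.add_sub_cancel' hji] at h
      have hxy : X.dist x y = i - k := by
        have b1 := hdist k le_rfl (by omega)
        rw [← hx] at b1
        have b2 := hX.dist_triangle (u := x) (v := y) (w := z)
        omega
      refine stepToward_eq_of_subset ?_ ?_
      · rintro w ⟨hw1, hw2⟩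
        refine ⟨hw1, ?_⟩
        have b1 := hX.dist_triangle (u := w) (v := y) (w := z)
        have b2 := hX.dist_triangle (u := x) (v := w) (w := z)
        rw [dist_eq_one_iff_adj.2 hw1] at b2
        omega
      · have hm := hmem z k (by omega)
        rw [Function.iterate_succ_apply', ← hx] at hm
        refine ⟨hm.1, ?_⟩
        have b1 := hdist (k + 1) (by omega) hk
        rw [Function.iterate_succ_apply', ← hx] at b1
        have b2 := hX.dist_triangle (u := x) (v := stepToward X z x) (w := y)
        rw [dist_eq_one_iff_adj.2 hm.1] at b2
        omega
  · rw [Function.iterate_succ_apply', Function.iterate_succ_apply', ← he]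
    refine (stepToward_eq_of_subset ht.ge (ht ▸ ?_)).symm
    exact stepToward_mem (toward_nonempty hX (hne z₁ i h1))

end Existence

/-- The target `ζ` lies beyond `x`, as seen from `o`. -/
def Beyond (X : SimpleGraph V) (o x ζ : V) : Prop := X.dist o ζ = X.dist o x + X.dist x ζ

/-- Some geodesic from `p` to `ζ` meets `Q` at most in `p`. -/
def Misses (X : SimpleGraph V) (Q : Set V) (p ζ : V) : Prop :=
  ∃ β : X.Walk p ζ, IsGeodesic β ∧ ∀ q ∈ β.support, q ∈ Q → q = p

/-! ### Paths, cells, states and transitions -/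

namespace PathSystem

variable {o : V} (S : PathSystem X o)

lemma dist_path_le (hX : X.Connected) (z : V) {i j : ℕ} (hij : i ≤ j) (hj : j ≤ X.dist o z) :
    X.dist (S.path z i) (S.path z j) ≤ j - i := by
  induction j, hij using Nat.le_induction with
  | base => simp
  | succ j hij ih =>
    have h1 := ih (by omega)
    have h2 := dist_eq_one_iff_adj.2 (S.path_adj z j (by omega))
    have h3 := hX.dist_triangle (u := S.path z i) (v := S.path z j) (w := S.path z (j + 1))
    omega

lemma dist_path (hX : X.Connected) (z : V) {i : ℕ} (hi : i ≤ X.dist o z) :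
    X.dist o (S.path z i) = i := by
  have h1 := S.dist_path_le hX z (Nat.zero_le i) hi
  have h2 := S.dist_path_le hX z hi le_rfl
  rw [S.path_zero] at h1
  rw [S.path_dist] at h2
  have h3 := hX.dist_triangle (u := o) (v := S.path z i) (w := z)
  omega

lemma dist_path_end (hX : X.Connected) (z : V) {i : ℕ} (hi : i ≤ X.dist o z) :
    X.dist (S.path z i) z = X.dist o z - i := by
  have h1 := S.dist_path hX z hi
  have h2 := S.dist_path_le hX z hi le_rfl
  rw [S.path_dist] at h2
  have h3 := hX.dist_triangle (u := o) (v := S.path z i) (w := z)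
  omega

lemma beyond_path (hX : X.Connected) (z : V) {i : ℕ} (hi : i ≤ X.dist o z) :
    Beyond X o (S.path z i) z := by
  rw [Beyond, S.dist_path hX z hi, S.dist_path_end hX z hi]
  omega

/-- The predecessor of `x`. -/
noncomputable def pred (x : V) : V := S.path x (X.dist o x - 1)

lemma pred_path_succ (hX : X.Connected) (z : V) {i : ℕ} (hi : i < X.dist o z) :
    S.pred (S.path z (i + 1)) = S.path z i := by
  rw [pred, S.dist_path hX z (i := i + 1) hi, Nat.add_sub_cancel, S.path_path z _ _ (by omega) hi]

lemma dist_pred (hX : X.Connected) {x : V} (hx : x ≠ o) : X.dist o (S.pred x) + 1 = X.dist o x := by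
  have := hX.pos_dist_of_ne hx.symm
  rw [pred, S.dist_path hX x (by omega)]
  omega

lemma adj_pred (hX : X.Connected) {x : V} (hx : x ≠ o) : X.Adj (S.pred x) x := by
  have := hX.pos_dist_of_ne hx.symm
  have h := S.path_adj x (X.dist o x - 1) (by omega)
  rwa [Nat.sub_add_cancel (by omega), S.path_dist] at h

lemma pred_base : S.pred o = o := by
  rw [pred]; simp [S.path_zero]

lemma exists_walk (z : V) :
    ∃ γ : X.Walk o z, IsGeodesic γ ∧ ∀ i ≤ X.dist o z, γ.getVert i = S.path z i := by
  have key : ∀ j ≤ X.dist o z, ∃ γ : X.Walk o (S.path z j), γ.length = j ∧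
      ∀ i ≤ j, γ.getVert i = S.path z i := by
    intro j
    induction j with
    | zero =>
      intro _
      refine ⟨(Walk.nil : X.Walk o o).copy rfl (S.path_zero z).symm, by simp, fun i hi => ?_⟩
      obtain rfl : i = 0 := by omega
      simp [S.path_zero]
    | succ j ih =>
      intro hj
      obtain ⟨γ, hl, hv⟩ := ih (by omega)
      refine ⟨γ.concat (S.path_adj z j (by omega)), by simp [hl], fun i hi => ?_⟩
      rw [Walk.concat_eq_append, Walk.getVert_append]
      split_ifs with h
      · exact hv i (by omega)
      · rcases Nat.lt_or_ge i (j + 1) with h' | h'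
        · obtain rfl : i = j := by omega
          simp [hl]
        · obtain rfl : i = j + 1 := by omega
          simp [hl]
  obtain ⟨γ, hl, hv⟩ := key _ le_rfl
  refine ⟨γ.copy rfl (S.path_dist z), by simpa [IsGeodesic] using hl, fun i hi => ?_⟩
  rw [Walk.getVert_copy]
  exact hv i hi

lemma exists_walk_beyond (hX : X.Connected) {x ζ : V} (h : Beyond X o x ζ) :
    ∃ γ : X.Walk o ζ, IsGeodesic γ ∧ ∀ i ≤ X.dist o x, γ.getVert i = S.path x i := by
  obtain ⟨γ, hγ, hv⟩ := S.exists_walk x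
  obtain ⟨γ', hγ'⟩ := exists_geodesic hX x ζ
  refine ⟨γ.append γ', hγ.append hγ' h, fun i hi => ?_⟩
  have hl : γ.length = X.dist o x := hγ
  rw [Walk.getVert_append]
  split_ifs with h'
  · exact hv i hi
  · obtain rfl : i = γ.length := by omega
    rw [Nat.sub_self, Walk.getVert_zero, hl, S.path_dist]

/-- The endpoints of the edges in the neighbourhood of the edge leading to `x`. -/
def cell (L : ℕ) (x : V) : Set V := {q | ∃ f ∈ edgeNhd X L s(S.pred x, x), q ∈ f}

lemma self_mem_cell (L : ℕ) (x : V) : x ∈ S.cell L x :=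
  ⟨_, mem_edgeNhd_self L _, by simp⟩

/-- By the convention `S.pred o = o`, the pair leading to `o` is a diagonal one, which lies on no
loop. Consequently all targets have the same state at `o`. -/
lemma cell_base (L : ℕ) : S.cell L o = {o} := by
  ext q
  constructor
  · rintro ⟨f, hf, hq⟩
    rw [S.pred_base] at hf
    rcases hf with rfl | ⟨v, p, hp, -, he, -⟩
    · simpa using hq
    · have := p.edges_subset_edgeSet he
      simp at this
  · rintro rfl
    exact S.self_mem_cell L q

lemma dist_le_of_mem_cell (hX : X.Connected) {L : ℕ} (hL : 1 ≤ L) {x q : V}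
    (hq : q ∈ S.cell L x) : X.dist q x ≤ L := by
  by_cases hx : x = o
  · subst hx
    rw [S.cell_base] at hq
    simp [Set.mem_singleton_iff.1 hq]
  · obtain ⟨f, hf, hqf⟩ := hq
    rw [X.dist_comm]
    exact dist_le_of_mem_edgeNhd hL hf (S.adj_pred hX hx) (by simp) hqf

/-- The shape of the distance to `z` near `x`, up to an additive constant. -/
noncomputable def state (L : ℕ) (x z : V) : V → ℤ :=
  open Classical in fun q => if q ∈ S.cell L x then (X.dist q z : ℤ) - X.dist x z else 0

lemma state_eq_iff {L : ℕ} {x z₁ z₂ : V} : S.state L x z₁ = S.state L x z₂ ↔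
    ∀ q ∈ S.cell L x, (X.dist q z₁ : ℤ) - X.dist x z₁ = X.dist q z₂ - X.dist x z₂ := by
  constructor
  · intro h q hq
    simpa [state, hq] using congrFun h q
  · intro h
    funext q
    by_cases hq : q ∈ S.cell L x
    · simpa [state, hq] using h q hq
    · simp [state, hq]

/-- The `i`-th transition on the path to `z`. -/
noncomputable def trans (L : ℕ) (z : V) (i : ℕ) : V × (V → ℤ) × (V → ℤ) :=
  (S.path z (i + 1), S.state L (S.path z i) z, S.state L (S.path z (i + 1)) z)

/-- All transitions on the path to `z`. -/
noncomputable def transitions (L : ℕ) (z : V) : Finset (V × (V → ℤ) × (V → ℤ)) :=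
  open Classical in (Finset.range (X.dist o z)).image (S.trans L z)

lemma mem_transitions {L : ℕ} {z : V} {σ : V × (V → ℤ) × (V → ℤ)} :
    σ ∈ S.transitions L z ↔ ∃ j < X.dist o z, S.trans L z j = σ := by
  simp [transitions]

lemma dist_fst_trans (hX : X.Connected) {L : ℕ} {z : V} {j : ℕ} (hj : j < X.dist o z) :
    X.dist o (S.trans L z j).1 = j + 1 :=
  S.dist_path hX z hj

lemma trans_injOn (hX : X.Connected) (L : ℕ) (z : V) :
    Set.InjOn (S.trans L z) (Finset.range (X.dist o z)) := by
  intro i hi j hj hij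
  have h1 := S.dist_fst_trans hX (L := L) (Finset.mem_range.1 hi)
  have h2 := S.dist_fst_trans hX (L := L) (Finset.mem_range.1 hj)
  rw [hij] at h1
  omega

lemma dist_fst_le (hX : X.Connected) {L : ℕ} {z : V} {σ : V × (V → ℤ) × (V → ℤ)}
    (h : σ ∈ S.transitions L z) : X.dist o σ.1 ≤ X.dist o z := by
  obtain ⟨j, hj, rfl⟩ := S.mem_transitions.1 h
  rw [S.dist_fst_trans hX hj]
  omega

/-- If two targets have the same distances, up to a constant, to the points of a set `Q` that
separates them from the path to the first one, then they have the same transitions there. -/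
lemma exists_misses (hX : X.Connected) {L : ℕ} {Q : Set V} {z₁ z₂ : V} {κ : ℤ}
    (hκ : ∀ q ∈ Q, (X.dist q z₁ : ℤ) = X.dist q z₂ + κ) {j : ℕ} (hj : j < X.dist o z₁)
    (hσ : S.trans L z₁ j ∉ S.transitions L z₂) :
    ∃ p ζ, (ζ = z₁ ∨ ζ = z₂) ∧ Misses X Q p ζ ∧ ((∃ i ≤ j, p = S.path z₁ i) ∨
      (p ∉ Q ∧ (p ∈ S.cell L (S.path z₁ j) ∨ p ∈ S.cell L (S.path z₁ (j + 1))))) := by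
  -- Suppose that from all vertices in question every geodesic to `z₁` or `z₂` meets `Q` away from
  -- its start. Then the distances to the two targets differ by `κ` at these vertices too, and the
  -- paths and states agree up to the given transition.
  by_contra hcon
  push Not at hcon
  have cross : ∀ {p ζ : V}, (ζ = z₁ ∨ ζ = z₂) → ¬ Misses X Q p ζ → ∀ β : X.Walk p ζ,
      IsGeodesic β → ∃ q ∈ β.support, q ∈ Q ∧ q ≠ p := by
    intro p ζ _ hm β hβ
    by_contra h
    push Not at h
    exact hm ⟨β, hβ, h⟩
  have le_of_cross : ∀ {p a b : V} {c : ℤ}, (a = z₁ ∨ a = z₂) → ¬ Misses X Q p a →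
      (∀ q ∈ Q, (X.dist q a : ℤ) = X.dist q b + c) → (X.dist p b : ℤ) + c ≤ X.dist p a := by
    intro p a b c ha hm hc
    obtain ⟨β, hβ⟩ := exists_geodesic hX p a
    obtain ⟨q, hq, hqQ, -⟩ := cross ha hm β hβ
    have h1 := hβ.dist_add hX hq
    have h2 := hX.dist_triangle (u := p) (v := q) (w := b)
    have h3 := hc q hqQ
    omega
  have hκ' : ∀ q ∈ Q, (X.dist q z₂ : ℤ) = X.dist q z₁ + (-κ) := fun q hq => by
    rw [hκ q hq]; ring
  have eq_of_cross : ∀ {p : V}, ¬ Misses X Q p z₁ → ¬ Misses X Q p z₂ →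
      (X.dist p z₁ : ℤ) = X.dist p z₂ + κ := by
    intro p h1 h2
    have e1 := le_of_cross (Or.inl rfl) h1 hκ
    have e2 := le_of_cross (Or.inr rfl) h2 hκ'
    omega
  -- The meeting point with `Q` differs from `p`, so it comes after the first step; hence a first
  -- step towards `a` also leads towards `b`. This is why `Misses` tolerates the starting vertex.
  have toward_sub : ∀ {p a b : V} {c : ℤ}, (a = z₁ ∨ a = z₂) → ¬ Misses X Q p a →
      (∀ q ∈ Q, (X.dist q a : ℤ) = X.dist q b + c) → (X.dist p a : ℤ) = X.dist p b + c →
      toward X a p ⊆ toward X b p := by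
    intro p a b c ha hm hc hp w ⟨hw1, hw2⟩
    refine ⟨hw1, ?_⟩
    obtain ⟨β, hβ⟩ := exists_geodesic hX w a
    have hβ' : IsGeodesic (Walk.cons hw1 β) := by
      simp only [IsGeodesic, Walk.length_cons] at hβ ⊢
      omega
    obtain ⟨q, hq, hqQ, hqp⟩ := cross ha hm _ hβ'
    have hq' : q ∈ β.support := by
      rw [Walk.support_cons, List.mem_cons] at hq
      exact hq.resolve_left hqp
    have h1 := hβ.dist_add hX hq'
    have h2 := hX.dist_triangle (u := w) (v := q) (w := b)
    have h3 := hc q hqQ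
    have h4 := hX.dist_triangle (u := p) (v := w) (w := b)
    rw [dist_eq_one_iff_adj.2 hw1] at h4
    omega
  have hmiss : ∀ i ≤ j, ∀ ζ, (ζ = z₁ ∨ ζ = z₂) → ¬ Misses X Q (S.path z₁ i) ζ := by
    intro i hi ζ hζ hm
    exact (hcon _ ζ hζ hm).1 i hi rfl
  -- If the path ran through `z₂`, the constant geodesic there would miss `Q`.
  have hend : ∀ i ≤ j, S.path z₁ i ≠ z₂ := by
    intro i hi h
    refine hmiss i hi z₂ (Or.inr rfl) ?_
    rw [h]
    exact ⟨Walk.nil, by simp [IsGeodesic], by simp⟩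
  have key : ∀ i ≤ j + 1, i ≤ X.dist o z₂ ∧ S.path z₂ i = S.path z₁ i := by
    intro i
    induction i with
    | zero => simp [S.path_zero]
    | succ i ih =>
      intro hi
      obtain ⟨h1, h2⟩ := ih (by omega)
      have hlt : i < X.dist o z₂ := by
        rcases h1.lt_or_eq with h | h
        · exact h
        · exfalso
          rw [h, S.path_dist] at h2
          exact hend _ (by omega) h2.symm
      refine ⟨hlt, (S.path_succ_eq z₁ z₂ i (by omega) hlt h2.symm ?_).symm⟩
      have m1 := hmiss i (by omega) z₁ (Or.inl rfl)
      have m2 := hmiss i (by omega) z₂ (Or.inr rfl)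
      have e := eq_of_cross m1 m2
      exact (toward_sub (Or.inl rfl) m1 hκ e).antisymm
        (toward_sub (Or.inr rfl) m2 hκ' (by omega))
  refine hσ (S.mem_transitions.2 ⟨j, (key (j + 1) le_rfl).1, ?_⟩)
  have hcellpt : ∀ p, (p ∈ S.cell L (S.path z₁ j) ∨ p ∈ S.cell L (S.path z₁ (j + 1))) →
      (X.dist p z₁ : ℤ) = X.dist p z₂ + κ := by
    intro p hp
    by_cases hpQ : p ∈ Q
    · exact hκ p hpQ
    · have h : ∀ ζ, (ζ = z₁ ∨ ζ = z₂) → ¬ Misses X Q p ζ := fun ζ hζ hm => by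
        have := (hcon p ζ hζ hm).2 hpQ
        tauto
      exact eq_of_cross (h z₁ (Or.inl rfl)) (h z₂ (Or.inr rfl))
  have s1 : S.state L (S.path z₁ j) z₂ = S.state L (S.path z₁ j) z₁ := by
    rw [state_eq_iff]
    intro q hq
    have e1 := hcellpt q (Or.inl hq)
    have e2 := hcellpt _ (Or.inl (S.self_mem_cell L (S.path z₁ j)))
    omega
  have s2 : S.state L (S.path z₁ (j + 1)) z₂ = S.state L (S.path z₁ (j + 1)) z₁ := by
    rw [state_eq_iff]
    intro q hq
    have e1 := hcellpt q (Or.inr hq)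
    have e2 := hcellpt _ (Or.inr (S.self_mem_cell L (S.path z₁ (j + 1))))
    omega
  rw [trans, (key (j + 1) le_rfl).2, (key j (by omega)).2, s1, s2, trans]

end PathSystem

end RelHyp

namespace RelHyp

variable {V : Type*} {X : SimpleGraph V}

open SimpleGraph

/-! ### Cardinality bounds -/

/-- The set `s` is contained in a finite set with at most `n` elements. -/
def CardLE {α : Type*} (s : Set α) (n : ℕ) : Prop := ∃ t : Finset α, s ⊆ t ∧ t.card ≤ n

namespace CardLE

variable {α β : Type*} {s t : Set α} {m n : ℕ}

lemma mono (h : CardLE t n) (hs : s ⊆ t) (hmn : n ≤ m) : CardLE s m :=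
  let ⟨u, hu, hc⟩ := h
  ⟨u, hs.trans hu, hc.trans hmn⟩

lemma subset (h : CardLE t n) (hs : s ⊆ t) : CardLE s n := h.mono hs le_rfl

lemma union (hs : CardLE s m) (ht : CardLE t n) : CardLE (s ∪ t) (m + n) := by
  classical
  obtain ⟨u, hu, hc⟩ := hs
  obtain ⟨v, hv, hd⟩ := ht
  refine ⟨u ∪ v, ?_, (Finset.card_union_le u v).trans (by omega)⟩
  rw [Finset.coe_union]
  exact Set.union_subset_union hu hv

lemma biUnion {f : α → Set β} (hs : CardLE s m) (hf : ∀ a ∈ s, CardLE (f a) n) :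
    CardLE {b | ∃ a ∈ s, b ∈ f a} (m * n) := by
  classical
  obtain ⟨u, hu, hc⟩ := hs
  choose! g hg hgc using hf
  refine ⟨(u.filter (· ∈ s)).biUnion g, ?_, ?_⟩
  · rintro b ⟨a, ha, hb⟩
    simp only [Finset.coe_biUnion, Set.mem_iUnion]
    exact ⟨a, by simp [ha, Finset.mem_coe.1 (hu ha)], hg a ha hb⟩
  · refine (Finset.card_biUnion_le_card_mul _ _ n fun a ha => hgc a (Finset.mem_filter.1 ha).2).trans
      (Nat.mul_le_mul_right _ ((Finset.card_filter_le _ _).trans hc))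

lemma image (f : α → β) (hs : CardLE s m) : CardLE (f '' s) m := by
  classical
  obtain ⟨u, hu, hc⟩ := hs
  exact ⟨u.image f, by rw [Finset.coe_image]; exact Set.image_mono hu, Finset.card_image_le.trans hc⟩

lemma card_le {s : Finset α} (h : CardLE (s : Set α) n) : s.card ≤ n := by
  obtain ⟨u, hu, hc⟩ := h
  exact (Finset.card_le_card (Finset.coe_subset.1 hu)).trans hc

lemma of_encard_le (h : s.encard ≤ n) : CardLE s n := by
  have hf : s.Finite := Set.finite_of_encard_le_coe h
  refine ⟨hf.toFinset, by simp, ?_⟩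
  rw [hf.encard_eq_coe_toFinset_card] at h
  exact_mod_cast h

lemma singleton (a : α) : CardLE ({a} : Set α) 1 := ⟨{a}, by simp, by simp⟩

lemma mem_sym2 (e : Sym2 α) : CardLE {q | q ∈ e} 2 := by
  induction e with
  | _ a b =>
    refine ((singleton a).union (singleton b)).subset fun q hq => ?_
    exact Sym2.mem_iff.1 hq

lemma edges {x y : V} (p : X.Walk x y) : CardLE {f | f ∈ p.edges} p.length := by
  classical
  refine ⟨p.edges.toFinset, fun f hf => by simpa using hf, ?_⟩
  exact (List.toFinset_card_le _).trans_eq p.length_edges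

end CardLE

/-- The only use of fineness: at most `φ L` loops pass through `e`, each with at most `L` edges. The
summand `1` is `e` itself; a pair that is not an edge lies on no loop. -/
lemma cardLE_edgeNhd {φ : ℕ → ℕ}
    (hφ : ∀ L : ℕ, ∀ e ∈ X.edgeSet, (simpleLoops X L e).encard ≤ (φ L : ℕ∞)) (L : ℕ)
    (e : Sym2 V) : CardLE (edgeNhd X L e) (1 + φ L * L) := by
  have h : CardLE {f | ∃ C ∈ simpleLoops X L e, f ∈ C} (φ L * L) := by
    refine CardLE.biUnion ?_ ?_
    · by_cases he : e ∈ X.edgeSet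
      · exact CardLE.of_encard_le (hφ L e he)
      · refine ⟨∅, ?_, by simp⟩
        rintro C ⟨v, p, -, -, h, -⟩
        exact absurd (p.edges_subset_edgeSet h) he
    · rintro C ⟨v, p, -, hl, -, rfl⟩
      exact (CardLE.edges p).mono subset_rfl hl
  refine ((CardLE.singleton e).union h).subset ?_
  rintro f (rfl | ⟨v, p, hp, hl, he, hf⟩)
  · exact Or.inl rfl
  · exact Or.inr ⟨_, ⟨v, p, hp, hl, he, rfl⟩, hf⟩

/-! ### Fixed geodesics and the edges near their end -/

/-- A fixed geodesic between two vertices. -/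
noncomputable def geo (hX : X.Connected) (a b : V) : X.Walk a b := (exists_geodesic hX a b).choose

lemma isGeodesic_geo (hX : X.Connected) (a b : V) : IsGeodesic (geo hX a b) :=
  (exists_geodesic hX a b).choose_spec

/-- The edges of `w` having an endpoint at distance at most `ρ` from the end of `w`. -/
def endEdges {a b : V} (w : X.Walk a b) (ρ : ℕ) : Set (Sym2 V) :=
  {f | f ∈ w.edges ∧ ∃ v ∈ f, X.dist v b ≤ ρ}

lemma cardLE_endEdges (hX : X.Connected) {a b : V} {w : X.Walk a b} (hw : IsGeodesic w) (ρ : ℕ) :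
    CardLE (endEdges w ρ) (ρ + 1) := by
  classical
  refine ⟨(Finset.Ico (w.length - (ρ + 1)) w.length).image
    fun i => s(w.getVert i, w.getVert (i + 1)), ?_, ?_⟩
  · rintro f ⟨hf, v, hv, hd⟩
    obtain ⟨i, hi, rfl⟩ := exists_getVert_of_mem_edges w hf
    simp only [Finset.coe_image, Set.mem_image, Finset.coe_Ico, Set.mem_Ico]
    refine ⟨i, ⟨?_, hi⟩, rfl⟩
    have h1 := hw.dist_getVert hX (i := i) (j := w.length) hi.le le_rfl
    have h2 := hw.dist_getVert hX (i := i + 1) (j := w.length) hi le_rfl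
    rw [Walk.getVert_length] at h1 h2
    rcases Sym2.mem_iff.1 hv with rfl | rfl <;> omega
  · refine Finset.card_image_le.trans ?_
    simp; omega

/-! ### Edges forced to be near a geodesic, and the control of branching -/

namespace PathSystem

variable {o : V} (S : PathSystem X o)

/-- If a geodesic from `p` avoids the neighbourhood of the edge leading to `x`, then that edge is
close to each geodesic from `o` to `p`. -/
lemma exists_mem_edges_of_misses (hX : X.Connected) {D : ℕ} (hT : ThinTriangles X D) {L : ℕ}
    (hL : 24 * D + 26 ≤ L) {x p ζ : V} (hx : x ≠ o) (hζ : Beyond X o x ζ)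
    (hm : Misses X (S.cell L x) p ζ) {α : X.Walk o p} (hα : IsGeodesic α) :
    ∃ f ∈ α.edges, s(S.pred x, x) ∈ edgeNhd X L f := by
  obtain ⟨β, hβ, hβ'⟩ := hm
  obtain ⟨γ, hγ, hv⟩ := S.exists_walk_beyond hX hζ
  have hpos := hX.pos_dist_of_ne hx.symm
  have hl : γ.length = X.dist o ζ := hγ
  have hζ' : X.dist o ζ = X.dist o x + X.dist x ζ := hζ
  have h := (exists_mem_edgeNhd (n := X.dist o x - 1) hX hT hL hα hβ hγ (by omega)).1
  rw [hv _ (by omega), hv _ (by omega), Nat.sub_add_cancel (by omega), S.path_dist] at h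
  obtain ⟨f, hf, h | h⟩ := h
  · exact ⟨f, h, edgeNhd_symm hf⟩
  -- A neighbour on `β` would have both endpoints in the cell, hence both equal to `p`.
  · exfalso
    have he : f ∈ X.edgeSet := β.edges_subset_edgeSet h
    induction f with
    | _ a b =>
      have ha : a = p := hβ' a (mem_support_of_mem_edges h (by simp)) ⟨_, hf, by simp⟩
      have hb : b = p := hβ' b (mem_support_of_mem_edges h (by simp)) ⟨_, hf, by simp⟩
      rw [ha, hb] at he
      simp at he

/-- If a geodesic from `p` avoids the predecessor of `x`, then the edge leading to `x` is close to
the previous one, or to each geodesic from `o` to `p`. -/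
lemma exists_mem_edges_of_avoids (hX : X.Connected) {D : ℕ} (hT : ThinTriangles X D) {L : ℕ}
    (hL : 24 * D + 26 ≤ L) {x p ζ : V} (hx : x ≠ o) (hζ : Beyond X o x ζ)
    {β : X.Walk p ζ} (hβ : IsGeodesic β) (hp : S.pred x ∉ β.support)
    {α : X.Walk o p} (hα : IsGeodesic α) :
    (∃ f ∈ α.edges, s(S.pred x, x) ∈ edgeNhd X L f) ∨
      (S.pred x ≠ o ∧ s(S.pred x, x) ∈ edgeNhd X L s(S.pred (S.pred x), S.pred x)) := by
  obtain ⟨γ, hγ, hv⟩ := S.exists_walk_beyond hX hζ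
  have hpos := hX.pos_dist_of_ne hx.symm
  have hl : γ.length = X.dist o ζ := hγ
  have hζ' : X.dist o ζ = X.dist o x + X.dist x ζ := hζ
  have h := (exists_mem_edgeNhd (n := X.dist o x - 1) hX hT hL hα hβ hγ (by omega)).2
  rw [hv _ (by omega), hv _ (by omega), Nat.sub_add_cancel (by omega), S.path_dist,
    hv _ (by omega)] at h
  obtain ⟨f, hf, -, h | ⟨h0, rfl⟩⟩ := h hp
  · exact Or.inl ⟨f, h, edgeNhd_symm hf⟩
  · refine Or.inr ⟨?_, ?_⟩
    · intro h
      have h1 := S.dist_pred hX hx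
      rw [h, X.dist_self] at h1
      omega
    · have h2 : S.path x (X.dist o x - 1 - 1) = S.pred (S.pred x) := by
        have h1 := S.dist_path hX x (i := X.dist o x - 1) (by omega)
        rw [pred, pred, h1, S.path_path x _ _ (by omega) (by omega)]
      rw [h2] at hf
      exact edgeNhd_symm hf

/-- A point beyond `x` realizing the state `h`; it is `x` itself if possible. -/
noncomputable def rep (L : ℕ) (x : V) (h : V → ℤ) : V :=
  open Classical in
  if S.state L x x = h then x
  else if hr : ∃ r, Beyond X o x r ∧ S.state L x r = h then hr.choose else x

lemma rep_eq_self {L : ℕ} {x : V} {h : V → ℤ} (hx : S.state L x x = h) : S.rep L x h = x := by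
  rw [rep, if_pos hx]

lemma beyond_rep (L : ℕ) (x : V) (h : V → ℤ) : Beyond X o x (S.rep L x h) := by
  rw [rep]
  split_ifs with h1 h2
  · simp [Beyond]
  · exact h2.choose_spec.1
  · simp [Beyond]

lemma state_rep {L : ℕ} {x z : V} (hz : Beyond X o x z) :
    S.state L x (S.rep L x (S.state L x z)) = S.state L x z := by
  rw [rep]
  have hr : ∃ r, Beyond X o x r ∧ S.state L x r = S.state L x z := ⟨z, hz, rfl⟩
  split_ifs with h1
  · exact h1
  · exact hr.choose_spec.2

/-- The edges that can be reached from `e` by a bounded number of moves. -/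
def branchNhd (o : V) (hX : X.Connected) (L : ℕ) (e : Sym2 V) : Set (Sym2 V) :=
  {b | ∃ e₁ ∈ edgeNhd X L e, b ∈ edgeNhd X L e₁ ∪ {b | ∃ e₂ ∈ edgeNhd X L e₁, b ∈ {b | ∃ q ∈ {q | q ∈ e₂},
    b ∈ {b | ∃ e₃ ∈ endEdges (geo hX o q) (2 * L), b ∈ edgeNhd X L e₃}}}}

lemma mem_branchNhd {hX : X.Connected} {L : ℕ} {e b : Sym2 V} :
    b ∈ branchNhd o hX L e ↔ ∃ e₁ ∈ edgeNhd X L e, b ∈ edgeNhd X L e₁ ∨ ∃ e₂ ∈ edgeNhd X L e₁,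
      ∃ q ∈ e₂, ∃ e₃ ∈ endEdges (geo hX o q) (2 * L), b ∈ edgeNhd X L e₃ := Iff.rfl

lemma edgeNhd_subset_branchNhd (hX : X.Connected) (L : ℕ) (e : Sym2 V) :
    edgeNhd X L e ⊆ branchNhd o hX L e := fun _ hb =>
  mem_branchNhd.2 ⟨e, mem_edgeNhd_self L e, Or.inl hb⟩

lemma cardLE_branchNhd (hX : X.Connected) {L m : ℕ} (hm : ∀ e, CardLE (edgeNhd X L e) m)
    (e : Sym2 V) :
    CardLE (branchNhd o hX L e) (m * (m + m * (2 * ((2 * L + 1) * m)))) :=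
  (hm e).biUnion fun e₁ _ => (hm e₁).union <| (hm e₁).biUnion fun e₂ _ =>
    (CardLE.mem_sym2 e₂).biUnion fun _ _ =>
      (cardLE_endEdges hX (isGeodesic_geo hX _ _) _).biUnion fun e₃ _ => hm e₃

lemma dist_le_of_mem_branchNhd (hX : X.Connected) {L : ℕ} (hL : 1 ≤ L) {e b : Sym2 V}
    (hb : b ∈ branchNhd o hX L e) (he : e ∈ X.edgeSet) {v w : V} (hv : v ∈ e) (hw : w ∈ b) :
    X.dist v w ≤ 5 * L := by
  obtain ⟨e₁, h1, hb | ⟨e₂, h2, q, hq, e₃, ⟨h3, u, hu, hd⟩, hb⟩⟩ := mem_branchNhd.1 hb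
  · have he₁ := mem_edgeSet_of_mem_edgeNhd h1 he
    have d1 := dist_le_of_mem_edgeNhd hL h1 he hv (Sym2.out_fst_mem e₁)
    have d2 := dist_le_of_mem_edgeNhd hL hb he₁ (Sym2.out_fst_mem e₁) hw
    have := hX.dist_triangle (u := v) (v := (Quot.out e₁).1) (w := w)
    omega
  · have he₁ := mem_edgeSet_of_mem_edgeNhd h1 he
    have he₃ : e₃ ∈ X.edgeSet := (geo hX o q).edges_subset_edgeSet h3
    have d1 := dist_le_of_mem_edgeNhd hL h1 he hv (Sym2.out_fst_mem e₁)
    have d2 := dist_le_of_mem_edgeNhd hL h2 he₁ (Sym2.out_fst_mem e₁) hq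
    have d3 := dist_le_of_mem_edgeNhd hL hb he₃ hu hw
    have t1 := hX.dist_triangle (u := v) (v := (Quot.out e₁).1) (w := q)
    have t2 := hX.dist_triangle (u := v) (v := q) (w := u)
    have t3 := hX.dist_triangle (u := v) (v := u) (w := w)
    rw [X.dist_comm (u := q)] at t2
    omega

section Branching

variable (hX : X.Connected) {D : ℕ} (hT : ThinTriangles X D) {L : ℕ} (hL : 24 * D + 26 ≤ L)
include hX hT hL

lemma branch_of_misses_succ {x p ζ : V} (hx : x ≠ o) (hζ : Beyond X o x ζ)
    (hm : Misses X (S.cell L x) p ζ) {α : X.Walk o p} (hα : IsGeodesic α) :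
    ∃ f ∈ α.edges, s(S.pred x, x) ∈ branchNhd o hX L f := by
  obtain ⟨f, hf, h⟩ := S.exists_mem_edges_of_misses hX hT hL hx hζ hm hα
  exact ⟨f, hf, edgeNhd_subset_branchNhd hX L f h⟩

/-- A vertex can have infinitely many successors, so besides the edge leading to `x = S.pred x'`,
the edge from `x` to `x'` must be pinned down. This takes a geodesic to `z` avoiding `x`: the one
from `p` if the representative is `x`, and otherwise one from a point of the cell that distinguishes
the states of `z` and `x`. -/
lemma branch_of_misses {x' p z ζ : V} (hx' : x' ≠ o) (hz : Beyond X o x' z)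
    (hζ : ζ = z ∨ ζ = S.rep L (S.pred x') (S.state L (S.pred x') z))
    (hm : Misses X (S.cell L (S.pred x')) p ζ)
    (hp : p ≠ S.pred x' ∨ S.rep L (S.pred x') (S.state L (S.pred x') z) ≠ S.pred x')
    {α : X.Walk o p} (hα : IsGeodesic α) :
    ∃ f ∈ α.edges, s(S.pred x', x') ∈ branchNhd o hX L f := by
  set x := S.pred x' with hxdef
  have hdx := S.dist_pred hX hx'
  have hadj := S.adj_pred hX hx'
  rw [← hxdef] at hdx hadj
  have hzx : Beyond X o x z := by
    have h1 : X.dist o z = X.dist o x' + X.dist x' z := hz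
    have h2 := hX.dist_triangle (u := x) (v := x') (w := z)
    have h3 := hX.dist_triangle (u := o) (v := x) (w := z)
    rw [dist_eq_one_iff_adj.2 hadj] at h2
    simp only [Beyond]
    omega
  have hζx : Beyond X o x ζ := by
    rcases hζ with rfl | rfl
    · exact hzx
    · exact S.beyond_rep L _ _
  have pass : x ≠ o → ∃ f ∈ α.edges, s(S.pred x, x) ∈ edgeNhd X L f := fun hxo =>
    S.exists_mem_edges_of_misses hX hT hL hxo hζx hm hα
  by_cases hrep : S.rep L x (S.state L x z) = x
  · have hpx : p ≠ x := hp.resolve_right (fun h => h hrep)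
    obtain ⟨β, hβ, hβ'⟩ := hm
    have hxβ : x ∉ β.support := fun h => hpx (hβ' x h (S.self_mem_cell L x)).symm
    -- The geodesic avoids `x`, so it does not end at the representative, which is `x`.
    have hζz : ζ = z := by
      rcases hζ with h | h
      · exact h
      · exact absurd (by rw [← hrep, ← h]; exact β.end_mem_support) hxβ
    subst hζz
    rcases S.exists_mem_edges_of_avoids hX hT hL hx' hz hβ hxβ hα with ⟨f, hf, h⟩ | ⟨hxo, h⟩
    · exact ⟨f, hf, edgeNhd_subset_branchNhd hX L f h⟩
    · obtain ⟨f, hf, h'⟩ := pass hxo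
      exact ⟨f, hf, mem_branchNhd.2 ⟨_, h', Or.inl h⟩⟩
  -- The states of `x` and `z` at `x` differ, so for some `q` in the cell no geodesic from `q` to
  -- `z` passes through `x`.
  · have hst : S.state L x x ≠ S.state L x z := fun h => hrep (S.rep_eq_self h)
    rw [Ne, state_eq_iff] at hst
    push Not at hst
    obtain ⟨q, hq, hne⟩ := hst
    have hxo : x ≠ o := by
      intro h
      rw [h, S.cell_base, Set.mem_singleton_iff] at hq
      rw [h, hq] at hne
      simp at hne
    obtain ⟨f, hf, hfx⟩ := pass hxo
    obtain ⟨β, hβ⟩ := exists_geodesic hX q z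
    have hxβ : x ∉ β.support := by
      intro h
      have := hβ.dist_add hX h
      apply hne
      rw [X.dist_self]
      omega
    rcases S.exists_mem_edges_of_avoids hX hT hL hx' hz hβ hxβ (isGeodesic_geo hX o q) with
      ⟨e₃, he₃, h⟩ | ⟨-, h⟩
    · have hqx := S.dist_le_of_mem_cell hX (by omega) hq
      obtain ⟨e₂, he₂, hqe⟩ := hq
      refine ⟨f, hf, mem_branchNhd.2 ⟨_, hfx, Or.inr ⟨e₂, he₂, q, hqe, e₃, ⟨he₃, ?_⟩, h⟩⟩⟩
      have he₃' : e₃ ∈ X.edgeSet := (geo hX o q).edges_subset_edgeSet he₃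
      -- Both `q` and `e₃` are within `L` of `x`, whence the radius `2 * L` in `branchNhd`.
      have d := dist_le_of_mem_edgeNhd (by omega) h he₃' (Sym2.out_fst_mem e₃) (Sym2.mem_mk_left x x')
      refine ⟨_, Sym2.out_fst_mem e₃, ?_⟩
      have := hX.dist_triangle (u := (Quot.out e₃).1) (v := x) (w := q)
      rw [X.dist_comm (u := x)] at this
      omega
    · exact ⟨f, hf, mem_branchNhd.2 ⟨_, hfx, Or.inl h⟩⟩

end Branching

end PathSystem

end RelHyp

/-! ### Comparison of two path systems -/

namespace RelHyp

variable {V : Type*} {X : SimpleGraph V}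

open SimpleGraph

lemma exists_mem_edgeNhd_of_mem_edges (hX : X.Connected) {D : ℕ} (hT : ThinTriangles X D) {L : ℕ}
    (hL : 24 * D + 26 ≤ L) {o p z : V} {α : X.Walk o p} {β : X.Walk p z} {γ : X.Walk o z}
    (hα : IsGeodesic α) (hβ : IsGeodesic β) (hγ : IsGeodesic γ) {e : Sym2 V} (he : e ∈ γ.edges) :
    ∃ f, (f ∈ α.edges ∨ f ∈ β.edges) ∧ e ∈ edgeNhd X L f := by
  obtain ⟨n, hn, rfl⟩ := exists_getVert_of_mem_edges γ he
  obtain ⟨f, hf, h⟩ := (exists_mem_edgeNhd hX hT hL hα hβ hγ hn).1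
  exact ⟨f, h, edgeNhd_symm hf⟩

namespace PathSystem

variable {o o' : V} (S : PathSystem X o) (S' : PathSystem X o')

lemma exists_walk_edges (hX : X.Connected) (z : V) {k : ℕ} (hk : k ≤ X.dist o z) :
    ∃ γ : X.Walk o (S.path z k), IsGeodesic γ ∧
      (∀ f ∈ γ.edges, ∃ i < k, f = s(S.path z i, S.path z (i + 1))) ∧
      ∀ i < k, s(S.path z i, S.path z (i + 1)) ∈ γ.edges := by
  obtain ⟨γ, hγ, hv⟩ := S.exists_walk (S.path z k)
  have hd := S.dist_path hX z hk
  have hl : γ.length = k := Eq.trans hγ hd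
  have hv' : ∀ i ≤ k, γ.getVert i = S.path z i := fun i hi => by
    rw [hv i (by omega), S.path_path z k i hi hk]
  refine ⟨γ, hγ, fun f hf => ?_, fun i hi => ?_⟩
  · obtain ⟨i, hi, rfl⟩ := exists_getVert_of_mem_edges γ hf
    exact ⟨i, by omega, by rw [hv' i (by omega), hv' (i + 1) (by omega)]⟩
  · have := mem_edges_getVert γ (i := i) (by omega)
    rwa [hv' i (by omega), hv' (i + 1) (by omega)] at this

lemma exists_walk_pred_mem (hX : X.Connected) {x ζ : V} (hx : x ≠ o) (hζ : Beyond X o x ζ) :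
    ∃ γ : X.Walk o ζ, IsGeodesic γ ∧ s(S.pred x, x) ∈ γ.edges := by
  obtain ⟨γ, hγ, hv⟩ := S.exists_walk_beyond hX hζ
  have hpos := hX.pos_dist_of_ne hx.symm
  have hl : γ.length = X.dist o ζ := hγ
  have hζ' : X.dist o ζ = X.dist o x + X.dist x ζ := hζ
  have := mem_edges_getVert γ (i := X.dist o x - 1) (by omega)
  rw [hv _ (by omega), hv _ (by omega), Nat.sub_add_cancel (by omega), S.path_dist] at this
  exact ⟨γ, hγ, this⟩

/-- If a geodesic from `p` to `z` starts at the predecessor of `x`, then its first edge is close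
to the edge leading to `x`. -/
lemma pred_edge_mem_edgeNhd (hX : X.Connected) {D : ℕ} (hT : ThinTriangles X D) {L : ℕ}
    (hL : 24 * D + 26 ≤ L) {x z w : V} (hx : x ≠ o) (hz : Beyond X o x z)
    (hw : X.Adj (S.pred x) w) (hwz : X.dist (S.pred x) z = X.dist w z + 1) :
    s(S.pred x, x) ∈ edgeNhd X L s(S.pred x, w) := by
  have hadj := S.adj_pred hX hx
  have hd := S.dist_pred hX hx
  have hz' : X.dist o z = X.dist o x + X.dist x z := hz
  obtain ⟨γ, hγ⟩ := exists_geodesic hX x z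
  obtain ⟨α, hα⟩ := exists_geodesic hX w z
  have t1 := hX.dist_triangle (u := S.pred x) (v := x) (w := z)
  have t2 := hX.dist_triangle (u := o) (v := S.pred x) (w := z)
  rw [dist_eq_one_iff_adj.2 hadj] at t1
  have hγ' : IsGeodesic (Walk.cons hadj γ) := by
    simp only [IsGeodesic, Walk.length_cons] at hγ ⊢
    omega
  have hα' : IsGeodesic (Walk.cons hw α) := by
    simp only [IsGeodesic, Walk.length_cons] at hα ⊢
    omega
  have hβ : IsGeodesic (Walk.nil : X.Walk z z) := by simp [IsGeodesic]
  obtain ⟨f, hf, hm, h⟩ := (exists_mem_edgeNhd (n := 0) hX hT hL hα' hβ hγ' (by simp)).2 (by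
    simp only [Walk.getVert_zero, Walk.support_nil, List.mem_singleton]
    rintro h
    rw [h, X.dist_self] at hwz
    omega)
  simp only [Walk.getVert_zero, zero_add, Walk.getVert_cons_succ, lt_self_iff_false, false_and,
    or_false] at hf hm h
  rw [Walk.edges_cons, List.mem_cons] at h
  rcases h with rfl | h
  · exact edgeNhd_symm hf
  · exfalso
    have := hα.dist_add hX (mem_support_of_mem_edges h hm)
    rw [X.dist_comm, dist_eq_one_iff_adj.2 hw] at this
    omega

/-- The value at the node `(x, h)` of `S` of the indicator function of a transition of `S'`. -/
noncomputable def crossVal (L : ℕ) (σ : V × (V → ℤ) × (V → ℤ)) (x : V) (h : V → ℤ) : ℂ :=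
  open Classical in
  if σ ∈ S'.transitions L (S.rep L x h) ∧ X.dist o' σ.1 ≤ X.dist o' x + L then 1 else 0

/-- The level condition in `crossVal` is vacuous here, since transitions on the path to `z` have at
most the level of `z`. Elsewhere it discards transitions far beyond `x`, which is needed for the
bounds on rows and on columns. -/
lemma crossVal_end (hX : X.Connected) (L : ℕ) (σ : V × (V → ℤ) × (V → ℤ)) (z : V) :
    S.crossVal S' L σ z (S.state L z z) =
      open Classical in if σ ∈ S'.transitions L z then 1 else 0 := by
  rw [crossVal, S.rep_eq_self rfl]
  congr 1
  simp only [eq_iff_iff, and_iff_left_iff_imp]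
  intro h
  exact (S'.dist_fst_le hX h).trans (by omega)

section Jump

variable (hX : X.Connected) {D : ℕ} (hT : ThinTriangles X D) {L : ℕ} (hL : 24 * D + 26 ≤ L)
include hX hT hL

/-- The vertices relevant for the `j`-th transition of `S'` on the way to `z`. -/
def relevant (S' : PathSystem X o') (L : ℕ) (z : V) (j : ℕ) : Set V :=
  {p | (∃ i ≤ j, p = S'.path z i) ∨ p ∈ S'.cell L (S'.path z j) ∨
    p ∈ S'.cell L (S'.path z (j + 1))}

omit hT hL in
-- Equal states mean that the distances to `z₁` and `z₂` differ by a constant on the cell, so the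
-- cell can play the role of the separating set.
lemma exists_misses_of_state_eq {x z₁ z₂ : V} (h : S.state L x z₁ = S.state L x z₂) {j : ℕ}
    (hj : j < X.dist o' z₁) (hσ : S'.trans L z₁ j ∉ S'.transitions L z₂) :
    ∃ p ∈ relevant S' L z₁ j, ∃ ζ, (ζ = z₁ ∨ ζ = z₂) ∧ Misses X (S.cell L x) p ζ ∧
      (p ∈ S.cell L x → ∃ i ≤ j, p = S'.path z₁ i) := by
  rw [state_eq_iff] at h
  obtain ⟨p, ζ, hζ, hm, hp⟩ := S'.exists_misses hX (Q := S.cell L x)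
    (κ := (X.dist x z₁ : ℤ) - X.dist x z₂) (fun q hq => by have := h q hq; omega) hj hσ
  refine ⟨p, ?_, ζ, hζ, hm, fun hpx => ?_⟩
  · rcases hp with h | ⟨-, h⟩
    · exact Or.inl h
    · exact Or.inr h
  · rcases hp with h | ⟨h, -⟩
    · exact h
    · exact absurd hpx h

/-- If the indicator function of the transition `σ` of `S'` takes different values at two
successive nodes of `S`, then these are close to a vertex that is relevant for `σ`. -/
lemma exists_relevant_of_jump {σ : V × (V → ℤ) × (V → ℤ)} {x z : V} (hx : x ≠ o)
    (hz : Beyond X o x z)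
    (hjump : S.crossVal S' L σ (S.pred x) (S.state L (S.pred x) z) ≠
      S.crossVal S' L σ x (S.state L x z)) :
    ∃ z₁, (z₁ = z ∨ z₁ = S.rep L (S.pred x) (S.state L (S.pred x) z) ∨
        z₁ = S.rep L x (S.state L x z)) ∧
      ∃ j, j < X.dist o' z₁ ∧ S'.trans L z₁ j = σ ∧ j ≤ X.dist o' x + L ∧
      ∃ f, s(S.pred x, x) ∈ branchNhd o hX L f ∧
        ((∃ p ∈ relevant S' L z₁ j, f ∈ (geo hX o p).edges) ∨
          ∃ i ≤ j, f = s(S'.path z₁ i, S'.path z₁ (i + 1))) := by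
  set w := S.pred x with hw
  set r := S.rep L w (S.state L w z) with hr
  set r' := S.rep L x (S.state L x z) with hr'
  have hadj : X.Adj w x := S.adj_pred hX hx
  have hdw : X.dist o w + 1 = X.dist o x := S.dist_pred hX hx
  have hwx1 := dist_eq_one_iff_adj.2 hadj
  have hzw : Beyond X o w z := by
    have h1 : X.dist o z = X.dist o x + X.dist x z := hz
    have h2 := hX.dist_triangle (u := w) (v := x) (w := z)
    have h3 := hX.dist_triangle (u := o) (v := w) (w := z)
    simp only [Beyond]
    omega
  have hcomp : X.dist o' w ≤ X.dist o' x + 1 ∧ X.dist o' x ≤ X.dist o' w + 1 := by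
    have h1 := hX.dist_triangle (u := o') (v := x) (w := w)
    have h2 := hX.dist_triangle (u := o') (v := w) (w := x)
    rw [X.dist_comm (u := x)] at h1
    omega
  -- The target `z` mediates: it has the same state as `r` at `w` and the same state as `r'` at `x`.
  -- A jump is thus a difference between `z` and one of these representatives, or an effect of the
  -- level condition.
  have case_succ : ∀ z₁ z₂, (z₁ = z ∧ z₂ = r' ∨ z₁ = r' ∧ z₂ = z) → σ ∈ S'.transitions L z₁ →
      σ ∉ S'.transitions L z₂ → X.dist o' σ.1 ≤ X.dist o' x + L →
      ∃ j, j < X.dist o' z₁ ∧ S'.trans L z₁ j = σ ∧ j ≤ X.dist o' x + L ∧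
      ∃ f, s(w, x) ∈ branchNhd o hX L f ∧
        ((∃ p ∈ relevant S' L z₁ j, f ∈ (geo hX o p).edges) ∨
          ∃ i ≤ j, f = s(S'.path z₁ i, S'.path z₁ (i + 1))) := by
    intro z₁ z₂ h12 h1 h2 hlev
    obtain ⟨j, hj, rfl⟩ := S'.mem_transitions.1 h1
    rw [S'.dist_fst_trans hX hj] at hlev
    have hst : S.state L x z₁ = S.state L x z₂ := by
      rcases h12 with ⟨rfl, rfl⟩ | ⟨rfl, rfl⟩
      · exact (S.state_rep hz).symm
      · exact S.state_rep hz
    obtain ⟨p, hp, ζ, hζ, hm, -⟩ := S.exists_misses_of_state_eq S' hX hst hj h2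
    have hζx : Beyond X o x ζ := by
      have : ζ = z ∨ ζ = r' := by
        rcases h12 with ⟨rfl, rfl⟩ | ⟨rfl, rfl⟩ <;> tauto
      rcases this with rfl | rfl
      · exact hz
      · exact S.beyond_rep L _ _
    obtain ⟨f, hf, hb⟩ := S.branch_of_misses_succ hX hT hL hx hζx hm (isGeodesic_geo hX o p)
    exact ⟨j, hj, rfl, by omega, f, hb, Or.inl ⟨p, hp, hf⟩⟩
  have case_pred : ∀ z₁ z₂, (z₁ = z ∧ z₂ = r ∨ z₁ = r ∧ z₂ = z) → σ ∈ S'.transitions L z₁ →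
      σ ∉ S'.transitions L z₂ → X.dist o' σ.1 ≤ X.dist o' w + L →
      ∃ j, j < X.dist o' z₁ ∧ S'.trans L z₁ j = σ ∧ j ≤ X.dist o' x + L ∧
      ∃ f, s(w, x) ∈ branchNhd o hX L f ∧
        ((∃ p ∈ relevant S' L z₁ j, f ∈ (geo hX o p).edges) ∨
          ∃ i ≤ j, f = s(S'.path z₁ i, S'.path z₁ (i + 1))) := by
    intro z₁ z₂ h12 h1 h2 hlev
    obtain ⟨j, hj, rfl⟩ := S'.mem_transitions.1 h1
    rw [S'.dist_fst_trans hX hj] at hlev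
    have hst : S.state L w z₁ = S.state L w z₂ := by
      rcases h12 with ⟨rfl, rfl⟩ | ⟨rfl, rfl⟩
      · exact (S.state_rep hzw).symm
      · exact S.state_rep hzw
    obtain ⟨p, hp, ζ, hζ, hm, hpath⟩ := S.exists_misses_of_state_eq S' hX hst hj h2
    have hζ' : ζ = z ∨ ζ = r := by
      rcases h12 with ⟨rfl, rfl⟩ | ⟨rfl, rfl⟩ <;> tauto
    by_cases hpr : p ≠ w ∨ r ≠ w
    · obtain ⟨f, hf, hb⟩ := S.branch_of_misses hX hT hL hx hz hζ' hm hpr (isGeodesic_geo hX o p)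
      exact ⟨j, hj, rfl, by omega, f, hb, Or.inl ⟨p, hp, hf⟩⟩
    -- Exceptional case: the second path passes through `w`, and the representative at `w` is `w`.
    -- If the path goes on to `z`, its next edge is a neighbour of the edge to `x`; if its target is
    -- `w`, it has no transition of index `j ≥ i`.
    · push Not at hpr
      obtain ⟨hpw, hrw⟩ := hpr
      obtain ⟨i, hi, hpi⟩ := hpath (by rw [hpw]; exact S.self_mem_cell L w)
      have hi' := S'.dist_path hX z₁ (i := i) (by omega)
      rw [← hpi, hpw] at hi'
      rcases h12 with ⟨rfl, h⟩ | ⟨h, rfl⟩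
      · refine ⟨j, hj, rfl, by omega, _, ?_, Or.inr ⟨i, hi, rfl⟩⟩
        apply edgeNhd_subset_branchNhd
        have ha := S'.path_adj z₁ i (by omega)
        have e1 := S'.dist_path_end hX z₁ (i := i) (by omega)
        have e2 := S'.dist_path_end hX z₁ (i := i + 1) (by omega)
        rw [← hpi, hpw] at ha e1 ⊢
        rw [hw] at e1
        exact S.pred_edge_mem_edgeNhd hX hT hL hx hz ha (by omega)
      · rw [h, hrw] at hj
        omega
  -- The transition sits at the cutoff, about `L` levels beyond `x`. The edge to `x` has a neighbour
  -- on the geodesic from `o` to `o'` or on the second path, in the latter case at an index at most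
  -- `j`, because neighbours are within `L`.
  have case_cut : σ ∈ S'.transitions L z → X.dist o' x + L ≤ X.dist o' σ.1 →
      X.dist o' σ.1 ≤ X.dist o' x + L + 1 →
      ∃ j, j < X.dist o' z ∧ S'.trans L z j = σ ∧ j ≤ X.dist o' x + L ∧
      ∃ f, s(w, x) ∈ branchNhd o hX L f ∧
        ((∃ p ∈ relevant S' L z j, f ∈ (geo hX o p).edges) ∨
          ∃ i ≤ j, f = s(S'.path z i, S'.path z (i + 1))) := by
    intro h1 h2 h3
    obtain ⟨j, hj, rfl⟩ := S'.mem_transitions.1 h1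
    rw [S'.dist_fst_trans hX hj] at h2 h3
    refine ⟨j, hj, rfl, by omega, ?_⟩
    obtain ⟨γ, hγ, hmem⟩ := S.exists_walk_pred_mem hX hx hz
    obtain ⟨β, hβ, hβ'⟩ : ∃ β : X.Walk o' z, IsGeodesic β ∧
        (∀ f ∈ β.edges, ∃ i < X.dist o' z, f = s(S'.path z i, S'.path z (i + 1))) := by
      have h := S'.exists_walk_edges hX z le_rfl
      rw [S'.path_dist] at h
      obtain ⟨β, hβ, hβ', -⟩ := h
      exact ⟨β, hβ, hβ'⟩
    obtain ⟨f, hf, hfe⟩ := exists_mem_edgeNhd_of_mem_edges hX hT hL (isGeodesic_geo hX o o')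
      hβ hγ hmem
    refine ⟨f, edgeNhd_subset_branchNhd hX L f hfe, ?_⟩
    rcases hf with hf | hf
    · exact Or.inl ⟨o', Or.inl ⟨0, by omega, (S'.path_zero z).symm⟩, hf⟩
    · obtain ⟨i, hi, rfl⟩ := hβ' f hf
      refine Or.inr ⟨i, ?_, rfl⟩
      have d1 := dist_le_of_mem_edgeNhd (by omega) hfe (β.edges_subset_edgeSet hf)
        (Sym2.mem_mk_right _ _) (Sym2.mem_mk_right w x)
      have d2 := S'.dist_path hX z (i := i + 1) hi
      have d3 := hX.dist_triangle (u := o') (v := x) (w := S'.path z (i + 1))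
      rw [X.dist_comm (u := x)] at d3
      omega
  classical
  simp only [crossVal] at hjump
  rw [← hr, ← hr'] at hjump
  by_cases hzσ : σ ∈ S'.transitions L z
  · by_cases h1 : X.dist o' σ.1 ≤ X.dist o' w + L
    · by_cases h2 : X.dist o' σ.1 ≤ X.dist o' x + L
      · by_cases h3 : σ ∈ S'.transitions L r
        · by_cases h4 : σ ∈ S'.transitions L r'
          · simp [h1, h2, h3, h4] at hjump
          · exact ⟨z, Or.inl rfl, case_succ z r' (Or.inl ⟨rfl, rfl⟩) hzσ h4 h2⟩
        · exact ⟨z, Or.inl rfl, case_pred z r (Or.inl ⟨rfl, rfl⟩) hzσ h3 h1⟩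
      · exact ⟨z, Or.inl rfl, case_cut hzσ (by omega) (by omega)⟩
    · by_cases h2 : X.dist o' σ.1 ≤ X.dist o' x + L
      · exact ⟨z, Or.inl rfl, case_cut hzσ (by omega) (by omega)⟩
      · simp [h1, h2] at hjump
  · by_cases h3 : σ ∈ S'.transitions L r ∧ X.dist o' σ.1 ≤ X.dist o' w + L
    · exact ⟨r, Or.inr (Or.inl rfl), case_pred r z (Or.inr ⟨rfl, rfl⟩) h3.1 hzσ h3.2⟩
    · by_cases h4 : σ ∈ S'.transitions L r' ∧ X.dist o' σ.1 ≤ X.dist o' x + L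
      · exact ⟨r', Or.inr (Or.inr rfl), case_succ r' z (Or.inr ⟨rfl, rfl⟩) h4.1 hzσ h4.2⟩
      · rw [if_neg h3, if_neg h4] at hjump
        exact absurd rfl hjump

end Jump

end PathSystem

end RelHyp

/-! ### Counting the nonzero entries of the change-of-base matrix -/

namespace RelHyp

variable {V : Type*} {X : SimpleGraph V}

open SimpleGraph

namespace PathSystem

variable {o o' : V} (S : PathSystem X o) (S' : PathSystem X o')

lemma cardLE_cell {L m : ℕ} (hm : ∀ e, CardLE (edgeNhd X L e) m) (x : V) :
    CardLE (S.cell L x) (m * 2) :=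
  (hm s(S.pred x, x)).biUnion fun e _ => CardLE.mem_sym2 e

lemma abs_state_le (hX : X.Connected) {L : ℕ} (hL : 1 ≤ L) (x z q : V) :
    |S.state L x z q| ≤ L := by
  rw [state]
  split_ifs with h
  · have h1 := S.dist_le_of_mem_cell hX hL h
    have h2 := hX.dist_triangle (u := q) (v := x) (w := z)
    have h3 := hX.dist_triangle (u := x) (v := q) (w := z)
    rw [X.dist_comm (u := x) (v := q)] at h3
    rw [abs_le]
    constructor <;> omega
  · simp

/-- A state vanishes off a cell of at most `m * 2` points and takes values between `-L` and `L` on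
it. -/
lemma cardLE_state (hX : X.Connected) {L m : ℕ} (hL : 1 ≤ L)
    (hm : ∀ e, CardLE (edgeNhd X L e) m) (x : V) :
    CardLE {h | ∃ z, h = S.state L x z} ((2 * L + 1) ^ (m * 2)) := by
  classical
  obtain ⟨u, hu, hc⟩ := S.cardLE_cell hm x
  refine ⟨(Fintype.piFinset fun _ : u => Finset.Icc (-L : ℤ) L).image
    fun g q => if h : q ∈ u then g ⟨q, h⟩ else 0, ?_, ?_⟩
  · rintro h ⟨z, rfl⟩
    simp only [Finset.coe_image, Set.mem_image, Finset.mem_coe, Fintype.mem_piFinset,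
      Finset.mem_Icc]
    refine ⟨fun q => S.state L x z q, fun q => abs_le.1 (S.abs_state_le hX hL x z q), ?_⟩
    funext q
    split_ifs with h
    · rfl
    · rw [state, if_neg fun hq => h (hu hq)]
  · refine Finset.card_image_le.trans ?_
    rw [Fintype.card_piFinset]
    simp only [Int.card_Icc, Finset.prod_const, Finset.card_univ, Fintype.card_coe]
    rw [show (L + 1 - -(L : ℤ)).toNat = 2 * L + 1 by omega]
    exact Nat.pow_le_pow_right (by omega) hc

/-- The number of transitions along a given set of edges is bounded. -/
lemma cardLE_transitions_over (hX : X.Connected) {L m n : ℕ} (hL : 1 ≤ L)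
    (hm : ∀ e, CardLE (edgeNhd X L e) m) {B : Set (Sym2 V)} (hB : CardLE B n) :
    CardLE {t | (∃ z, t ∈ S.transitions L z) ∧ s(S.pred t.1, t.1) ∈ B}
      (n * 2 * ((2 * L + 1) ^ (m * 2) * (2 * L + 1) ^ (m * 2))) := by
  refine ((hB.biUnion fun e _ => CardLE.mem_sym2 e).biUnion (f := fun x =>
    {t | ∃ h ∈ {h | ∃ z, h = S.state L (S.pred x) z}, t ∈ (fun h' => (x, h, h')) ''
      {h' | ∃ z, h' = S.state L x z}}) fun x _ =>
    (S.cardLE_state hX hL hm _).biUnion fun h _ =>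
      (S.cardLE_state hX hL hm x).image _).subset ?_
  rintro t ⟨⟨z, hz⟩, ht⟩
  obtain ⟨j, hj, rfl⟩ := S.mem_transitions.1 hz
  refine ⟨_, ⟨_, ht, Sym2.mem_mk_right _ _⟩, _, ⟨z, rfl⟩, _, ⟨z, rfl⟩, ?_⟩
  simp only [trans, S.pred_path_succ hX z hj]

/-- The difference of the values of a function of the nodes at the ends of a transition. -/
noncomputable def diff (G : V → (V → ℤ) → ℂ) (t : V × (V → ℤ) × (V → ℤ)) : ℂ :=
  G t.1 t.2.2 - G (S.pred t.1) t.2.1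

lemma diff_trans (hX : X.Connected) (G : V → (V → ℤ) → ℂ) (L : ℕ) (z : V) {j : ℕ}
    (hj : j < X.dist o z) : S.diff G (S.trans L z j) =
      G (S.path z (j + 1)) (S.state L (S.path z (j + 1)) z) -
        G (S.path z j) (S.state L (S.path z j) z) := by
  rw [diff, trans, S.pred_path_succ hX z hj]

/-- The sum telescopes along the path to `z`; at `o` the state does not depend on the target. -/
lemma sum_diff (hX : X.Connected) (G : V → (V → ℤ) → ℂ) (L : ℕ) (z : V) :
    ∑ t ∈ S.transitions L z, S.diff G t = G z (S.state L z z) - G o (S.state L o o) := by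
  classical
  have h : S.transitions L z = (Finset.range (X.dist o z)).image (S.trans L z) := by
    simp [transitions]
  rw [h, Finset.sum_image (by exact_mod_cast S.trans_injOn hX L z), Finset.sum_congr rfl fun j hj =>
    S.diff_trans hX G L z (Finset.mem_range.1 hj),
    Finset.sum_range_sub fun j => G (S.path z j) (S.state L (S.path z j) z), S.path_dist, S.path_zero]
  congr 2
  rw [state_eq_iff, S.cell_base]
  simp

lemma norm_diff_crossVal_le (L : ℕ) (σ t : V × (V → ℤ) × (V → ℤ)) :
    ‖S.diff (S.crossVal S' L σ) t‖ ≤ 1 := by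
  simp only [diff, crossVal]
  split_ifs <;> simp

/-- The edges close to which a transition of `S'` to `y` matters for a path system at `o`. -/
def core (hX : X.Connected) (o : V) (L : ℕ) (y : V) : Set (Sym2 V) :=
  {f | f ∈ (geo hX o o').edges} ∪ endEdges (geo hX o' y) (8 * L + 1) ∪
    {f | ∃ p ∈ S'.cell L (S'.pred y) ∪ S'.cell L y, f ∈ {f | f ∈ (geo hX y p).edges}}

lemma cardLE_core (hX : X.Connected) {L m : ℕ} (hL : 1 ≤ L)
    (hm : ∀ e, CardLE (edgeNhd X L e) m) {y : V} (hy : y ≠ o') :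
    CardLE (S'.core hX o L y)
      (X.dist o o' + (8 * L + 1 + 1) + (m * 2 + m * 2) * (L + 1)) := by
  refine (((CardLE.edges _).mono subset_rfl (isGeodesic_geo hX o o').le).union
    (cardLE_endEdges hX (isGeodesic_geo hX o' y) _)).union
    (((S'.cardLE_cell hm _).union (S'.cardLE_cell hm _)).biUnion fun p hp =>
      (CardLE.edges _).mono subset_rfl ((isGeodesic_geo hX y p).le.trans ?_))
  rcases hp with hp | hp
  · have h1 := S'.dist_le_of_mem_cell hX hL hp
    have h2 := dist_eq_one_iff_adj.2 (S'.adj_pred hX hy)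
    have h3 := hX.dist_triangle (u := p) (v := S'.pred y) (w := y)
    rw [X.dist_comm]
    omega
  · rw [X.dist_comm]
    exact (S'.dist_le_of_mem_cell hX hL hp).trans (by omega)

section Jump

variable (hX : X.Connected) {D : ℕ} (hT : ThinTriangles X D) {L : ℕ} (hL : 24 * D + 26 ≤ L)
include hX hT hL

/-- A path of `S'` to `y` is close to each geodesic with the same endpoints. -/
lemma exists_mem_geo_of_path {y : V} {i : ℕ} (hi : i < X.dist o' y) :
    ∃ f ∈ (geo hX o' y).edges, s(S'.path y i, S'.path y (i + 1)) ∈ edgeNhd X L f := by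
  have h := S'.exists_walk_edges hX y le_rfl
  rw [S'.path_dist] at h
  obtain ⟨γ, hγ, -, hmem⟩ := h
  obtain ⟨f, hf, h⟩ := exists_mem_edgeNhd_of_mem_edges hX hT hL (isGeodesic_geo hX o' y)
    (β := Walk.nil) (by simp [IsGeodesic]) hγ (hmem i hi)
  exact ⟨f, hf.resolve_right (by simp), h⟩

/-- A vertex relevant for `σ` lies on the path to `σ.1` or in one of two cells at its end. Triangles
move the edges of a geodesic from `o` to it onto geodesics from `o` to `o'`, from `o'` to `σ.1`, or
from `σ.1` into the cells. Of the second one, the level condition leaves only the end. -/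
lemma exists_mem_core_of_jump {σ t : V × (V → ℤ) × (V → ℤ)} {z : V}
    (ht : t ∈ S.transitions L z) (hjump : S.diff (S.crossVal S' L σ) t ≠ 0) :
    ∃ f₂ ∈ S'.core hX o L σ.1, ∃ f₁ ∈ edgeNhd X L f₂, ∃ f ∈ edgeNhd X L f₁,
      s(S.pred t.1, t.1) ∈ branchNhd o hX L f := by
  obtain ⟨n, hn, rfl⟩ := S.mem_transitions.1 ht
  rw [S.diff_trans hX _ L z hn, sub_ne_zero, ← S.pred_path_succ hX z hn] at hjump
  set x := S.path z (n + 1) with hxdef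
  have hxn := S.dist_path hX z (i := n + 1) hn
  rw [← hxdef] at hxn
  have hx : x ≠ o := by
    intro h
    rw [h, X.dist_self] at hxn
    omega
  obtain ⟨z₁, -, j, hj, rfl, hjx, f, hb, hf⟩ := S.exists_relevant_of_jump S' hX hT hL hx
    (S.beyond_path hX z hn) hjump.symm
  change ∃ f₂ ∈ S'.core hX o L (S'.path z₁ (j + 1)), ∃ f₁ ∈ edgeNhd X L f₂, ∃ f ∈ edgeNhd X L f₁,
      s(S.pred x, x) ∈ branchNhd o hX L f
  set y := S'.path z₁ (j + 1) with hydef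
  have hy : X.dist o' y = j + 1 := S'.dist_path hX z₁ hj
  have hpath : ∀ i ≤ j + 1, S'.path z₁ i = S'.path y i := fun i hi =>
    (S'.path_path z₁ (j + 1) i hi hj).symm
  have hpred : S'.path z₁ j = S'.pred y := (S'.pred_path_succ hX z₁ hj).symm
  -- It is at most `2 * L` from `v` to `f` and `5 * L` from there to `x`, and `x` is at most `L + 1`
  -- levels below `y`; this gives the radius `8 * L + 1`.
  have near : ∀ f₂ ∈ (geo hX o' y).edges, ∀ f₁ ∈ edgeNhd X L f₂, f ∈ edgeNhd X L f₁ →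
      f₂ ∈ S'.core hX o L y := by
    intro f₂ h₂ f₁ h₁ h
    refine Or.inl (Or.inr ⟨h₂, _, Sym2.out_fst_mem f₂, ?_⟩)
    have e₂ : f₂ ∈ X.edgeSet := (geo hX o' y).edges_subset_edgeSet h₂
    have e₁ := mem_edgeSet_of_mem_edgeNhd h₁ e₂
    have e := mem_edgeSet_of_mem_edgeNhd h e₁
    set v := (Quot.out f₂).1 with hv
    have d1 := dist_le_of_mem_edgeNhd (by omega) h₁ e₂ (Sym2.out_fst_mem f₂) (Sym2.out_fst_mem f₁)
    have d2 := dist_le_of_mem_edgeNhd (by omega) h e₁ (Sym2.out_fst_mem f₁) (Sym2.out_fst_mem f)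
    have d3 := dist_le_of_mem_branchNhd hX (by omega) hb e (Sym2.out_fst_mem f)
      (Sym2.mem_mk_right (S.pred x) x)
    have t1 := hX.dist_triangle (u := v) (v := (Quot.out f₁).1) (w := (Quot.out f).1)
    have t2 := hX.dist_triangle (u := v) (v := (Quot.out f).1) (w := x)
    have t3 := hX.dist_triangle (u := o') (v := v) (w := x)
    have t4 := (isGeodesic_geo hX o' y).dist_add hX
      (mem_support_of_mem_edges h₂ (Sym2.out_fst_mem f₂))
    rw [← hv] at d1 t4
    omega
  rcases hf with ⟨p, hp, hf⟩ | ⟨i, hi, rfl⟩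
  · rcases hp with ⟨i, hi, rfl⟩ | hp
    · obtain ⟨β, hβ, hβ', -⟩ := S'.exists_walk_edges hX z₁ (k := i) (by omega)
      obtain ⟨f₁, h₁, h⟩ := exists_mem_edgeNhd_of_mem_edges hX hT hL (isGeodesic_geo hX o o') hβ
        (isGeodesic_geo hX _ _) hf
      rcases h₁ with h₁ | h₁
      · exact ⟨f₁, Or.inl (Or.inl h₁), f₁, mem_edgeNhd_self L _, f, h, hb⟩
      · obtain ⟨l, hl, rfl⟩ := hβ' _ h₁
        rw [hpath l (by omega), hpath (l + 1) (by omega)] at h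
        obtain ⟨f₂, h₂, h'⟩ := S'.exists_mem_geo_of_path hX hT hL (y := y) (i := l) (by omega)
        exact ⟨f₂, near _ h₂ _ h' h, _, h', f, h, hb⟩
    · obtain ⟨f₁, h₁, h⟩ := exists_mem_edgeNhd_of_mem_edges hX hT hL (isGeodesic_geo hX o o')
        (isGeodesic_geo hX o' p) (isGeodesic_geo hX _ _) hf
      rcases h₁ with h₁ | h₁
      · exact ⟨f₁, Or.inl (Or.inl h₁), f₁, mem_edgeNhd_self L _, f, h, hb⟩
      · obtain ⟨f₂, h₂, h'⟩ := exists_mem_edgeNhd_of_mem_edges hX hT hL (isGeodesic_geo hX o' y)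
          (isGeodesic_geo hX y p) (isGeodesic_geo hX _ _) h₁
        rcases h₂ with h₂ | h₂
        · exact ⟨f₂, near _ h₂ _ h' h, _, h', f, h, hb⟩
        · rw [hpred] at hp
          exact ⟨f₂, Or.inr ⟨p, hp, h₂⟩, _, h', f, h, hb⟩
  · have h := mem_edgeNhd_self (X := X) L s(S'.path z₁ i, S'.path z₁ (i + 1))
    obtain ⟨f₂, h₂, h'⟩ := S'.exists_mem_geo_of_path hX hT hL (y := y) (i := i) (by omega)
    rw [← hpath i (by omega), ← hpath (i + 1) (by omega)] at h'
    exact ⟨f₂, near _ h₂ _ h' h, _, h', _, h, hb⟩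

/-- The number of transitions of `S` at which the indicator function of a given transition of `S'`
changes its value. -/
lemma cardLE_row {m : ℕ} (hm : ∀ e, CardLE (edgeNhd X L e) m) {σ : V × (V → ℤ) × (V → ℤ)}
    (hσ : σ.1 ≠ o') :
    CardLE {t | (∃ z, t ∈ S.transitions L z) ∧ S.diff (S.crossVal S' L σ) t ≠ 0}
      ((X.dist o o' + (8 * L + 1 + 1) + (m * 2 + m * 2) * (L + 1)) *
        (m * (m * (m * (m + m * (2 * ((2 * L + 1) * m)))))) * 2 *
        ((2 * L + 1) ^ (m * 2) * (2 * L + 1) ^ (m * 2))) := by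
  refine (S.cardLE_transitions_over hX (by omega) hm
    ((S'.cardLE_core (o := o) hX (by omega) hm hσ).biUnion fun f₂ _ => (hm f₂).biUnion fun f₁ _ =>
      (hm f₁).biUnion fun f _ => cardLE_branchNhd (o := o) hX hm f)).subset ?_
  rintro t ⟨⟨z, hz⟩, ht⟩
  exact ⟨⟨z, hz⟩, S.exists_mem_core_of_jump S' hX hT hL hz ht⟩

/-- The number of transitions of `S'` whose indicator function changes its value at a given
transition of `S`. -/
lemma cardLE_column (t : V × (V → ℤ) × (V → ℤ)) (ht : ∃ z, t ∈ S.transitions L z) :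
    CardLE {σ | S.diff (S.crossVal S' L σ) t ≠ 0} (3 * (2 * X.dist o o' + 7 * L + 2)) := by
  classical
  obtain ⟨z, hz⟩ := ht
  obtain ⟨n, hn, rfl⟩ := S.mem_transitions.1 hz
  set x := S.path z (n + 1) with hxdef
  have hxn := S.dist_path hX z (i := n + 1) hn
  rw [← hxdef] at hxn
  have hx : x ≠ o := by
    intro h
    rw [h, X.dist_self] at hxn
    omega
  set r := S.rep L (S.pred x) (S.state L (S.pred x) z)
  set r' := S.rep L x (S.state L x z)
  have hthree : CardLE ({z, r, r'} : Set V) 3 :=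
    ⟨{z, r, r'}, by simp, Finset.card_le_three⟩
  -- The level condition bounds `j` from above. From below, `x` has level `n + 1` and is within `5 *
  -- L` of an edge whose distance from `o` is at most `dist o o' + j + 1 + L`.
  have hint : CardLE (Finset.Icc (n + 1 - (X.dist o o' + 6 * L + 1)) (n + 1 + X.dist o o' + L) : Set ℕ)
      (2 * X.dist o o' + 7 * L + 2) := by
    refine ⟨Finset.Icc (n + 1 - (X.dist o o' + 6 * L + 1)) (n + 1 + X.dist o o' + L), by simp, ?_⟩
    rw [Nat.card_Icc]
    omega
  refine (hthree.biUnion fun z₁ _ => hint.image (S'.trans L z₁)).subset ?_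
  intro σ hσ
  rw [Set.mem_ofPred_eq, S.diff_trans hX _ L z hn, sub_ne_zero, ← S.pred_path_succ hX z hn,
    ← hxdef] at hσ
  obtain ⟨z₁, hz₁, j, hj, rfl, hjx, f, hb, hf⟩ := S.exists_relevant_of_jump S' hX hT hL hx
    (S.beyond_path hX z hn) hσ.symm
  refine ⟨z₁, by simpa using hz₁, j, ?_, rfl⟩
  have tx := hX.dist_triangle (u := o') (v := o) (w := x)
  rw [X.dist_comm (u := o') (v := o)] at tx
  have key : ∀ v ∈ f, f ∈ X.edgeSet → X.dist o v ≤ X.dist o o' + j + 1 + L →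
      j ∈ (Finset.Icc (n + 1 - (X.dist o o' + 6 * L + 1)) (n + 1 + X.dist o o' + L) : Set ℕ) := by
    intro v hv he hd
    have d := dist_le_of_mem_branchNhd hX (by omega) hb he hv (Sym2.mem_mk_right (S.pred x) x)
    have t1 := hX.dist_triangle (u := o) (v := v) (w := x)
    simp only [Finset.coe_Icc, Set.mem_Icc]
    omega
  rcases hf with ⟨p, hp, hf⟩ | ⟨i, hi, rfl⟩
  · refine key _ (Sym2.out_fst_mem f) ((geo hX o p).edges_subset_edgeSet hf) ?_
    have t1 := (isGeodesic_geo hX o p).dist_add hX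
      (mem_support_of_mem_edges hf (Sym2.out_fst_mem f))
    have t2 := hX.dist_triangle (u := o) (v := o') (w := p)
    have t3 : X.dist o' p ≤ j + 1 + L := by
      rcases hp with ⟨i, hi, rfl⟩ | hp | hp
      · rw [S'.dist_path hX z₁ (by omega)]
        omega
      · have := S'.dist_le_of_mem_cell hX (by omega) hp
        have h' := S'.dist_path hX z₁ (i := j) (by omega)
        have := hX.dist_triangle (u := o') (v := S'.path z₁ j) (w := p)
        rw [X.dist_comm (u := S'.path z₁ j) (v := p)] at this
        omega
      · have := S'.dist_le_of_mem_cell hX (by omega) hp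
        have h' := S'.dist_path hX z₁ (i := j + 1) (by omega)
        have := hX.dist_triangle (u := o') (v := S'.path z₁ (j + 1)) (w := p)
        rw [X.dist_comm (u := S'.path z₁ (j + 1)) (v := p)] at this
        omega
    omega
  · refine key _ (Sym2.mem_mk_left _ _) (S'.path_adj z₁ i (by omega)) ?_
    have h' := S'.dist_path hX z₁ (i := i) (by omega)
    have := hX.dist_triangle (u := o) (v := o') (w := S'.path z₁ i)
    omega

end Jump

end PathSystem

end RelHyp

/-! ### Flows and the change of the base vertex -/

namespace RelHyp

variable {V : Type*} {X : SimpleGraph V}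

open SimpleGraph

/-- Cauchy–Schwarz, where at most `n` coefficients contribute to the first factor. -/
lemma norm_sum_mul_sq_le {ι : Type*} {s : Finset ι} {a b : ι → ℂ} {M : ℝ} {n : ℕ}
    (hM : ∀ i ∈ s, ‖a i‖ ≤ M) (hn : CardLE {i | i ∈ s ∧ a i ≠ 0} n) :
    ‖∑ i ∈ s, a i * b i‖ ^ 2 ≤ M ^ 2 * n * ∑ i ∈ s, ‖b i‖ ^ 2 := by
  classical
  have hn' : (s.filter (a · ≠ 0)).card ≤ n := CardLE.card_le (by simpa using hn)
  have h1 : ‖∑ i ∈ s, a i * b i‖ ≤ ∑ i ∈ s, ‖a i‖ * ‖b i‖ :=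
    (norm_sum_le _ _).trans_eq (Finset.sum_congr rfl fun i _ => norm_mul _ _)
  have h2 := Finset.sum_mul_sq_le_sq_mul_sq s (fun i => ‖a i‖) fun i => ‖b i‖
  have h3 : ∑ i ∈ s, ‖a i‖ ^ 2 ≤ M ^ 2 * n := by
    rw [← Finset.sum_filter_of_ne (p := (a · ≠ 0)) (fun i _ h => by
      rintro h0
      simp [h0] at h)]
    refine (Finset.sum_le_card_nsmul _ _ (M ^ 2) fun i hi =>
      pow_le_pow_left₀ (norm_nonneg _) (hM i (Finset.mem_filter.1 hi).1) 2).trans ?_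
    rw [nsmul_eq_mul, mul_comm]
    exact mul_le_mul_of_nonneg_left (by exact_mod_cast hn') (sq_nonneg M)
  calc ‖∑ i ∈ s, a i * b i‖ ^ 2 ≤ (∑ i ∈ s, ‖a i‖ * ‖b i‖) ^ 2 :=
        pow_le_pow_left₀ (norm_nonneg _) h1 2
    _ ≤ (∑ i ∈ s, ‖a i‖ ^ 2) * ∑ i ∈ s, ‖b i‖ ^ 2 := h2
    _ ≤ _ := mul_le_mul_of_nonneg_right h3 (Finset.sum_nonneg fun i _ => sq_nonneg _)

/-- The Schur test for matrices with few entries, all of them bounded by `1`. -/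
lemma sum_norm_sum_mul_sq_le {ι κ : Type*} {s : Finset ι} {u : Finset κ} {a : κ → ι → ℂ} {b : ι → ℂ}
    {m n : ℕ} (ha : ∀ k i, ‖a k i‖ ≤ 1) (hm : ∀ k ∈ u, CardLE {i | i ∈ s ∧ a k i ≠ 0} m)
    (hn : ∀ i ∈ s, CardLE {k | a k i ≠ 0} n) :
    ∑ k ∈ u, ‖∑ i ∈ s, a k i * b i‖ ^ 2 ≤ m * n * ∑ i ∈ s, ‖b i‖ ^ 2 := by
  classical
  have h1 : ∀ k ∈ u, ‖∑ i ∈ s, a k i * b i‖ ^ 2 ≤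
      m * ∑ i ∈ s, if a k i ≠ 0 then ‖b i‖ ^ 2 else 0 := by
    intro k hk
    -- Setting `b` to zero where the row vanishes keeps the positions of the nonzero entries in the
    -- bound, so that the column bound applies after exchanging the sums.
    have h := norm_sum_mul_sq_le (s := s) (a := a k) (b := fun i => if a k i ≠ 0 then b i else 0)
      (M := 1) (fun i _ => ha k i) (hm k hk)
    rw [one_pow, one_mul] at h
    convert h using 3 with i i
    · refine Finset.sum_congr rfl fun i _ => ?_
      split_ifs with h0
      · rfl
      · simp [not_not.1 h0]
    · split_ifs <;> simp
  refine (Finset.sum_le_sum h1).trans ?_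
  rw [← Finset.mul_sum, Finset.sum_comm, mul_assoc, Finset.mul_sum (a := (n : ℝ))]
  refine mul_le_mul_of_nonneg_left (Finset.sum_le_sum fun i hi => ?_) (Nat.cast_nonneg m)
  rw [← Finset.sum_filter, Finset.sum_const, nsmul_eq_mul]
  refine mul_le_mul_of_nonneg_right ?_ (sq_nonneg _)
  exact_mod_cast CardLE.card_le ((hn i hi).subset (by intro k hk; simpa using (Finset.mem_filter.1 hk).2))

/-- The sum of the values of a finitely supported function. -/
noncomputable def total (V : Type*) : (V →₀ ℂ) →ₗ[ℂ] ℂ := Finsupp.linearCombination ℂ fun _ => 1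

namespace PathSystem

variable {o o' : V} (S : PathSystem X o) (S' : PathSystem X o')

/-- The total mass sent along the transition `t`. -/
noncomputable def flow (L : ℕ) (t : V × (V → ℤ) × (V → ℤ)) : (V →₀ ℂ) →ₗ[ℂ] ℂ :=
  open Classical in Finsupp.linearCombination ℂ fun z => if t ∈ S.transitions L z then 1 else 0

/-- The transitions on the paths to the points of the support of `f`. -/
noncomputable def carrier (L : ℕ) (f : V →₀ ℂ) : Finset (V × (V → ℤ) × (V → ℤ)) :=
  open Classical in f.support.biUnion (S.transitions L)

lemma exists_of_mem_carrier {L : ℕ} {f : V →₀ ℂ} {t : V × (V → ℤ) × (V → ℤ)}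
    (h : t ∈ S.carrier L f) : ∃ z, t ∈ S.transitions L z := by
  obtain ⟨z, -, hz⟩ := by simpa only [carrier, Finset.mem_biUnion] using h
  exact ⟨z, hz⟩

lemma flow_eq_zero {L : ℕ} {f : V →₀ ℂ} {t : V × (V → ℤ) × (V → ℤ)}
    (h : t ∉ S.carrier L f) : S.flow L t f = 0 := by
  rw [flow, Finsupp.linearCombination_apply]
  refine Finset.sum_eq_zero fun z hz => ?_
  have ht : t ∉ S.transitions L z := fun ht =>
    h (by simpa only [carrier, Finset.mem_biUnion] using ⟨z, hz, ht⟩)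
  simp only [if_neg ht, smul_zero]

/-- By telescoping, the value at `z` is a sum over the transitions to `z` plus a constant, and total
mass zero annihilates the constant. -/
lemma linearCombination_eq_sum (hX : X.Connected) (L : ℕ) (G : V → (V → ℤ) → ℂ) {f : V →₀ ℂ}
    (hf : total V f = 0) :
    Finsupp.linearCombination ℂ (fun z => G z (S.state L z z)) f =
      ∑ t ∈ S.carrier L f, S.diff G t * S.flow L t f := by
  classical
  have h1 : ∀ z ∈ f.support, G z (S.state L z z) =
      ∑ t ∈ S.carrier L f, S.diff G t * (if t ∈ S.transitions L z then 1 else 0) +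
        G o (S.state L o o) := by
    intro z hz
    rw [← sub_eq_iff_eq_add, ← S.sum_diff hX G L z]
    simp only [mul_ite, mul_one, mul_zero]
    rw [← Finset.sum_filter]
    refine Finset.sum_congr ?_ fun _ _ => rfl
    ext t
    simp only [carrier, Finset.mem_filter, Finset.mem_biUnion]
    exact ⟨fun h => ⟨⟨z, hz, h⟩, h⟩, fun h => h.2⟩
  rw [total, Finsupp.linearCombination_apply, Finsupp.sum] at hf
  simp only [flow, Finsupp.linearCombination_apply, Finsupp.sum, smul_eq_mul, mul_one] at hf ⊢
  rw [Finset.sum_congr rfl fun z hz => by rw [h1 z hz]]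
  simp only [mul_add, Finset.sum_add_distrib, Finset.mul_sum]
  rw [← Finset.sum_mul, hf, zero_mul, add_zero, Finset.sum_comm]
  refine Finset.sum_congr rfl fun t _ => Finset.sum_congr rfl fun z _ => by ring

lemma norm_linearCombination_sq_le (hX : X.Connected) {L : ℕ} {G : V → (V → ℤ) → ℂ} {f : V →₀ ℂ}
    (hf : total V f = 0) {M : ℝ} {n : ℕ}
    (hM : ∀ t, (∃ z, t ∈ S.transitions L z) → ‖S.diff G t‖ ≤ M)
    (hn : CardLE {t | (∃ z, t ∈ S.transitions L z) ∧ S.diff G t ≠ 0} n) :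
    ‖Finsupp.linearCombination ℂ (fun z => G z (S.state L z z)) f‖ ^ 2 ≤
      M ^ 2 * n * ∑ t ∈ S.carrier L f, ‖S.flow L t f‖ ^ 2 := by
  rw [S.linearCombination_eq_sum hX L G hf]
  exact norm_sum_mul_sq_le (fun t ht => hM t (S.exists_of_mem_carrier ht))
    (hn.subset fun t ht => ⟨S.exists_of_mem_carrier ht.1, ht.2⟩)

/-- A constant bounding the effect of a change of the base point. -/
def baseChangeConst (L m : ℕ) : ℕ :=
  (8 * L + 1 + 1 + (m * 2 + m * 2) * (L + 1)) *
    (m * (m * (m * (m + m * (2 * ((2 * L + 1) * m)))))) * 2 *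
    ((2 * L + 1) ^ (m * 2) * (2 * L + 1) ^ (m * 2)) + 3 * (7 * L + 2)

/-- The effect on flows of a change of the base point. -/
theorem sum_norm_flow_sq_le (hX : X.Connected) {D : ℕ} (hT : ThinTriangles X D) {L : ℕ}
    (hL : 24 * D + 26 ≤ L) {m : ℕ} (hm : ∀ e, CardLE (edgeNhd X L e) m) {f : V →₀ ℂ}
    (hf : total V f = 0) (u : Finset (V × (V → ℤ) × (V → ℤ))) :
    ∑ σ ∈ u, ‖S'.flow L σ f‖ ^ 2 ≤ (baseChangeConst L m * (1 + X.dist o o')) ^ 2 *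
      ∑ t ∈ S.carrier L f, ‖S.flow L t f‖ ^ 2 := by
  classical
  set C := baseChangeConst L m with hC
  -- No transition ends at `o'`; such `σ` are not covered by the row bound.
  have hzero : ∀ σ : V × (V → ℤ) × (V → ℤ), σ.1 = o' → S'.flow L σ f = 0 := by
    intro σ hσ
    refine S'.flow_eq_zero fun h => ?_
    obtain ⟨z, hz⟩ := S'.exists_of_mem_carrier h
    obtain ⟨j, hj, rfl⟩ := S'.mem_transitions.1 hz
    have := S'.dist_fst_trans hX (L := L) hj
    rw [hσ, X.dist_self] at this
    omega
  have hexp : ∀ σ, S'.flow L σ f =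
      ∑ t ∈ S.carrier L f, S.diff (S.crossVal S' L σ) t * S.flow L t f := by
    intro σ
    rw [← S.linearCombination_eq_sum hX L _ hf]
    simp only [S.crossVal_end S' hX]
    rfl
  -- For `a ≥ 1` the distance `N` is absorbed by a factor `1 + N`.
  have hcoef : ∀ a b c d N : ℕ, (N + a + b) * c * 2 * d ≤ ((a + b) * c * 2 * d + 0) * (1 + N) ∨
      a = 0 := by
    intro a b c d N
    rcases Nat.eq_zero_or_pos a with h | h
    · exact Or.inr h
    · left
      have h1 : N + a + b ≤ (a + b) * (1 + N) := by nlinarith [Nat.zero_le (b * N), Nat.mul_le_mul_right N h]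
      calc (N + a + b) * c * 2 * d ≤ ((a + b) * (1 + N)) * c * 2 * d := by gcongr
        _ = _ := by ring
  have hrow : ∀ σ ∈ u.filter (·.1 ≠ o'), CardLE
      {t | t ∈ S.carrier L f ∧ S.diff (S.crossVal S' L σ) t ≠ 0} (C * (1 + X.dist o o')) := by
    intro σ hσ
    refine (S.cardLE_row S' hX hT hL hm (Finset.mem_filter.1 hσ).2).mono
      (fun t ht => ⟨S.exists_of_mem_carrier ht.1, ht.2⟩) ?_
    refine ((hcoef (8 * L + 1 + 1) _ _ _ _).resolve_right (Nat.succ_ne_zero _)).trans ?_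
    refine Nat.mul_le_mul_right _ ?_
    rw [hC, baseChangeConst]
    exact Nat.add_le_add_left (Nat.zero_le _) _
  have hcol : ∀ t ∈ S.carrier L f, CardLE {σ | S.diff (S.crossVal S' L σ) t ≠ 0}
      (C * (1 + X.dist o o')) := by
    intro t ht
    refine (S.cardLE_column S' hX hT hL t (S.exists_of_mem_carrier ht)).mono subset_rfl ?_
    have h1 : 3 * (7 * L + 2) ≤ C := Nat.le_add_left _ _
    calc 3 * (2 * X.dist o o' + 7 * L + 2) ≤ (3 * (7 * L + 2)) * (1 + X.dist o o') := by
          nlinarith [Nat.zero_le (L * X.dist o o')]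
      _ ≤ _ := Nat.mul_le_mul_right _ h1
  have h := sum_norm_sum_mul_sq_le (b := fun t => S.flow L t f)
    (fun σ t => S.norm_diff_crossVal_le S' L σ t) hrow hcol
  calc ∑ σ ∈ u, ‖S'.flow L σ f‖ ^ 2 = ∑ σ ∈ u.filter (·.1 ≠ o'), ‖S'.flow L σ f‖ ^ 2 := by
        refine (Finset.sum_filter_of_ne (s := u) (p := (·.1 ≠ o')) fun σ _ h h' => h ?_).symm
        simp [hzero σ h']
    _ ≤ _ := by
        simp only [hexp]
        refine h.trans_eq ?_
        push_cast
        ring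

end PathSystem

end RelHyp

/-! ### Gromov products as functionals -/

namespace RelHyp

variable {V : Type*} {X : SimpleGraph V}

open SimpleGraph

/-- Twice the Gromov product of `y` and `z` based at `o`. -/
noncomputable def gromov (X : SimpleGraph V) (o y z : V) : ℕ := X.dist o z + X.dist o y - X.dist y z

lemma gromov_eq (hX : X.Connected) (o y z : V) :
    (gromov X o y z : ℤ) = X.dist o z + X.dist o y - X.dist y z := by
  have h := hX.dist_triangle (u := y) (v := o) (w := z)
  rw [X.dist_comm (u := y) (v := o)] at h
  rw [gromov, Nat.cast_sub (by omega)]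
  push_cast
  ring

lemma gromov_le (hX : X.Connected) (o y z : V) : gromov X o y z ≤ 2 * X.dist o z := by
  have h1 := gromov_eq hX o y z
  have h2 := hX.dist_triangle (u := o) (v := z) (w := y)
  rw [X.dist_comm (u := z) (v := y)] at h2
  omega

namespace PathSystem

variable {o : V} (S : PathSystem X o)

/-- The value of the Gromov product with `y` at the node `(x, h)` of `S`. -/
noncomputable def gromovVal (L : ℕ) (y x : V) (h : V → ℤ) : ℕ :=
  min (gromov X o y (S.rep L x h)) (2 * X.dist o x + 2 * L)

lemma gromovVal_end (hX : X.Connected) (L : ℕ) (y z : V) :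
    S.gromovVal L y z (S.state L z z) = gromov X o y z := by
  rw [gromovVal, S.rep_eq_self rfl]
  have := gromov_le hX o y z
  omega

section Jump

variable (hX : X.Connected) {D : ℕ} (hT : ThinTriangles X D) {L : ℕ} (hL : 24 * D + 26 ≤ L)
include hX

/-- For `z` beyond `x`, the product with `y` depends on `z` only through `dist y z - dist x z`. The
state determines this number if `y` is in the cell, or if all geodesics from `y` to the two targets
cross the cell. -/
lemma exists_misses_of_gromov_ne {y x z₁ z₂ : V} (h₁ : Beyond X o x z₁) (h₂ : Beyond X o x z₂)
    (hst : S.state L x z₁ = S.state L x z₂) (hne : gromov X o y z₁ ≠ gromov X o y z₂) :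
    y ∉ S.cell L x ∧ ∃ ζ, (ζ = z₁ ∨ ζ = z₂) ∧ Misses X (S.cell L x) y ζ := by
  have e1 := gromov_eq hX o y z₁
  have e2 := gromov_eq hX o y z₂
  simp only [Beyond] at h₁ h₂
  rw [state_eq_iff] at hst
  have hy : y ∉ S.cell L x := fun hy => by
    have := hst y hy
    omega
  refine ⟨hy, ?_⟩
  by_contra hcon
  push Not at hcon
  have cross : ∀ a b, (a = z₁ ∨ a = z₂) → (∀ q ∈ S.cell L x,
      (X.dist q a : ℤ) - X.dist x a = X.dist q b - X.dist x b) →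
      (X.dist y b : ℤ) - X.dist x b ≤ X.dist y a - X.dist x a := by
    intro a b ha hab
    obtain ⟨β, hβ⟩ := exists_geodesic hX y a
    have : ¬ ∀ q ∈ β.support, q ∈ S.cell L x → q = y := fun h => hcon a ha ⟨β, hβ, h⟩
    push Not at this
    obtain ⟨q, hq, hqc, -⟩ := this
    have h1 := hβ.dist_add hX hq
    have h2 := hab q hqc
    have h3 := hX.dist_triangle (u := y) (v := q) (w := b)
    omega
  have c1 := cross z₁ z₂ (Or.inl rfl) hst
  have c2 := cross z₂ z₁ (Or.inr rfl) fun q hq => (hst q hq).symm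
  omega

include hT hL

/-- Both representatives are compared with `z`, as for transitions. If both have the product of `z`,
the jump comes from the truncation, which takes effect only near the geodesic from `o` to `y`. -/
lemma exists_branch_of_gromovVal_ne {y x z : V} (hx : x ≠ o) (hz : Beyond X o x z)
    (hne : S.gromovVal L y (S.pred x) (S.state L (S.pred x) z) ≠
      S.gromovVal L y x (S.state L x z)) :
    ∃ f ∈ (geo hX o y).edges, s(S.pred x, x) ∈ branchNhd o hX L f := by
  have hdw := S.dist_pred hX hx
  have hadj := S.adj_pred hX hx
  have hwx := dist_eq_one_iff_adj.2 hadj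
  have hzw : Beyond X o (S.pred x) z := by
    have h1 : X.dist o z = X.dist o x + X.dist x z := hz
    have h2 := hX.dist_triangle (u := S.pred x) (v := x) (w := z)
    have h3 := hX.dist_triangle (u := o) (v := S.pred x) (w := z)
    simp only [Beyond]
    omega
  by_cases hr' : gromov X o y (S.rep L x (S.state L x z)) = gromov X o y z
  · by_cases hr : gromov X o y (S.rep L (S.pred x) (S.state L (S.pred x) z)) = gromov X o y z
    · have hlt : 2 * X.dist o (S.pred x) + 2 * L < gromov X o y z := by
        rw [gromovVal, gromovVal, hr, hr'] at hne
        omega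
      obtain ⟨γ, hγ, hmem⟩ := S.exists_walk_pred_mem hX hx hz
      obtain ⟨f, hf, hfe⟩ := exists_mem_edgeNhd_of_mem_edges hX hT hL (isGeodesic_geo hX o y)
        (isGeodesic_geo hX y z) hγ hmem
      rcases hf with hf | hf
      · exact ⟨f, hf, edgeNhd_subset_branchNhd hX L f hfe⟩
      -- A neighbour on the geodesic from `y` to `z` would keep twice the product within `2 * X.dist
      -- o (S.pred x) + 2 * L`.
      · exfalso
        set v := (Quot.out f).1 with hv
        have d1 := dist_le_of_mem_edgeNhd (by omega) hfe ((geo hX y z).edges_subset_edgeSet hf)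
          (Sym2.out_fst_mem f) (Sym2.mem_mk_left (S.pred x) x)
        have d2 := (isGeodesic_geo hX y z).dist_add hX
          (mem_support_of_mem_edges hf (Sym2.out_fst_mem f))
        rw [← hv] at d1 d2
        have t1 := hX.dist_triangle (u := o) (v := v) (w := z)
        have t2 := hX.dist_triangle (u := o) (v := v) (w := y)
        have t3 := hX.dist_triangle (u := o) (v := S.pred x) (w := v)
        rw [X.dist_comm (u := v) (v := y)] at t2
        rw [X.dist_comm (u := S.pred x) (v := v)] at t3
        have e := gromov_eq hX o y z
        omega
    · obtain ⟨hy, ζ, hζ, hm⟩ := S.exists_misses_of_gromov_ne hX hzw (S.beyond_rep L _ _)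
        (S.state_rep hzw).symm (Ne.symm hr)
      exact S.branch_of_misses hX hT hL hx hz hζ hm
        (Or.inl fun h => hy (h ▸ S.self_mem_cell L _)) (isGeodesic_geo hX o y)
  · obtain ⟨-, ζ, hζ, hm⟩ := S.exists_misses_of_gromov_ne hX hz (S.beyond_rep L _ _)
      (S.state_rep hz).symm (Ne.symm hr')
    have hζ' : Beyond X o x ζ := by
      rcases hζ with rfl | rfl
      · exact hz
      · exact S.beyond_rep L _ _
    exact S.branch_of_misses_succ hX hT hL hx hζ' hm (isGeodesic_geo hX o y)

omit hT hL in
-- Near the geodesic from `o` to `y` the value is `2 * X.dist o x` up to a constant, which bounds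
-- its jumps there.
lemma gromovVal_near {y x v : V} {n : ℕ} (h : V → ℤ) (hv : v ∈ (geo hX o y).support)
    (hd : X.dist v x ≤ n) :
    2 * X.dist o x ≤ S.gromovVal L y x h + 2 * n ∧
      S.gromovVal L y x h ≤ 2 * X.dist o x + 2 * L := by
  refine ⟨?_, min_le_right _ _⟩
  have h0 : X.dist o (S.rep L x h) = X.dist o x + X.dist x (S.rep L x h) := S.beyond_rep L x h
  have h1 := (isGeodesic_geo hX o y).dist_add hX hv
  have h2 := hX.dist_triangle (u := y) (v := v) (w := S.rep L x h)
  have h3 := hX.dist_triangle (u := v) (v := x) (w := S.rep L x h)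
  have h4 := hX.dist_triangle (u := o) (v := v) (w := x)
  have h5 := gromov_eq hX o y (S.rep L x h)
  rw [X.dist_comm (u := y) (v := v)] at h2
  rw [gromovVal]
  omega

omit hT hL in
lemma exists_trans_data {t : V × (V → ℤ) × (V → ℤ)} (ht : ∃ z, t ∈ S.transitions L z) :
    ∃ z, t.1 ≠ o ∧ Beyond X o t.1 z ∧ t.2.1 = S.state L (S.pred t.1) z ∧
      t.2.2 = S.state L t.1 z := by
  obtain ⟨z, hz⟩ := ht
  obtain ⟨n, hn, rfl⟩ := S.mem_transitions.1 hz
  refine ⟨z, ?_, S.beyond_path hX z hn, ?_, rfl⟩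
  · intro h
    have := S.dist_fst_trans hX (L := L) hn
    rw [h, X.dist_self] at this
    omega
  · simp only [trans, S.pred_path_succ hX z hn]

/-- A constant bounding the norm of the Gromov product as a functional. -/
def gromovConst (L m : ℕ) : ℕ :=
  (12 * L + 2) ^ 2 * (m * (m + m * (2 * ((2 * L + 1) * m))) * 2 *
    ((2 * L + 1) ^ (m * 2) * (2 * L + 1) ^ (m * 2)))

/-- Only transitions near the geodesic from `o` to `y` contribute, so their number is linear in
`dist o y`. Each coefficient is at most `12 * L + 2`: twice `5 * L` for the distance to the
geodesic, `2 * L` for the truncation, and `2` for the step. -/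
theorem norm_gromov_sq_le {m : ℕ} (hm : ∀ e, CardLE (edgeNhd X L e) m) {f : V →₀ ℂ}
    (hf : total V f = 0) (y : V) :
    ‖Finsupp.linearCombination ℂ (fun z => (gromov X o y z : ℂ)) f‖ ^ 2 ≤
      gromovConst L m * X.dist o y * ∑ t ∈ S.carrier L f, ‖S.flow L t f‖ ^ 2 := by
  have hbranch : ∀ t, (∃ z, t ∈ S.transitions L z) →
      S.diff (fun x h => (S.gromovVal L y x h : ℂ)) t ≠ 0 →
      ∃ f ∈ (geo hX o y).edges, s(S.pred t.1, t.1) ∈ branchNhd o hX L f := by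
    intro t ht hne
    obtain ⟨z, h0, hz, h1, h2⟩ := S.exists_trans_data hX ht
    refine S.exists_branch_of_gromovVal_ne hX hT hL h0 hz fun h => hne ?_
    rw [diff, h1, h2, h, sub_self]
  have h := S.norm_linearCombination_sq_le hX
    (G := fun x h => (S.gromovVal L y x h : ℂ)) (M := (12 * L + 2 : ℕ)) hf ?_
    ((S.cardLE_transitions_over hX (by omega) hm (((CardLE.edges (geo hX o y)).mono subset_rfl
      (isGeodesic_geo hX o y).le).biUnion fun f _ => cardLE_branchNhd (o := o) hX hm f)).subset
      fun t ht => ⟨ht.1, hbranch t ht.1 ht.2⟩)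
  · simp only [S.gromovVal_end hX] at h
    refine h.trans_eq ?_
    rw [gromovConst]
    push_cast
    ring
  · intro t ht
    by_cases hne : S.diff (fun x h => (S.gromovVal L y x h : ℂ)) t = 0
    · rw [hne, norm_zero]
      positivity
    · obtain ⟨f, hf, hb⟩ := hbranch t ht hne
      obtain ⟨z, h0, -⟩ := S.exists_trans_data hX ht
      have he := (geo hX o y).edges_subset_edgeSet hf
      have hv := mem_support_of_mem_edges hf (Sym2.out_fst_mem f)
      have b1 := S.gromovVal_near hX (L := L) t.2.2 hv (dist_le_of_mem_branchNhd hX (by omega) hb he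
        (Sym2.out_fst_mem f) (Sym2.mem_mk_right _ _))
      have b2 := S.gromovVal_near hX (L := L) t.2.1 hv (dist_le_of_mem_branchNhd hX (by omega) hb he
        (Sym2.out_fst_mem f) (Sym2.mem_mk_left _ _))
      have hd := S.dist_pred hX h0
      rw [diff, ← Complex.ofReal_natCast, ← Complex.ofReal_natCast, ← Complex.ofReal_sub,
        Complex.norm_real, Real.norm_eq_abs, abs_le]
      generalize S.gromovVal L y t.1 t.2.2 = a at *
      generalize S.gromovVal L y (S.pred t.1) t.2.1 = b at *
      have h1 : a ≤ b + (12 * L + 2) := by omega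
      have h2 : b ≤ a + (12 * L + 2) := by omega
      have h1' : (a : ℝ) ≤ b + (12 * L + 2 : ℕ) := by exact_mod_cast h1
      have h2' : (b : ℝ) ≤ a + (12 * L + 2 : ℕ) := by exact_mod_cast h2
      constructor <;> linarith

end Jump

end PathSystem

end RelHyp

/-! ### Equivariance under automorphisms -/

namespace RelHyp

variable {V : Type*} {X : SimpleGraph V}

open SimpleGraph

section Automorphisms

variable (e : X ≃g X)

lemma dist_apply_le (hX : X.Connected) (e : X ≃g X) (x y : V) :
    X.dist (e x) (e y) ≤ X.dist x y := by
  obtain ⟨p, hp⟩ := hX.exists_walk_length_eq_dist x y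
  rw [← hp]
  simpa using X.dist_le (p.map e.toHom)

lemma dist_apply (hX : X.Connected) (x y : V) : X.dist (e x) (e y) = X.dist x y := by
  refine (dist_apply_le hX e x y).antisymm ?_
  simpa using dist_apply_le hX e.symm (e x) (e y)

lemma map_mem_edgeNhd {L : ℕ} {f e' : Sym2 V} (e : X ≃g X) (h : f ∈ edgeNhd X L e') :
    f.map e ∈ edgeNhd X L (e'.map e) := by
  rcases h with rfl | ⟨v, p, hp, hl, h1, h2⟩
  · exact mem_edgeNhd_self L _
  · refine Or.inr ⟨e v, p.map e.toHom, hp.map e.injective, by simpa using hl, ?_, ?_⟩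
    · rw [Walk.edges_map]
      exact List.mem_map_of_mem h1
    · rw [Walk.edges_map]
      exact List.mem_map_of_mem h2

lemma map_symm_map (f : Sym2 V) : (f.map e).map e.symm = f := by
  induction f with
  | _ a b => simp

lemma map_map_symm (f : Sym2 V) : (f.map e.symm).map e = f := by
  induction f with
  | _ a b => simp

lemma map_mem_edgeNhd_iff {L : ℕ} {f e' : Sym2 V} :
    f.map e ∈ edgeNhd X L (e'.map e) ↔ f ∈ edgeNhd X L e' := by
  refine ⟨fun h => ?_, map_mem_edgeNhd e⟩
  have := map_mem_edgeNhd e.symm h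
  rwa [map_symm_map, map_symm_map] at this

namespace PathSystem

variable {o : V} (S : PathSystem X o)

/-- The image of a system of geodesics under an automorphism. -/
def translate (hX : X.Connected) : PathSystem X (e o) where
  path z i := e (S.path (e.symm z) i)
  path_zero z := by rw [S.path_zero]
  path_dist z := by
    have h := dist_apply e hX o (e.symm z)
    rw [e.apply_symm_apply] at h
    rw [h, S.path_dist, e.apply_symm_apply]
  path_adj z i hi := by
    have h := dist_apply e hX o (e.symm z)
    rw [e.apply_symm_apply] at h
    exact e.map_adj_iff.2 (S.path_adj _ i (h ▸ hi))
  path_path z i k hk hi := by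
    have h := dist_apply e hX o (e.symm z)
    rw [e.apply_symm_apply] at h
    rw [e.symm_apply_apply, S.path_path _ i k hk (h ▸ hi)]
  path_succ_eq z₁ z₂ i h₁ h₂ he ht := by
    have hd₁ := dist_apply e hX o (e.symm z₁)
    have hd₂ := dist_apply e hX o (e.symm z₂)
    rw [e.apply_symm_apply] at hd₁ hd₂
    refine congrArg e (S.path_succ_eq _ _ i (hd₁ ▸ h₁) (hd₂ ▸ h₂) (e.injective he) ?_)
    have key : ∀ z x w, w ∈ toward X (e.symm z) x ↔ e w ∈ toward X z (e x) := by
      intro z x w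
      have h1 := dist_apply e hX x (e.symm z)
      have h2 := dist_apply e hX w (e.symm z)
      rw [e.apply_symm_apply] at h1 h2
      simp only [toward, Set.mem_ofPred_eq, e.map_adj_iff, h1, h2]
    ext w
    rw [key, key, ht]

variable (hX : X.Connected)

lemma translate_path (z : V) (i : ℕ) : (S.translate e hX).path (e z) i = e (S.path z i) := by
  simp [translate]

lemma translate_pred (x : V) : (S.translate e hX).pred (e x) = e (S.pred x) := by
  rw [pred, dist_apply e hX, translate_path, pred]

lemma mem_cell_translate {L : ℕ} {x q : V} :
    e q ∈ (S.translate e hX).cell L (e x) ↔ q ∈ S.cell L x := by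
  have h : s((S.translate e hX).pred (e x), e x) = (s(S.pred x, x)).map e := by
    rw [translate_pred, Sym2.map_mk]
  constructor
  · rintro ⟨f, hf, hq⟩
    refine ⟨f.map e.symm, ?_, ?_⟩
    · rwa [← map_mem_edgeNhd_iff e, ← h, map_map_symm]
    · simpa using Sym2.mem_map (f := e.symm) |>.2 ⟨e q, hq, e.symm_apply_apply q⟩
  · rintro ⟨f, hf, hq⟩
    refine ⟨f.map e, ?_, Sym2.mem_map.2 ⟨q, hq, rfl⟩⟩
    rw [h]
    exact map_mem_edgeNhd e hf

lemma state_translate (L : ℕ) (x z : V) :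
    (S.translate e hX).state L (e x) (e z) = S.state L x z ∘ e.symm := by
  funext q
  obtain ⟨q, rfl⟩ := e.surjective q
  rw [Function.comp_apply, e.symm_apply_apply]
  by_cases hq : q ∈ S.cell L x
  · simp only [state, if_pos hq, if_pos ((S.mem_cell_translate e hX).2 hq), dist_apply e hX]
  · simp only [state, if_neg hq, if_neg (mt (S.mem_cell_translate e hX).1 hq)]

/-- The action of an automorphism on transitions. -/
def transEquiv : V × (V → ℤ) × (V → ℤ) ≃ V × (V → ℤ) × (V → ℤ) :=
  e.toEquiv.prodCongr ((e.toEquiv.arrowCongr (Equiv.refl ℤ)).prodCongr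
    (e.toEquiv.arrowCongr (Equiv.refl ℤ)))

lemma trans_translate (L : ℕ) (z : V) (i : ℕ) :
    (S.translate e hX).trans L (e z) i = transEquiv e (S.trans L z i) := by
  simp only [trans, translate_path, state_translate]
  rfl

lemma mem_transitions_translate {L : ℕ} {z : V} {t : V × (V → ℤ) × (V → ℤ)} :
    transEquiv e t ∈ (S.translate e hX).transitions L (e z) ↔ t ∈ S.transitions L z := by
  simp only [mem_transitions, dist_apply e hX, trans_translate, EmbeddingLike.apply_eq_iff_eq]

lemma flow_translate (L : ℕ) (t : V × (V → ℤ) × (V → ℤ)) (f : V →₀ ℂ) :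
    (S.translate e hX).flow L (transEquiv e t) (f.mapDomain e) = S.flow L t f := by
  classical
  rw [flow, Finsupp.linearCombination_mapDomain, flow]
  congr 1
  congr 1
  funext z
  simp only [Function.comp_apply, mem_transitions_translate]

/-- When path system and function move together, the flows are merely relabelled by `transEquiv`. -/
lemma sum_norm_flow_translate_le (L : ℕ) (f : V →₀ ℂ) (u : Finset (V × (V → ℤ) × (V → ℤ))) :
    ∃ u' : Finset (V × (V → ℤ) × (V → ℤ)),
      ∑ t ∈ u, ‖(S.translate e hX).flow L t (f.mapDomain e)‖ ^ 2 = ∑ t ∈ u', ‖S.flow L t f‖ ^ 2 := by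
  classical
  refine ⟨u.map (transEquiv e).symm.toEmbedding, ?_⟩
  rw [Finset.sum_map]
  refine Finset.sum_congr rfl fun t _ => ?_
  rw [← S.flow_translate e hX]
  simp

end PathSystem

end Automorphisms

lemma total_mapDomain (φ : V → V) (f : V →₀ ℂ) : total V (f.mapDomain φ) = total V f := by
  rw [total, Finsupp.linearCombination_mapDomain]
  rfl

end RelHyp

/-! ### The Hilbert space and the affine representation -/

namespace RelHyp

universe v

variable {V : Type v} {X : SimpleGraph V}

open SimpleGraph

section Extension

variable {E : Type*} {G : Type*} [Group G] {C : G → ℝ}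

/-- A criterion for an affine representation to be proper. -/
theorem AffineRep.isProperFor_of_denseRange {H : Type*} [NormedAddCommGroup H]
    [InnerProductSpace ℂ H] {e : E → H} (he : DenseRange e) (α : AffineRep G H) {d : G → ℕ} {K : ℝ}
    (hK : 0 ≤ K) (hd : ∀ g x, (d g : ℝ) ≤ K * (‖e x‖ ^ 2 + ‖α.act g (e x)‖ ^ 2)) :
    α.IsProperFor d := by
  intro B hB
  obtain ⟨R, hR⟩ := hB.exists_norm_le
  refine ⟨⌈K * ((R + 1) ^ 2 + (R + 1) ^ 2)⌉₊, fun g hg => ?_⟩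
  obtain ⟨_, ⟨v, hv, rfl⟩, hgv⟩ := hg
  -- An approximation of `v` so close that its image under `α.linear g` is also off by at most `1`.
  have hpos : 0 < 1 / (1 + ‖α.linear g‖) := by positivity
  obtain ⟨x, hx⟩ := he.exists_dist_lt v hpos
  rw [_root_.dist_comm, dist_eq_norm] at hx
  have hle : 1 / (1 + ‖α.linear g‖) ≤ 1 := by
    rw [div_le_one (by positivity)]
    linarith [norm_nonneg (α.linear g)]
  have h1 : ‖e x‖ ≤ R + 1 := by
    have := norm_add_le v (e x - v)
    rw [add_sub_cancel] at this
    linarith [hR v hv]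
  have h2 : ‖α.act g (e x)‖ ≤ R + 1 := by
    have h : α.act g (e x) = α.act g v + α.linear g (e x - v) := by
      simp only [AffineRep.act, map_sub]
      abel
    have h' : ‖α.linear g (e x - v)‖ ≤ 1 := by
      refine ((α.linear g).le_opNorm _).trans ?_
      calc ‖α.linear g‖ * ‖e x - v‖
          ≤ (1 + ‖α.linear g‖) * (1 / (1 + ‖α.linear g‖)) := by gcongr; linarith
        _ = 1 := by field_simp
    rw [h]
    exact (norm_add_le _ _).trans (add_le_add (hR _ hgv) h')
  have h : (d g : ℝ) ≤ K * ((R + 1) ^ 2 + (R + 1) ^ 2) := (hd g x).trans (by gcongr)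
  exact_mod_cast h.trans (Nat.le_ceil _)

variable [AddCommGroup E] [Module ℂ E] {ρ : G → E →ₗ[ℂ] E} {b : G → E}

/-- A linear action with a cocycle on a space mapped densely to a Hilbert space extends to an affine
representation, if the action is by bounded operators. -/
theorem exists_affineRep_of_denseRange {H : Type*} [NormedAddCommGroup H] [InnerProductSpace ℂ H]
    [CompleteSpace H] {e : E →ₗ[ℂ] H} (he : DenseRange e) (h_one : ∀ x, ρ 1 x = x)
    (h_mul : ∀ g h x, ρ (g * h) x = ρ g (ρ h x)) (hb : ∀ g h, b (g * h) = b g + ρ g (b h))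
    (hC : ∀ g, 0 ≤ C g) (hρ : ∀ g x, ‖e (ρ g x)‖ ≤ C g * ‖e x‖) :
    ∃ α : AffineRep G H, (∀ g, ‖α.linear g‖ ≤ C g) ∧ (∀ g, α.cocycle g = e (b g)) ∧
      ∀ g x, α.linear g (e x) = e (ρ g x) := by
  have key : ∀ g x, (e ∘ₗ ρ g).extendOfNorm e (e x) = e (ρ g x) := fun g x =>
    LinearMap.extendOfNorm_eq he ⟨C g, hρ g⟩ x
  refine ⟨⟨⟨⟨fun g => (e ∘ₗ ρ g).extendOfNorm e, ?_⟩, fun g h => ?_⟩, fun g => e (b g),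
    fun g h => ?_⟩, fun g => LinearMap.opNorm_extendOfNorm_le he (hC g) (hρ g), fun g => rfl, key⟩
  · refine ContinuousLinearMap.ext fun y => ?_
    refine he.induction_on y (isClosed_eq (by fun_prop) (by fun_prop)) fun x => ?_
    rw [key, h_one]
    rfl
  · refine ContinuousLinearMap.ext fun y => ?_
    refine he.induction_on y (isClosed_eq (by fun_prop) (by fun_prop)) fun x => ?_
    change (e ∘ₗ ρ (g * h)).extendOfNorm e (e x) =
      (e ∘ₗ ρ g).extendOfNorm e ((e ∘ₗ ρ h).extendOfNorm e (e x))
    rw [key, key, key, h_mul]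
  · change e (b (g * h)) = e (b g) + (e ∘ₗ ρ g).extendOfNorm e (e (b h))
    rw [key, hb, map_add]

/-- The affine representation on the closure of the image of a linear map to a Hilbert space. -/
theorem exists_affineRep {A : Type v} [NormedAddCommGroup A] [InnerProductSpace ℂ A]
    [CompleteSpace A] (J : E →ₗ[ℂ] A) (h_one : ∀ x, ρ 1 x = x)
    (h_mul : ∀ g h x, ρ (g * h) x = ρ g (ρ h x)) (hb : ∀ g h, b (g * h) = b g + ρ g (b h))
    (hC : ∀ g, 0 ≤ C g) (hρ : ∀ g x, ‖J (ρ g x)‖ ≤ C g * ‖J x‖) {d : G → ℕ} {K : ℝ} (hK : 0 ≤ K)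
    (hd : ∀ g x, (d g : ℝ) ≤ K * (‖J x‖ ^ 2 + ‖J (ρ g x) + J (b g)‖ ^ 2)) :
    ∃ (H : Type v) (_ : NormedAddCommGroup H) (_ : InnerProductSpace ℂ H) (_ : CompleteSpace H)
      (α : AffineRep G H), (∀ g, ‖α.linear g‖ ≤ C g) ∧ α.IsProperFor d ∧
        ∀ g, ‖α.cocycle g‖ = ‖J (b g)‖ := by
  let e : E →ₗ[ℂ] (LinearMap.range J).topologicalClosure :=
    J.codRestrict _ fun x => Submodule.le_topologicalClosure _ ⟨x, rfl⟩
  have he : DenseRange e := by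
    intro y
    rw [Topology.IsInducing.subtypeVal.closure_eq_preimage_closure_image]
    have h : (y : A) ∈ closure (LinearMap.range J : Set A) := y.2
    refine closure_mono ?_ h
    rintro _ ⟨x, rfl⟩
    exact ⟨e x, ⟨x, rfl⟩, rfl⟩
  have hcomplete : CompleteSpace (LinearMap.range J).topologicalClosure :=
    (Submodule.isClosed_topologicalClosure _).completeSpace_coe
  obtain ⟨α, h1, h2, h3⟩ := exists_affineRep_of_denseRange he h_one h_mul hb hC hρ
  refine ⟨_, inferInstance, inferInstance, hcomplete, α, h1,
    α.isProperFor_of_denseRange he hK fun g x => ?_, fun g => ?_⟩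
  · rw [AffineRep.act, h2, h3]
    exact hd g x
  · rw [h2]
    rfl

end Extension

/-- The ambient Hilbert space: square summable families indexed by transitions and vertices. -/
abbrev AmbientSpace (V : Type v) : Type v := lp (fun _ : (V × (V → ℤ) × (V → ℤ)) ⊕ V => ℂ) 2

namespace PathSystem

variable {o : V} (S : PathSystem X o) (L : ℕ) (w : V → ℝ)

/-- The flows and the weighted values of a finitely supported function. -/
noncomputable def coord (f : V →₀ ℂ) : (V × (V → ℤ) × (V → ℤ)) ⊕ V → ℂ :=
  Sum.elim (fun t => S.flow L t f) fun v => w v * f v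

lemma memℓp_coord (f : V →₀ ℂ) : Memℓp (S.coord L w f) 2 := by
  refine Memℓp.of_exponent_ge (q := 0) (memℓp_zero ?_) zero_le
  refine ((S.carrier L f).disjSum f.support).finite_toSet.subset ?_
  rintro (t | v) h
  · exact Finset.inl_mem_disjSum.2 (by_contra fun ht => h (S.flow_eq_zero ht))
  · refine Finset.inr_mem_disjSum.2 (Finsupp.mem_support_iff.2 fun hv => h ?_)
    simp [coord, hv]

/-- The embedding of finitely supported functions into the ambient Hilbert space. -/
noncomputable def embed : (V →₀ ℂ) →ₗ[ℂ] AmbientSpace V where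
  toFun f := ⟨S.coord L w f, S.memℓp_coord L w f⟩
  map_add' f g := by
    ext (t | v)
    · exact map_add (S.flow L t) f g
    · exact mul_add (w v : ℂ) (f v) (g v)
  map_smul' c f := by
    ext (t | v)
    · exact map_smul (S.flow L t) c f
    · exact mul_left_comm (w v : ℂ) c (f v)

lemma sum_le_norm_embed_sq (f : V →₀ ℂ) (u : Finset (V × (V → ℤ) × (V → ℤ))) (u' : Finset V) :
    ∑ t ∈ u, ‖S.flow L t f‖ ^ 2 + ∑ v ∈ u', ‖(w v : ℂ) * f v‖ ^ 2 ≤ ‖S.embed L w f‖ ^ 2 := by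
  have h := lp.sum_rpow_le_norm_rpow (p := 2) (by simp) (S.embed L w f) (u.disjSum u')
  rw [Finset.sum_disjSum] at h
  simpa [embed, coord] using h

lemma norm_embed_le {f : V →₀ ℂ} {C : ℝ} (hC : 0 ≤ C)
    (h : ∀ (u : Finset (V × (V → ℤ) × (V → ℤ))) (u' : Finset V),
      ∑ t ∈ u, ‖S.flow L t f‖ ^ 2 + ∑ v ∈ u', ‖(w v : ℂ) * f v‖ ^ 2 ≤ C ^ 2) :
    ‖S.embed L w f‖ ≤ C := by
  refine lp.norm_le_of_forall_sum_le (p := 2) (by simp) hC fun u => ?_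
  rw [← Finset.toLeft_disjSum_toRight (u := u), Finset.sum_disjSum]
  simpa [embed, coord] using h u.toLeft u.toRight

end PathSystem

section Action

variable {G : Type*} [Group G] [MulAction G V]

/-- The automorphism given by an element of a group acting on the graph. -/
def smulIso (hG : ∀ (g : G) (v w : V), X.Adj (g • v) (g • w) ↔ X.Adj v w) (g : G) : X ≃g X where
  toEquiv := MulAction.toPerm g
  map_rel_iff' := hG g _ _

/-- The action on functions of total mass zero. -/
noncomputable def shift (g : G) : LinearMap.ker (total V) →ₗ[ℂ] LinearMap.ker (total V) :=
  (Finsupp.lmapDomain ℂ ℂ (g • · : V → V)).restrict fun f hf => by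
    rw [LinearMap.mem_ker] at hf ⊢
    rw [Finsupp.lmapDomain_apply, total_mapDomain, hf]

lemma coe_shift (g : G) (f : LinearMap.ker (total V)) :
    (shift g f : V →₀ ℂ) = (f : V →₀ ℂ).mapDomain (g • ·) := rfl

lemma shift_one (f : LinearMap.ker (total V)) : shift (1 : G) f = f := by
  ext1
  rw [coe_shift]
  simp only [one_smul]
  exact Finsupp.mapDomain_id

lemma shift_mul (g h : G) (f : LinearMap.ker (total V)) :
    shift (g * h) f = shift g (shift h f) := by
  ext1
  simp only [coe_shift]
  rw [← Finsupp.mapDomain_comp]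
  congr 1
  funext v
  simp [mul_smul]

/-- The difference of the point masses at the images of the base point. -/
noncomputable def deltaDiff (o : V) (g : G) : LinearMap.ker (total V) :=
  ⟨Finsupp.single (g • o) 1 - Finsupp.single o 1, by simp [total]⟩

lemma deltaDiff_mul (o : V) (g h : G) :
    deltaDiff o (g * h) = deltaDiff o g + shift g (deltaDiff o h) := by
  ext1
  simp only [deltaDiff, Submodule.coe_add, coe_shift, sub_eq_add_neg, Finsupp.mapDomain_add,
    ← Finsupp.single_neg, Finsupp.mapDomain_single, mul_smul]
  simp only [Finsupp.single_neg]
  abel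

namespace PathSystem

variable {o : V} (S : PathSystem X o) (hX : X.Connected)
  (hG : ∀ (g : G) (v w : V), X.Adj (g • v) (g • w) ↔ X.Adj v w)
  {D : ℕ} (hT : ThinTriangles X D) {L : ℕ} (hL : 24 * D + 26 ≤ L) {m : ℕ}
  (hm : ∀ e, CardLE (edgeNhd X L e) m) {w : V → ℝ} (hw₀ : ∀ v, 0 ≤ w v) {a : G → ℝ}
  (ha : ∀ g, 0 ≤ a g) (hw : ∀ g v, w (g • v) ≤ (1 + a g) * w v)

include hX hG hT hL hm hw₀ ha hw in
-- The flows of the shifted function are compared by a change of base with those for the translated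
-- system at `g • o`, which are the flows of `f` relabelled. The weighted values grow at most by the
-- factor `1 + a g`.
lemma norm_embed_shift_le (g : G) (f : LinearMap.ker (total V)) :
    ‖S.embed L w (shift g f)‖ ≤
      (baseChangeConst L m + 1) * (1 + X.dist o (g • o) + a g) * ‖S.embed L w f‖ := by
  classical
  set A : ℝ := (baseChangeConst L m + 1) * (1 + X.dist o (g • o) + a g) with hA
  have hC0 : (0 : ℝ) ≤ baseChangeConst L m := Nat.cast_nonneg _
  have hN0 : (0 : ℝ) ≤ X.dist o (g • o) := Nat.cast_nonneg _
  have hag := ha g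
  have hA1 : baseChangeConst L m * (1 + X.dist o (g • o)) ≤ A := by
    rw [hA]
    nlinarith [mul_nonneg hC0 hag]
  have hA2 : 1 + a g ≤ A := by
    rw [hA]
    nlinarith [mul_nonneg hC0 hag, mul_nonneg hC0 hN0]
  have hA0 : 0 ≤ A := by positivity
  rw [coe_shift]
  refine S.norm_embed_le L w (by positivity) fun u u' => ?_
  set e := smulIso hG g
  have hf0 : total V ((f : V →₀ ℂ).mapDomain e) = 0 := by rw [total_mapDomain]; exact f.2
  have h1 := (S.translate e hX).sum_norm_flow_sq_le S hX hT hL hm hf0 u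
  obtain ⟨t, ht⟩ := S.sum_norm_flow_translate_le e hX L f
    ((S.translate e hX).carrier L ((f : V →₀ ℂ).mapDomain e))
  rw [ht, show e o = g • o from rfl, X.dist_comm] at h1
  have h2 : ∑ v ∈ u', ‖(w v : ℂ) * (f : V →₀ ℂ).mapDomain (g • ·) v‖ ^ 2 ≤
      (1 + a g) ^ 2 * ∑ v ∈ u'.image (g⁻¹ • ·), ‖(w v : ℂ) * (f : V →₀ ℂ) v‖ ^ 2 := by
    rw [Finset.sum_image (MulAction.injective g⁻¹).injOn, Finset.mul_sum]
    refine Finset.sum_le_sum fun v _ => ?_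
    have hv : (f : V →₀ ℂ).mapDomain (g • ·) v = (f : V →₀ ℂ) (g⁻¹ • v) := by
      have := Finsupp.mapDomain_apply (MulAction.injective g) (f : V →₀ ℂ) (g⁻¹ • v)
      rwa [smul_inv_smul] at this
    have hwv := hw g (g⁻¹ • v)
    rw [smul_inv_smul] at hwv
    rw [hv, ← mul_pow, norm_mul, norm_mul, Complex.norm_real, Complex.norm_real, ← mul_assoc,
      Real.norm_of_nonneg (hw₀ _), Real.norm_of_nonneg (hw₀ _)]
    have := hw₀ v
    gcongr
  have h3 := S.sum_le_norm_embed_sq L w f t (u'.image (g⁻¹ • ·))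
  calc _ ≤ A ^ 2 * ∑ t ∈ t, ‖S.flow L t f‖ ^ 2 +
        A ^ 2 * ∑ v ∈ u'.image (g⁻¹ • ·), ‖(w v : ℂ) * (f : V →₀ ℂ) v‖ ^ 2 := by
        refine add_le_add (h1.trans ?_) (h2.trans ?_)
        · gcongr
        · gcongr
    _ ≤ _ := by
        rw [← mul_add, mul_pow A]
        exact mul_le_mul_of_nonneg_left h3 (sq_nonneg A)

include hX hG hT hL hm in
-- Twice the product of `z` with `g⁻¹ • o` is `dist o z - dist o (g • z) + N`; for `g • z` and `g •
-- o` it is `dist o (g • z) - dist o z + N`. Added up they are constant, which mass zero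
-- annihilates, so only the cocycle contributes, and it contributes `2 * N`. As each functional has
-- squared norm of order `N`, one factor `N` survives.
lemma dist_le_norm_sq (g : G) (f : LinearMap.ker (total V)) :
    (X.dist o (g • o) : ℝ) ≤ gromovConst L m * (‖S.embed L w f‖ ^ 2 +
      ‖S.embed L w (shift g f + deltaDiff o g : LinearMap.ker (total V))‖ ^ 2) := by
  set N := X.dist o (g • o) with hN
  have hdist : ∀ x y : V, X.dist (g • x) (g • y) = X.dist x y := dist_apply (smulIso hG g) hX
  have hN' : X.dist o (g⁻¹ • o) = N := by
    rw [← hdist, smul_inv_smul, X.dist_comm]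
  have bound : ∀ (y : V) (φ : LinearMap.ker (total V)), X.dist o y = N →
      ‖Finsupp.linearCombination ℂ (fun z => (gromov X o y z : ℂ)) (φ : V →₀ ℂ)‖ ^ 2 ≤
        gromovConst L m * N * ‖S.embed L w φ‖ ^ 2 := by
    intro y φ hy
    have h1 := S.norm_gromov_sq_le hX hT hL hm (f := φ) φ.2 y
    rw [hy] at h1
    refine h1.trans (mul_le_mul_of_nonneg_left ?_ (by positivity))
    simpa using S.sum_le_norm_embed_sq L w φ (S.carrier L φ) ∅
  have b1 := bound (g⁻¹ • o) f hN'
  have b2 := bound (g • o) (shift g f + deltaDiff o g) rfl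
  have cast_gromov : ∀ y z : V, X.dist o y = N →
      (gromov X o y z : ℂ) = X.dist o z + N - X.dist y z := by
    intro y z hy
    have := gromov_eq hX o y z
    rw [hy] at this
    exact_mod_cast congrArg (Int.cast (R := ℂ)) this
  have hsum : Finsupp.linearCombination ℂ (fun z => (gromov X o (g⁻¹ • o) z : ℂ)) (f : V →₀ ℂ) +
      Finsupp.linearCombination ℂ (fun z => (gromov X o (g • o) z : ℂ))
        ((shift g f + deltaDiff o g : LinearMap.ker (total V)) : V →₀ ℂ) = 2 * N := by
    have h0 : total V f = 0 := f.2
    have e1 : Finsupp.linearCombination ℂ (fun z => (gromov X o (g⁻¹ • o) z : ℂ)) (f : V →₀ ℂ) +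
        Finsupp.linearCombination ℂ (fun z => (gromov X o (g • o) z : ℂ)) (shift g f : V →₀ ℂ) =
          (2 * N : ℂ) * total V f := by
      rw [coe_shift, Finsupp.linearCombination_mapDomain]
      simp only [total, Finsupp.linearCombination_apply, Finsupp.sum, Function.comp_apply,
        ← Finset.sum_add_distrib, Finset.mul_sum, smul_eq_mul]
      refine Finset.sum_congr rfl fun z _ => ?_
      rw [cast_gromov _ _ hN', cast_gromov _ _ rfl, hdist,
        show X.dist (g⁻¹ • o) z = X.dist o (g • z) by rw [← hdist, smul_inv_smul]]
      ring
    have e2 : Finsupp.linearCombination ℂ (fun z => (gromov X o (g • o) z : ℂ))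
        (deltaDiff o g : V →₀ ℂ) = 2 * N := by
      simp only [deltaDiff, map_sub, Finsupp.linearCombination_single, smul_eq_mul, one_mul]
      rw [cast_gromov _ _ rfl, cast_gromov _ _ rfl, X.dist_self, X.dist_self,
        X.dist_comm (u := g • o), ← hN]
      push_cast
      ring
    rw [Submodule.coe_add, map_add, ← add_assoc, e1, h0, e2, mul_zero, zero_add]
  rcases Nat.eq_zero_or_pos N with h0 | hpos
  · rw [h0, Nat.cast_zero]
    positivity
  · have h := norm_add_le
      (Finsupp.linearCombination ℂ (fun z => (gromov X o (g⁻¹ • o) z : ℂ)) (f : V →₀ ℂ))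
      (Finsupp.linearCombination ℂ (fun z => (gromov X o (g • o) z : ℂ))
        ((shift g f + deltaDiff o g : LinearMap.ker (total V)) : V →₀ ℂ))
    rw [hsum, norm_mul, Complex.norm_natCast, Complex.norm_ofNat] at h
    have hpos' : (0 : ℝ) < N := by exact_mod_cast hpos
    set A := ‖Finsupp.linearCombination ℂ (fun z => (gromov X o (g⁻¹ • o) z : ℂ)) (f : V →₀ ℂ)‖
    set B := ‖Finsupp.linearCombination ℂ (fun z => (gromov X o (g • o) z : ℂ))
        ((shift g f + deltaDiff o g : LinearMap.ker (total V)) : V →₀ ℂ)‖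
    -- Both squares on the right are bounded by multiples of `N`, so a factor `N` cancels.
    have h4 : (2 * (N : ℝ)) ^ 2 ≤ 2 * (A ^ 2 + B ^ 2) := by
      calc (2 * (N : ℝ)) ^ 2 ≤ (A + B) ^ 2 := pow_le_pow_left₀ (by positivity) h 2
        _ ≤ _ := by nlinarith [sq_nonneg (A - B)]
    have h5 : (N : ℝ) * N ≤ (gromovConst L m * (‖S.embed L w f‖ ^ 2 +
      ‖S.embed L w (shift g f + deltaDiff o g : LinearMap.ker (total V))‖ ^ 2)) * N := by nlinarith
    exact le_of_mul_le_mul_right h5 hpos'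

include hw₀ in
-- The weighted coordinate of the cocycle at the vertex `g • o` already has this size.
lemma le_norm_embed_deltaDiff {g : G} (hg : g • o ≠ o) :
    w (g • o) ≤ ‖S.embed L w (deltaDiff o g)‖ := by
  have h := S.sum_le_norm_embed_sq L w (deltaDiff o g) ∅ {g • o}
  have e : (deltaDiff o g : V →₀ ℂ) (g • o) = 1 := by
    simp [deltaDiff, hg.symm]
  rw [Finset.sum_empty, zero_add, Finset.sum_singleton, e, mul_one, Complex.norm_real,
    Real.norm_of_nonneg (hw₀ _)] at h
  exact le_of_sq_le_sq h (norm_nonneg _)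

end PathSystem

end Action

end RelHyp

namespace RelHyp

universe v

open SimpleGraph

/-- A group acting on a hyperbolic uniformly fine graph has an affine representation, with linear
part of linear growth, which is proper for the metric of the graph and whose cocycle dominates a
given weight. -/
theorem exists_affineRep_of_action {V : Type v} {X : SimpleGraph V} {G : Type*} [Group G]
    [MulAction G V] (hyp : IsHyperbolic X) (fine : IsUniformlyFine X)
    (hG : ∀ (g : G) (v w : V), X.Adj (g • v) (g • w) ↔ X.Adj v w) (o : V) {w : V → ℝ}
    (hw₀ : ∀ v, 0 ≤ w v) {a : G → ℝ} (ha : ∀ g, 0 ≤ a g)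
    (hw : ∀ g v, w (g • v) ≤ (1 + a g) * w v) :
    ∃ (H : Type v) (_ : NormedAddCommGroup H) (_ : InnerProductSpace ℂ H) (_ : CompleteSpace H)
      (α : AffineRep G H),
      (∃ K : ℝ, 0 < K ∧ ∀ g, ‖α.linear g‖ ≤ K * (1 + X.dist o (g • o) + a g)) ∧
      α.IsProperFor (fun g => X.dist o (g • o)) ∧
      ∀ g : G, g • o ≠ o → w (g • o) ≤ ‖α.cocycle g‖ := by
  obtain ⟨δ, -, hδ⟩ := hyp
  obtain ⟨φ, hφ⟩ := fine
  have hX := hδ.1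
  have hT := hδ.thinTriangles
  obtain ⟨S⟩ := exists_pathSystem hX o
  obtain ⟨L, hL⟩ : ∃ L, 24 * ⌈δ⌉₊ + 26 ≤ L := ⟨_, le_rfl⟩
  have hm := cardLE_edgeNhd hφ L
  obtain ⟨A, _, _, _, J, hJ⟩ : ∃ (A : Type v) (_ : NormedAddCommGroup A)
      (_ : InnerProductSpace ℂ A) (_ : CompleteSpace A) (J : LinearMap.ker (total V) →ₗ[ℂ] A),
      ∀ f : LinearMap.ker (total V), ‖J f‖ = ‖S.embed L w f‖ :=
    ⟨AmbientSpace V, inferInstance, inferInstance, inferInstance,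
      (S.embed L w).domRestrict _, fun f => rfl⟩
  have hρ := fun (g : G) f => S.norm_embed_shift_le hX hG hT hL hm hw₀ ha hw g f
  have hc := fun (g : G) (hg : g • o ≠ o) => S.le_norm_embed_deltaDiff (L := L) hw₀ hg
  have hd : ∀ (g : G) f, (X.dist o (g • o) : ℝ) ≤ PathSystem.gromovConst L (1 + φ L * L) *
      (‖J f‖ ^ 2 + ‖J (shift g f) + J (deltaDiff o g)‖ ^ 2) := by
    intro g f
    rw [← map_add, hJ, hJ]
    exact S.dist_le_norm_sq hX hG hT hL hm g f
  simp only [← hJ] at hρ hc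
  obtain ⟨K, hK, hK₀⟩ : ∃ K : ℝ, K = PathSystem.baseChangeConst L (1 + φ L * L) + 1 ∧ 0 < K :=
    ⟨_, rfl, by positivity⟩
  obtain ⟨K', hK', hK₀'⟩ : ∃ K' : ℝ, K' = PathSystem.gromovConst L (1 + φ L * L) ∧ 0 ≤ K' :=
    ⟨_, rfl, by positivity⟩
  rw [← hK] at hρ
  rw [← hK'] at hd
  obtain ⟨H, i₁, i₂, i₃, α, h1, h2, h3⟩ := exists_affineRep (E := LinearMap.ker (total V)) J
    (ρ := fun g : G => shift g) (b := deltaDiff o) (C := fun g => K * (1 + X.dist o (g • o) + a g))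
    (d := fun g => X.dist o (g • o)) shift_one shift_mul (deltaDiff_mul o)
    (fun g => by have := ha g; positivity) (fun g f => hρ g f) hK₀'
    (by intro g f; exact hd g f)
  refine ⟨H, i₁, i₂, i₃, α, ⟨K, hK₀, h1⟩, h2, fun g hg => ?_⟩
  rw [h3]
  exact hc g hg

/-! ### Coned-off graphs and the choice of generators -/

section ConedOff

variable {G : Type*} [Group G] {k : ℕ} {P : Fin k → Subgroup G}

lemma conedOffGraph_adj_smul (S : Set G) (g : G) (v w : ConedOffVertex P) :
    (conedOffGraph S P).Adj (g • v) (g • w) ↔ (conedOffGraph S P).Adj v w := by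
  have key : ∀ (i : Fin k) (h : G) (c : G ⧸ P i),
      (QuotientGroup.mk (g * h) : G ⧸ P i) = g • c ↔ (QuotientGroup.mk h : G ⧸ P i) = c :=
    fun i h c => smul_left_cancel_iff (x := (QuotientGroup.mk h : G ⧸ P i)) g
  rcases v with v | c <;> rcases w with w | d
  · change (g * v ≠ g * w ∧ ((g * v)⁻¹ * (g * w) ∈ S ∨ (g * w)⁻¹ * (g * v) ∈ S)) ↔
      (v ≠ w ∧ (v⁻¹ * w ∈ S ∨ w⁻¹ * v ∈ S))
    simp [mul_assoc]
  · exact key d.1 v d.2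
  · exact key c.1 w c.2
  · exact Iff.rfl

lemma conedOffGraph_adj_mul {S : Set G} {g s : G} (hs : s ∈ S) (h : g ≠ g * s) :
    (conedOffGraph S P).Adj (Sum.inl g) (Sum.inl (g * s)) :=
  ⟨h, Or.inl (by simpa using hs)⟩

lemma conedOffGraph_reachable {S : Set G} (hS : Subgroup.closure S = ⊤) (g : G) :
    (conedOffGraph S P).Reachable (Sum.inl 1) (Sum.inl g) := by
  have hstep : ∀ g s : G, s ∈ S → (conedOffGraph S P).Reachable (Sum.inl g) (Sum.inl (g * s)) := by
    intro g s hs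
    by_cases h : g = g * s
    · rw [← h]
    · exact (conedOffGraph_adj_mul hs h).reachable
  have hg : g ∈ Subgroup.closure S := hS ▸ Subgroup.mem_top g
  induction hg using Subgroup.closure_induction_right with
  | one => rfl
  | mul_right x _ y hy ih => exact ih.trans (hstep x y hy)
  | mul_inv_cancel x _ y hy ih =>
    have := hstep (x * y⁻¹) y hy
    rw [inv_mul_cancel_right] at this
    exact ih.trans this.symm

lemma conedOffGraph_connected {S : Set G} (hS : Subgroup.closure S = ⊤) :
    (conedOffGraph S P).Connected := by
  have h : ∀ v, (conedOffGraph S P).Reachable (Sum.inl 1) v := by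
    rintro (g | ⟨i, c⟩)
    · exact conedOffGraph_reachable hS g
    · obtain ⟨g, rfl⟩ := QuotientGroup.mk_surjective c
      have hadj : (conedOffGraph S P).Adj (Sum.inl g) (Sum.inr ⟨i, QuotientGroup.mk g⟩) := rfl
      exact (conedOffGraph_reachable hS g).trans hadj.reachable
  exact connected_iff_exists_forall_reachable _ |>.2 ⟨_, h⟩

lemma conedOffGraph_dist_smul {S : Set G} (hS : Subgroup.closure S = ⊤) (g : G)
    (v w : ConedOffVertex P) :
    (conedOffGraph S P).dist (g • v) (g • w) = (conedOffGraph S P).dist v w :=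
  dist_apply (smulIso (conedOffGraph_adj_smul S) g) (conedOffGraph_connected hS) v w

lemma isLengthFunction_conedOffLength {S : Set G} (hS : Subgroup.closure S = ⊤)
    (P : Fin k → Subgroup G) : IsLengthFunction fun g => (conedOffLength S P g : ℝ) where
  nonneg g := Nat.cast_nonneg _
  inv g := by
    have h := conedOffGraph_dist_smul (P := P) hS g (Sum.inl 1) (Sum.inl g⁻¹)
    simp only [Sum.smul_inl, smul_eq_mul, mul_one, mul_inv_cancel] at h
    simp only [conedOffLength]
    rw [← h, SimpleGraph.dist_comm]
  mul_le g h := by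
    have h1 := conedOffGraph_dist_smul (P := P) hS g (Sum.inl 1) (Sum.inl h)
    simp only [Sum.smul_inl, smul_eq_mul, mul_one] at h1
    have h2 := (conedOffGraph_connected (P := P) hS).dist_triangle (u := Sum.inl 1)
      (v := Sum.inl g) (w := Sum.inl (g * h))
    rw [h1] at h2
    exact_mod_cast h2

/-- The coned-off metrics for two finite generating sets are comparable. -/
lemma exists_dist_le_mul {S : Set G} (hS : Subgroup.closure S = ⊤) {S₀ : Finset G}
    (hS₀ : Subgroup.closure (S₀ : Set G) = ⊤) (P : Fin k → Subgroup G) : ∃ C : ℕ, ∀ g,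
      conedOffLength S P g ≤ C * conedOffLength (S₀ : Set G) P g := by
  set X := conedOffGraph S P
  set X₀ := conedOffGraph (S₀ : Set G) P
  have hX : X.Connected := conedOffGraph_connected hS
  refine ⟨1 + ∑ s ∈ S₀, conedOffLength S P s, fun g => ?_⟩
  set C := 1 + ∑ s ∈ S₀, conedOffLength S P s with hC
  have hstep : ∀ g h : G, g⁻¹ * h ∈ S₀ → X.dist (Sum.inl g) (Sum.inl h) ≤ C := by
    intro g h hs
    have h1 := conedOffGraph_dist_smul (P := P) hS g (Sum.inl 1) (Sum.inl (g⁻¹ * h))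
    simp only [Sum.smul_inl, smul_eq_mul, mul_one, mul_inv_cancel_left] at h1
    rw [h1]
    exact (Finset.single_le_sum (f := conedOffLength S P) (fun _ _ => Nat.zero_le _) hs).trans
      (Nat.le_add_left _ _)
  -- Edges at cone vertices are common to both graphs; only those given by `S₀` need the sum in `C`.
  have hadj : ∀ v w, X₀.Adj v w → X.dist v w ≤ C := by
    rintro (v | c) (w | d) h
    · rcases h.2 with h | h
      · exact hstep v w h
      · rw [SimpleGraph.dist_comm]
        exact hstep w v h
    · have h' : X.Adj (Sum.inl v) (Sum.inr d) := h
      exact (dist_eq_one_iff_adj.2 h').le.trans (Nat.le_add_right _ _)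
    · have h' : X.Adj (Sum.inr c) (Sum.inl w) := h
      exact (dist_eq_one_iff_adj.2 h').le.trans (Nat.le_add_right _ _)
    · exact absurd h id
  have hwalk : ∀ v w (p : X₀.Walk v w), X.dist v w ≤ C * p.length := by
    intro v w p
    induction p with
    | nil => simp
    | @cons u v w h p ih =>
      have h1 := hX.dist_triangle (u := u) (v := v) (w := w)
      have h2 := hadj _ _ h
      rw [Walk.length_cons, mul_add]
      omega
  obtain ⟨p, hp⟩ := (conedOffGraph_connected (P := P) hS₀).exists_walk_length_eq_dist
    (Sum.inl 1) (Sum.inl g)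
  have := hwalk _ _ p
  rwa [hp] at this

lemma AffineRep.IsProperFor.mono {H : Type*} [NormedAddCommGroup H] [InnerProductSpace ℂ H]
    {α : AffineRep G H} {d d' : G → ℕ} (h : α.IsProperFor d) {C : ℕ}
    (hd : ∀ g, d' g ≤ C * d g) : α.IsProperFor d' := by
  intro B hB
  obtain ⟨R, hR⟩ := h B hB
  exact ⟨C * R, fun g hg => (hd g).trans (Nat.mul_le_mul_left C (hR g hg))⟩

end ConedOff

end RelHyp


theorem theorem1p5 {G : Type u} [Group G] {k : ℕ} (P : Fin k → Subgroup G)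
    (hG : RelHyp.IsRelativelyHyperbolic G P)
    (hP : ∀ i, Infinite (G ⧸ P i))
    (S : Finset G) (hS : Subgroup.closure (S : Set G) = ⊤) :
    ∃ (H : Type u) (_ : NormedAddCommGroup H) (_ : InnerProductSpace ℂ H) (_ : CompleteSpace H)
      (α : RelHyp.AffineRep G H),
      (∃ (l : G → ℝ) (Q : ℝ[X]), RelHyp.IsLengthFunction l ∧ Q.natDegree = 2 ∧
        ∀ g : G, ‖α.linear g‖ ≤ Q.eval (l g)) ∧
      α.IsProperFor (RelHyp.conedOffLength (S : Set G) P) ∧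
      ∀ g : G, g ≠ 1 → (RelHyp.conedOffLength (S : Set G) P g : ℝ) + 1 ≤ ‖α.cocycle g‖ := by
  obtain ⟨S₀, hS₀, hyp, fine⟩ := hG
  have hl := RelHyp.isLengthFunction_conedOffLength hS P
  have hl₀ := RelHyp.isLengthFunction_conedOffLength hS₀ P
  have hX := RelHyp.conedOffGraph_connected (P := P) hS
  have hsmul : ∀ g : G, g • (Sum.inl 1 : RelHyp.ConedOffVertex P) = Sum.inl g := fun g => by
    simp [Sum.smul_inl]
  obtain ⟨C, hC⟩ := RelHyp.exists_dist_le_mul hS hS₀ P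
  -- Hyperbolicity and fineness are known for `S₀`, while the weight uses the metric of `S`, in
  -- which the lower bound on the cocycle is wanted.
  obtain ⟨H, i₁, i₂, i₃, α, ⟨K, hK, h1⟩, h2, h3⟩ := RelHyp.exists_affineRep_of_action hyp fine
    (RelHyp.conedOffGraph_adj_smul (S₀ : Set G)) (Sum.inl 1)
    (w := fun v => ((RelHyp.conedOffGraph (S : Set G) P).dist (Sum.inl 1) v : ℝ) + 1)
    (fun v => by positivity) (a := fun g => (RelHyp.conedOffLength (S : Set G) P g : ℝ))
    hl.nonneg (fun g v => by
      have t := hX.dist_triangle (u := Sum.inl 1) (v := g • Sum.inl 1) (w := g • v)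
      rw [RelHyp.conedOffGraph_dist_smul hS, hsmul] at t
      have t' : ((RelHyp.conedOffGraph (S : Set G) P).dist (Sum.inl 1) (g • v) : ℝ) ≤
          RelHyp.conedOffLength (S : Set G) P g +
            (RelHyp.conedOffGraph (S : Set G) P).dist (Sum.inl 1) v := by exact_mod_cast t
      have h0 : (0 : ℝ) ≤ RelHyp.conedOffLength (S : Set G) P g *
        (RelHyp.conedOffGraph (S : Set G) P).dist (Sum.inl 1) v := by positivity
      linarith)
  simp only [hsmul] at h1 h2 h3
  -- The linear part grows at most linearly in the sum of the two lengths; the quadratic term only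
  -- raises the degree to `2`.
  refine ⟨H, i₁, i₂, i₃, α, ⟨fun g => RelHyp.conedOffLength (S₀ : Set G) P g +
    RelHyp.conedOffLength (S : Set G) P g, Polynomial.C K * Polynomial.X ^ 2 +
      Polynomial.C K * Polynomial.X + Polynomial.C K, ⟨fun g => ?_, fun g => ?_, fun g h => ?_⟩,
        Polynomial.natDegree_quadratic hK.ne', fun g => ?_⟩, h2.mono hC, fun g hg => ?_⟩
  · positivity
  · exact congrArg₂ (· + ·) (hl₀.inv g) (hl.inv g)
  · have t1 := hl₀.mul_le g h
    have t2 := hl.mul_le g h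
    exact (add_le_add t1 t2).trans_eq (by ring)
  · refine (h1 g).trans ?_
    simp only [Polynomial.eval_add, Polynomial.eval_mul, Polynomial.eval_C, Polynomial.eval_pow,
      Polynomial.eval_X]
    change K * (1 + (RelHyp.conedOffLength (S₀ : Set G) P g : ℝ) + _) ≤ _
    nlinarith [mul_nonneg hK.le (sq_nonneg ((RelHyp.conedOffLength (S₀ : Set G) P g : ℝ) +
      RelHyp.conedOffLength (S : Set G) P g))]
  · exact h3 g fun h => hg (Sum.inl_injective h)
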